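/- **Flow Combining Lemma.** *Conventions.* A *flow* on $\mathbb{R}^d$ is a family $v=\{v_t\}_{t\in[0,1]}$ of vector fields $v_t:\mathbb{R}^d\to\mathbb{R}^d$. Its trajectory from $x_1\in\mathbb{R}^d$ is the solution on $[0,1]$ of $\frac{dx_t}{dt}=-v_t(x_t)$ with value $x_1$ at time $t=1$, in the integrated (Carathéodory) sense: $s\mapsto v_s(x_s)$ is integrable on $[0,1]$ and $x_t=x_1+\int_t^1 v_s(x_s)\,ds$ for all $t\in[0,1]$. Say that the flow ODE of $v$ is *well posed at $x_1$* if exactly one such solution exists; then $\mathrm{RunFlow}(v,x_1,t)$ denotes its value at time $t$. For a probability measure $q$ such that the ODE is well posed at $q$-almost every $x_1$ and $x_1\mapsto\mathrm{RunFlow}(v,x_1,0)$ is $q$-measurable, let $v(q)$ be the law of $\mathrm{RunFlow}(v,x_1,0)$ for $x_1\sim q$; we say that $v$ *transports* $q$ to $p$ if moreover $v(q)=p$. *Random flows.* Let $(v,x_1)$ be a random flow together with a random initial point, defined on a probability space, and put $x_t:=\mathrm{RunFlow}(v,x_1,t)$ and $w_t:=v_t(x_t)$. Assume throughout that $v_t(x)$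 is jointly measurable in the random parameter, $t$ and $x$; that almost surely the ODE of $v$ is well posed at $x_1$; that each $x_t$ is a random variable; and that $\int_0^1\mathbb{E}\|w_t\|\,dt<\infty$. A *marginal flow* is a jointly measurable field $(t,x)\mapsto v^*_t(x)$ such that, for almost every $t\in[0,1]$, $$v^*_t(x_t)=\mathbb{E}[w_t\mid x_t]=\mathbb{E}[v_t(x_t)\mid x_t]\quad\text{almost surely.}$$ **(a)** Let $\Gamma$ be a distribution over pairs $(v,q_v)$ of a flow and an initial probability distribution on $\mathbb{R}^d$ (a probability space with a random flow $v$ and a Markov kernel $q_v$), and let $(v,q_v)\sim\Gamma$, $x_1\sim q_v$, under the assumptions above. Then a marginal flow $v^*$ exists, and every marginal flow $v^*$ whose ODE is well posed at $\mathbb{E}[q_v]$-almost every initial point transports the mixture $\mathbb{E}[q_v]$ to the mixture $\mathbb{E}[v(q_v)]$. **(b)** In particular, let $q,p$ be probability measures on $\mathbb{R}^d$, let $\Pi$ be a coupling of $q$ and $p$, and for points $x_1,x_0$ let $u^{x_1,x_0}$ be a flow such that, for $\Pi$-almost every $(x_1,x_0)$, it is a pointwise flow from $x_1$ to $x_0$,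 that is, its ODE is well posed at $x_1$ and $\mathrm{RunFlow}(u^{x_1,x_0},x_1,0)=x_0$. Let $(x_1,x_0)\sim\Pi$ and $v:=u^{x_1,x_0}$, under the assumptions above. Then a marginal flow $v^*$ exists, i.e. $v^*_t(x_t)=\mathbb{E}[u^{x_1,x_0}_t(x_t)\mid x_t]$ with $x_t=\mathrm{RunFlow}(u^{x_1,x_0},x_1,t)$, and every marginal flow $v^*$ whose ODE is well posed at $q$-almost every initial point transports $q$ to $p$. -/

import Mathlib

open MeasureTheory ProbabilityTheory Set

/-- A flow on `ℝᵈ`: a family of vector fields `v t : ℝᵈ → ℝᵈ` indexed by time.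
Only the times `t ∈ [0, 1]` matter. -/
abbrev FlowField (d : ℕ) : Type :=
  ℝ → EuclideanSpace ℝ (Fin d) → EuclideanSpace ℝ (Fin d)

/-- `γ` solves `dγ/dt = - v t (γ t)` on `[0, 1]` with initial condition `γ 1 = x₁` at time `1`,
in integrated form (Carathéodory solution):
`γ t = x₁ + ∫_t^1 v s (γ s) ds`, with `s ↦ v s (γ s)` integrable on `[0, 1]`. -/
def IsTrajectory {d : ℕ} (v : FlowField d) (x₁ : EuclideanSpace ℝ (Fin d))
    (γ : ℝ → EuclideanSpace ℝ (Fin d)) : Prop :=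
  IntervalIntegrable (fun s => v s (γ s)) volume 0 1 ∧
    ∀ t ∈ Icc (0 : ℝ) 1, γ t = x₁ + ∫ s in t..1, v s (γ s)

/-- The flow ODE has exactly one solution on `[0, 1]` starting from `x₁` at time `1`. -/
def WellPosedAt {d : ℕ} (v : FlowField d) (x₁ : EuclideanSpace ℝ (Fin d)) : Prop :=
  (∃ γ, IsTrajectory v x₁ γ) ∧
    ∀ γ γ', IsTrajectory v x₁ γ → IsTrajectory v x₁ γ' → EqOn γ γ' (Icc 0 1)

open Classical in
/-- `runFlow v x₁ t` is the value at time `t ∈ [0, 1]` of the solution of the flow ODE started from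
`x₁` at time `1`. It is meaningful where `WellPosedAt v x₁` holds. -/
noncomputable def runFlow {d : ℕ} (v : FlowField d) (x₁ : EuclideanSpace ℝ (Fin d)) (t : ℝ) :
    EuclideanSpace ℝ (Fin d) :=
  if h : ∃ γ, IsTrajectory v x₁ γ then h.choose t else x₁

/-- The final distribution `v(q)` obtained by transporting the initial distribution `q` along `v`
from time `1` to time `0`. -/
noncomputable def finalLaw {d : ℕ} (v : FlowField d) (q : Measure (EuclideanSpace ℝ (Fin d))) :
    Measure (EuclideanSpace ℝ (Fin d)) :=
  q.map (fun x₁ => runFlow v x₁ 0)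

/-- The flow `v` transports `q` to `p`: for `q`-almost every initial point the flow ODE has a unique
solution, its final point is a random variable under `q`, and the law of this variable is `p`. -/
def Transports {d : ℕ} (v : FlowField d) (q p : Measure (EuclideanSpace ℝ (Fin d))) : Prop :=
  (∀ᵐ x₁ ∂q, WellPosedAt v x₁) ∧ AEMeasurable (fun x₁ => runFlow v x₁ 0) q ∧ finalLaw v q = p

/-- A pointwise flow between `x₁` and `x₀`: its trajectory from `x₁` at time `1` ends
in `x₀` at time `0`. -/
def IsPointwiseFlow {d : ℕ} (v : FlowField d) (x₁ x₀ : EuclideanSpace ℝ (Fin d)) : Prop :=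
  WellPosedAt v x₁ ∧ runFlow v x₁ 0 = x₀

/-- The joint law, on `(ℝᵈ)³`, of `(x₁, x_t, w_t)`, where `x₁ = X s` and `v = V s` are random,
`x_t = runFlow v x₁ t` and `w_t = v t x_t`. -/
noncomputable def jointLaw {d : ℕ} {S : Type*} [MeasurableSpace S] (P : Measure S)
    (V : S → FlowField d) (X : S → EuclideanSpace ℝ (Fin d)) (t : ℝ) :
    Measure (EuclideanSpace ℝ (Fin d) × EuclideanSpace ℝ (Fin d) × EuclideanSpace ℝ (Fin d)) :=
  P.map (fun s => (X s, runFlow (V s) (X s) t, V s t (runFlow (V s) (X s) t)))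

/-- `vs` is a (jointly measurable version of the) marginal flow: for almost every time `t ∈ [0, 1]`,
`vs t x_t = 𝔼[w_t | x_t]` almost surely under the joint law of `(x₁, x_t, w_t)`. -/
def IsMarginalFlow {d : ℕ} {S : Type*} [MeasurableSpace S] (P : Measure S)
    (V : S → FlowField d) (X : S → EuclideanSpace ℝ (Fin d)) (vs : FlowField d) : Prop :=
  Measurable (fun z : ℝ × EuclideanSpace ℝ (Fin d) => vs z.1 z.2) ∧
    ∀ᵐ t ∂(volume.restrict (Icc (0 : ℝ) 1)),
      (fun z => vs t z.2.1) =ᵐ[jointLaw P V X t]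
        (jointLaw P V X t)[fun z => z.2.2 |
          MeasurableSpace.comap (fun z => z.2.1) inferInstance]

/-- Standing conventions on a random flow `V` with random initial point `X`: the velocity
`V s t x` is jointly measurable, the flow ODE almost surely has a unique solution, each position
`x_t` is a random variable, and `∫₀¹ 𝔼 ‖w_t‖ dt < ∞`. -/
structure IsRegularRandomFlow {d : ℕ} {S : Type*} [MeasurableSpace S] (P : Measure S)
    (V : S → FlowField d) (X : S → EuclideanSpace ℝ (Fin d)) : Prop where
  measurable_velocity :
    Measurable (fun z : S × ℝ × EuclideanSpace ℝ (Fin d) => V z.1 z.2.1 z.2.2)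
  wellPosed : ∀ᵐ s ∂P, WellPosedAt (V s) (X s)
  aemeasurable_position : ∀ t ∈ Icc (0 : ℝ) 1, AEMeasurable (fun s => runFlow (V s) (X s) t) P
  integrable_velocity :
    ∫⁻ t in Icc (0 : ℝ) 1, ∫⁻ z, ‖z.2.2‖ₑ ∂(jointLaw P V X t) < ⊤

/-! Both parts are instances of one statement, `IsMarginalFlow.transports`: a well posed marginal
flow carries the law of the random initial point to the law of the final point of the random flow.
In (a) the probability space is `Γ ⊗ₘ q`, in (b) it is the coupling; there it only remains to
recognise the two laws.

Reverse time, so that positions `y` with velocity `w` run forward from the initial point, and let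
`b` be the mean of `w` given the position. The heart is a superposition principle: some law on paths
has the same initial and final laws as `y`, and almost every path solves the ODE of `b`. Uniqueness
then identifies the end of such a path with the flow map applied to its start, so the flow map
pushes the initial law to the final one.

As `b` is merely measurable and integrable along `y`, the paths are built from Markov chains. On the
grid of mesh `2⁻ⁿ`, let the transitions be the conditional laws of `y` at one grid time given `y` at
the preceding one; the chain then has the one-time laws of `y` on the grid (`exists_dyadic_chain`).
Its displacement minus the sum of its conditional mean steps is a martingale. Once steps larger than
`2⁻ⁿ K` are cut off, its increments are orthogonal and of size `O(2⁻ⁿ K)`, and there are `O(2ⁿ)` of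
them, so it is of size `O(2^(-n/2) K)`; the steps cut off are negligible because `w` is integrable.
By contraction of conditional expectation, the mean step is `2⁻ⁿ b` up to the `L¹` error of
approximating `w` by its value at the left grid point. For a suitable shift of the grid, the step
approximations of `w` and of `b` along `y` converge in `L¹` along a subsequence
(`exists_good_shift`).

The chains, seen as laws on `ℚ → E`, are tight, and a weak limit exists. To pass to the limit, `b`
is replaced by a continuous compactly supported `c` and the sums are taken on a fixed coarser grid,
so that only finitely many coordinates enter, continuously (`lintegral_coarse_le`,
`exists_isLimitLaw`). The cost of replacing `b` by `c` is an `L¹` norm for the space-time law of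
`y`, the same for all chains. Finally the limit paths are extended to continuous time and `c` is
sent back to `b` (`lintegral_extension_sub_eq_zero`). -/

open Filter Topology

set_option linter.unusedSectionVars false

/-! ### Markov chains with prescribed marginals, and their martingale increments -/

section MarkovChain

/-- Extend a law on sequences by one step of a Markov kernel. -/
noncomputable def chainStep {E : Type*} [MeasurableSpace E] (Q : Measure (ℕ → E)) (κ : Kernel E E)
    (N : ℕ) : Measure (ℕ → E) :=
  (Q ⊗ₘ κ.comap (fun z : ℕ → E => z N) (measurable_pi_apply N)).map
    (fun p => Function.update p.1 (N + 1) p.2)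

lemma measurable_update_succ {E : Type*} [MeasurableSpace E] (N : ℕ) :
    Measurable (fun p : (ℕ → E) × E => Function.update p.1 (N + 1) p.2) := by
  refine measurable_pi_lambda _ fun i => ?_
  by_cases h : i = N + 1
  · subst h; simpa using measurable_snd
  · simp only [Function.update_of_ne h]
    fun_prop

/-- Only coordinate `N + 1` is overwritten, and forgetting the value drawn from a Markov kernel
gives back `Q`. -/
lemma chainStep_map {E F : Type*} [MeasurableSpace E] [MeasurableSpace F] (Q : Measure (ℕ → E)) [IsProbabilityMeasure Q]
    (κ : Kernel E E) [IsMarkovKernel κ] (N : ℕ) {G : (ℕ → E) → F} (hG : Measurable G)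
    (h : ∀ z e, G (Function.update z (N + 1) e) = G z) :
    (chainStep Q κ N).map G = Q.map G := by
  rw [chainStep, Measure.map_map hG (measurable_update_succ N)]
  have : (G ∘ fun p : (ℕ → E) × E => Function.update p.1 (N + 1) p.2) = G ∘ Prod.fst := by
    ext p; exact h _ _
  rw [this, ← Measure.map_map hG measurable_fst]
  congr 1
  exact Measure.fst_compProd ..

variable {E : Type*} [NormedAddCommGroup E] [InnerProductSpace ℝ E] [MeasurableSpace E]
  [BorelSpace E] [SecondCountableTopology E] [CompleteSpace E]

/-- A Markov chain with prescribed transition kernels and marginals, together with the orthogonality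
of its martingale increments. -/
lemma exists_markov_chain (ν : ℕ → Measure E) [∀ k, IsProbabilityMeasure (ν k)]
    (κ : ℕ → Kernel E E) [∀ k, IsMarkovKernel (κ k)]
    (hν : ∀ k, (ν k ⊗ₘ κ k).snd = ν (k + 1)) (N : ℕ) :
    ∃ Q : Measure (ℕ → E), IsProbabilityMeasure Q ∧ (∀ k ≤ N, Q.map (fun z => z k) = ν k) ∧
      (∀ k < N, Q.map (fun z => (z k, z (k + 1))) = ν k ⊗ₘ κ k) ∧
      ∀ i j, i < j → j < N → ∀ (m m' : E × E → E) (C : ℝ), Measurable m → Measurable m' →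
        (∀ p, ‖m p‖ ≤ C) → (∀ p, ‖m' p‖ ≤ C) → (∀ z, ∫ e, m' (z, e) ∂(κ j z) = 0) →
        ∫ z, inner ℝ (m (z i, z (i + 1))) (m' (z j, z (j + 1))) ∂Q = 0 := by
  induction N with
  | zero =>
    -- Constant sequences serve: only coordinate `0` is constrained yet.
    refine ⟨(ν 0).map (fun x _ => x), ?_, ?_, ?_, ?_⟩
    · exact Measure.isProbabilityMeasure_map (by fun_prop)
    · intro k hk
      obtain rfl : k = 0 := by omega
      rw [Measure.map_map (by fun_prop) (by fun_prop)]
      exact Measure.map_id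
    · intro k hk; omega
    · intro i j _ hj; omega
  | succ N ih =>
    obtain ⟨Q, hQ, hmarg, hpair, horth⟩ := ih
    have hPr : IsProbabilityMeasure (chainStep Q (κ N) N) :=
      Measure.isProbabilityMeasure_map (measurable_update_succ N).aemeasurable
    have hlast : (chainStep Q (κ N) N).map (fun z => (z N, z (N + 1))) = ν N ⊗ₘ κ N := by
      rw [chainStep, Measure.map_map (by fun_prop) (measurable_update_succ N)]
      have : ((fun z : ℕ → E => (z N, z (N + 1))) ∘
          fun p : (ℕ → E) × E => Function.update p.1 (N + 1) p.2) = fun p => (p.1 N, p.2) := by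
        ext p <;> simp
      rw [this, ← hmarg N le_rfl]
      ext s hs
      rw [Measure.map_apply (by fun_prop) hs, Measure.compProd_apply (by measurability),
        Measure.compProd_apply hs, lintegral_map (Kernel.measurable_kernel_prodMk_left hs)
          (by fun_prop)]
      rfl
    refine ⟨chainStep Q (κ N) N, hPr, ?_, ?_, ?_⟩
    · intro k hk
      rcases Nat.lt_or_ge k (N + 1) with h | h
      · rw [chainStep_map Q (κ N) N (by fun_prop), hmarg k (by omega)]
        intro z e; simp [Function.update_of_ne h.ne]
      · obtain rfl : k = N + 1 := by omega
        rw [← hν N, ← hlast, Measure.snd, Measure.map_map (by fun_prop) (by fun_prop)]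
        rfl
    · intro k hk
      rcases Nat.lt_or_ge k N with h | h
      · rw [chainStep_map Q (κ N) N (by fun_prop), hpair k h]
        intro z e
        simp [Function.update_of_ne (show k ≠ N + 1 by omega),
          Function.update_of_ne (show k + 1 ≠ N + 1 by omega)]
      · obtain rfl : k = N := by omega
        exact hlast
    · intro i j hij hj m m' C hm hm' hmC hmC' hc
      have hG : ∀ k, Measurable (fun z : ℕ → E => (z k, z (k + 1))) := fun k => by fun_prop
      have hmeas : Measurable (fun z : ℕ → E =>
          inner ℝ (m (z i, z (i + 1))) (m' (z j, z (j + 1)))) :=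
        (hm.comp (hG i)).inner (hm'.comp (hG j))
      rcases Nat.lt_or_ge j N with h | h
      · rw [← horth i j hij h m m' C hm hm' hmC hmC' hc]
        have key := chainStep_map Q (κ N) N hmeas (by
          intro z e
          simp [Function.update_of_ne (show i ≠ N + 1 by omega),
            Function.update_of_ne (show j ≠ N + 1 by omega),
            Function.update_of_ne (show i + 1 ≠ N + 1 by omega),
            Function.update_of_ne (show j + 1 ≠ N + 1 by omega)])
        have e1 := integral_map (μ := chainStep Q (κ N) N) hmeas.aemeasurable
          (f := fun x : ℝ => x) (by fun_prop)
        have e2 := integral_map (μ := Q) hmeas.aemeasurable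
          (f := fun x : ℝ => x) (by fun_prop)
        rw [← e1, ← e2, key]
      · obtain rfl : j = N := by omega
        -- Here the second increment is the new one. The first involves only coordinates up to `i +
        -- 1 ≤ j`, so it is fixed while the new coordinate is integrated out, and the centring of
        -- `m'` gives zero.
        rw [chainStep, integral_map (measurable_update_succ j).aemeasurable
          hmeas.aestronglyMeasurable]
        have hup : ∀ p : (ℕ → E) × E, inner ℝ
            (m (Function.update p.1 (j + 1) p.2 i, Function.update p.1 (j + 1) p.2 (i + 1)))
            (m' (Function.update p.1 (j + 1) p.2 j, Function.update p.1 (j + 1) p.2 (j + 1)))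
            = inner ℝ (m (p.1 i, p.1 (i + 1))) (m' (p.1 j, p.2)) := by
          intro p
          simp [Function.update_of_ne (show i ≠ j + 1 by omega),
            Function.update_of_ne (show i + 1 ≠ j + 1 by omega)]
        simp_rw [hup]
        have hCm : ∀ p : (ℕ → E) × E, ‖(inner ℝ (m (p.1 i, p.1 (i + 1))) (m' (p.1 j, p.2)) : ℝ)‖
            ≤ C * C := fun p => (norm_inner_le_norm _ _).trans
              (mul_le_mul (hmC _) (hmC' _) (norm_nonneg _) ((norm_nonneg _).trans (hmC 0)))
        have hmm : Measurable (fun p : (ℕ → E) × E =>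
            (inner ℝ (m (p.1 i, p.1 (i + 1))) (m' (p.1 j, p.2)) : ℝ)) :=
          (hm.comp (by fun_prop)).inner (hm'.comp (by fun_prop))
        rw [Measure.integral_compProd (Integrable.of_bound hmm.aestronglyMeasurable (C * C)
          (ae_of_all _ hCm))]
        refine integral_eq_zero_of_ae (ae_of_all _ fun z => ?_)
        have hint : Integrable (fun e => m' (z j, e)) (κ j (z j)) :=
          Integrable.of_bound (hm'.comp (by fun_prop)).aestronglyMeasurable C
            (ae_of_all _ fun e => hmC' _)
        simp only [Kernel.comap_apply, Pi.zero_apply]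
        rw [integral_inner hint, hc, inner_zero_right]

/-- The second moment of a sum of bounded orthogonal increments controls its first moment. -/
lemma lintegral_sum_orthogonal_le {Ω : Type*} [MeasurableSpace Ω] (Q : Measure Ω)
    [IsProbabilityMeasure Q] (s : Finset ℕ) (m : ℕ → Ω → E) {C a : ℝ} (ha : 0 < a)
    (hm : ∀ k ∈ s, Measurable (m k)) (hC : ∀ k ∈ s, ∀ z, ‖m k z‖ ≤ C)
    (horth : ∀ k ∈ s, ∀ l ∈ s, k < l → ∫ z, inner ℝ (m k z) (m l z) ∂Q = 0)
    (hCa : s.card * C ^ 2 ≤ a ^ 2) :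
    ∫⁻ z, ‖∑ k ∈ s, m k z‖ₑ ∂Q ≤ ENNReal.ofReal a := by
  have hint : ∀ k ∈ s, ∀ l ∈ s, Integrable (fun z => (inner ℝ (m k z) (m l z) : ℝ)) Q := by
    intro k hk l hl
    refine Integrable.of_bound ((hm k hk).inner (hm l hl)).aestronglyMeasurable (C * C)
      (ae_of_all _ fun z => (norm_inner_le_norm _ _).trans ?_)
    exact mul_le_mul (hC k hk z) (hC l hl z) (norm_nonneg _) ((norm_nonneg _).trans (hC k hk z))
  have hexp : ∀ z, ‖∑ k ∈ s, m k z‖ ^ 2 = ∑ k ∈ s, ∑ l ∈ s, (inner ℝ (m k z) (m l z) : ℝ) := by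
    intro z
    rw [← real_inner_self_eq_norm_sq, sum_inner]
    simp_rw [inner_sum]
  have hsqint : Integrable (fun z => ‖∑ k ∈ s, m k z‖ ^ 2) Q := by
    simp_rw [hexp]
    exact integrable_finsetSum _ fun k hk => integrable_finsetSum _ fun l hl => hint k hk l hl
  have hsq : ∫ z, ‖∑ k ∈ s, m k z‖ ^ 2 ∂Q ≤ a ^ 2 := by
    simp_rw [hexp]
    rw [integral_finsetSum _ fun k hk => integrable_finsetSum _ fun l hl => hint k hk l hl]
    -- Orthogonality leaves only the diagonal term in each row.
    refine le_trans (Finset.sum_le_sum (g := fun _ => C ^ 2) fun k hk => ?_) (by simpa using hCa)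
    rw [integral_finsetSum _ fun l hl => hint k hk l hl, Finset.sum_eq_single_of_mem k hk]
    · simp_rw [real_inner_self_eq_norm_sq]
      calc ∫ z, ‖m k z‖ ^ 2 ∂Q ≤ ∫ _, C ^ 2 ∂Q := by
            refine integral_mono_of_nonneg (ae_of_all _ fun z => by positivity)
              (integrable_const _) (ae_of_all _ fun z => ?_)
            exact pow_le_pow_left₀ (norm_nonneg _) (hC k hk z) 2
        _ = C ^ 2 := by simp
    · intro l hl hlk
      rcases lt_or_gt_of_ne hlk with h | h
      · simp_rw [fun z => real_inner_comm (m l z) (m k z)]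
        exact horth l hl k hk h
      · exact horth k hk l hl h
  have hmeas : Measurable fun z => ∑ k ∈ s, m k z := Finset.measurable_fun_sum s hm
  -- The inequality `x ≤ (a + x² / a) / 2` plays the role of Cauchy–Schwarz: a second moment at most
  -- `a²` yields a first moment at most `a`.
  have hle : ∀ z, ‖∑ k ∈ s, m k z‖ ≤ (a + ‖∑ k ∈ s, m k z‖ ^ 2 / a) / 2 := by
    intro z
    rw [le_div_iff₀ two_pos, ← sub_nonneg]
    have : a + ‖∑ k ∈ s, m k z‖ ^ 2 / a - ‖∑ k ∈ s, m k z‖ * 2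
        = (a - ‖∑ k ∈ s, m k z‖) ^ 2 / a := by field_simp; ring
    rw [this]; positivity
  have hbd : Integrable (fun z => (a + ‖∑ k ∈ s, m k z‖ ^ 2 / a) / 2) Q :=
    ((integrable_const a).add (hsqint.div_const a)).div_const 2
  calc ∫⁻ z, ‖∑ k ∈ s, m k z‖ₑ ∂Q
      ≤ ∫⁻ z, ENNReal.ofReal ((a + ‖∑ k ∈ s, m k z‖ ^ 2 / a) / 2) ∂Q := by
        refine lintegral_mono fun z => ?_
        rw [← ofReal_norm]
        exact ENNReal.ofReal_le_ofReal (hle z)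
    _ = ENNReal.ofReal (∫ z, (a + ‖∑ k ∈ s, m k z‖ ^ 2 / a) / 2 ∂Q) :=
        (ofReal_integral_eq_lintegral_ofReal hbd (ae_of_all _ fun z => by positivity)).symm
    _ ≤ ENNReal.ofReal a := by
        refine ENNReal.ofReal_le_ofReal ?_
        rw [integral_div, integral_add (integrable_const a) (hsqint.div_const a), integral_div]
        simp only [integral_const, probReal_univ, one_smul]
        have : (∫ z, ‖∑ k ∈ s, m k z‖ ^ 2 ∂Q) / a ≤ a := by
          rw [div_le_iff₀ ha]; linarith [hsq, sq a]
        linarith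

/-- The part of the increment `p.2 - p.1` exceeding `R` in norm. -/
noncomputable def bigStep (R : ℝ) (p : E × E) : E :=
  {p : E × E | R < ‖p.2 - p.1‖}.indicator (fun p => p.2 - p.1) p

lemma measurable_bigStep (R : ℝ) : Measurable (bigStep R : E × E → E) := by
  refine Measurable.indicator (by fun_prop) ?_
  exact measurableSet_lt measurable_const (by fun_prop)

lemma norm_sub_bigStep_le {R : ℝ} (hR : 0 ≤ R) (p : E × E) :
    ‖p.2 - p.1 - bigStep R p‖ ≤ R := by
  by_cases h : R < ‖p.2 - p.1‖
  · simpa [bigStep, Set.indicator, h] using hR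
  · simpa [bigStep, Set.indicator, h] using not_lt.1 h

/-- Along a Markov chain, the sum of the increments is close to the sum of the conditional mean
increments, up to the contribution of large steps. -/
lemma exists_markov_chain_compensated (ν : ℕ → Measure E) [∀ k, IsProbabilityMeasure (ν k)]
    (κ : ℕ → Kernel E E) [∀ k, IsMarkovKernel (κ k)]
    (hν : ∀ k, (ν k ⊗ₘ κ k).snd = ν (k + 1)) (N : ℕ)
    (hfin : ∀ k, Integrable (fun p : E × E => p.2 - p.1) (ν k ⊗ₘ κ k)) :
    ∃ Q : Measure (ℕ → E), IsProbabilityMeasure Q ∧ (∀ k ≤ N, Q.map (fun z => z k) = ν k) ∧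
      (∀ k < N, Q.map (fun z => (z k, z (k + 1))) = ν k ⊗ₘ κ k) ∧
      ∀ i j, j ≤ N → ∀ R a : ℝ, 0 ≤ R → 0 < a → N * (2 * R) ^ 2 ≤ a ^ 2 →
        ∫⁻ z, ‖∑ k ∈ Finset.Ico i j, (z (k + 1) - z k - ∫ e, (e - z k) ∂(κ k (z k)))‖ₑ ∂Q ≤
          ENNReal.ofReal a +
            2 * ∑ k ∈ Finset.Ico i j, ∫⁻ p, ‖bigStep R p‖ₑ ∂(ν k ⊗ₘ κ k) := by
  obtain ⟨Q, hQ, hmarg, hpair, horth⟩ := exists_markov_chain ν κ hν N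
  refine ⟨Q, hQ, hmarg, hpair, fun i j hj R a hR ha hNa => ?_⟩
  -- The increments are only integrable. Their truncations are bounded by `R`, so the centred
  -- truncations `m` are bounded by `2 * R` and the orthogonality estimate applies to them.
  let D : E × E → E := fun p => p.2 - p.1 - bigStep R p
  have hD : Measurable D := (by fun_prop : Measurable fun p : E × E => p.2 - p.1).sub
    (measurable_bigStep R)
  have hDR : ∀ p, ‖D p‖ ≤ R := norm_sub_bigStep_le hR
  have hker : ∀ (k : ℕ) {F : E × E → E}, Measurable F →
      Measurable fun z => ∫ e, F (z, e) ∂(κ k z) := fun k F hF =>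
    (hF.stronglyMeasurable.integral_kernel_prod_right' (κ := κ k)).measurable
  let m : ℕ → E × E → E := fun k p => D p - ∫ e, D (p.1, e) ∂(κ k p.1)
  have hDint : ∀ k z, Integrable (fun e => D (z, e)) (κ k z) := fun k z =>
    Integrable.of_bound (hD.comp (by fun_prop)).aestronglyMeasurable R (ae_of_all _ fun e => hDR _)
  have hm : ∀ k, Measurable (m k) := fun k => hD.sub ((hker k hD).comp measurable_fst)
  have hmC : ∀ k p, ‖m k p‖ ≤ 2 * R := by
    intro k p
    have h2 : ‖∫ e, D (p.1, e) ∂(κ k p.1)‖ ≤ R := by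
      simpa using norm_integral_le_of_norm_le_const (μ := κ k p.1)
        (ae_of_all _ fun e => hDR (p.1, e))
    calc ‖m k p‖ ≤ ‖D p‖ + _ := norm_sub_le _ _
      _ ≤ 2 * R := by linarith [hDR p]
  have hmc : ∀ k z, ∫ e, m k (z, e) ∂(κ k z) = 0 := by
    intro k z
    simp only [m]
    rw [integral_sub (hDint k z) (integrable_const _)]
    simp
  -- The remainder is a large step minus its conditional mean. Each of the two is estimated in `L¹`
  -- by the same quantity, whence the factor `2` in the conclusion.
  have hstep : ∀ k ∈ Finset.Ico i j, ∀ᵐ z ∂Q, z (k + 1) - z k - ∫ e, (e - z k) ∂(κ k (z k)) =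
      m k (z k, z (k + 1)) + (bigStep R (z k, z (k + 1)) -
        ∫ e, bigStep R (z k, e) ∂(κ k (z k))) := by
    intro k hk
    have hk' := (Finset.mem_Ico.1 hk).2
    have h1 : ∀ᵐ x ∂(ν k), Integrable (fun e => e - x) (κ k x) :=
      (Measure.integrable_compProd_iff (hfin k).aestronglyMeasurable).1 (hfin k) |>.1
    rw [← hmarg k (by omega)] at h1
    filter_upwards [ae_of_ae_map (measurable_pi_apply k).aemeasurable h1] with z hz
    have : ∫ e, bigStep R (z k, e) ∂(κ k (z k)) =
        ∫ e, (e - z k) ∂(κ k (z k)) - ∫ e, D (z k, e) ∂(κ k (z k)) := by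
      rw [← integral_sub hz (hDint k _)]
      simp [D]
    rw [this]
    simp only [m, D]
    abel
  have hbig : ∀ k ∈ Finset.Ico i j, ∫⁻ z, ‖bigStep R (z k, z (k + 1))‖ₑ ∂Q =
      ∫⁻ p, ‖bigStep R p‖ₑ ∂(ν k ⊗ₘ κ k) := by
    intro k hk
    rw [← hpair k (by have := (Finset.mem_Ico.1 hk).2; omega),
      lintegral_map (measurable_bigStep R).enorm (by fun_prop)]
  have hbig' : ∀ k ∈ Finset.Ico i j, ∫⁻ z, ‖∫ e, bigStep R (z k, e) ∂(κ k (z k))‖ₑ ∂Q ≤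
      ∫⁻ p, ‖bigStep R p‖ₑ ∂(ν k ⊗ₘ κ k) := by
    intro k hk
    have hk' := (Finset.mem_Ico.1 hk).2
    rw [Measure.lintegral_compProd (measurable_bigStep R).enorm, ← hmarg k (by omega),
      lintegral_map _ (by fun_prop)]
    · exact lintegral_mono fun z => enorm_integral_le_lintegral_enorm _
    · exact Measurable.lintegral_kernel_prod_right' (measurable_bigStep R).enorm
  have hM : ∀ k, Measurable fun z : ℕ → E => m k (z k, z (k + 1)) := fun k =>
    (hm k).comp (by fun_prop)
  have hB : ∀ k, Measurable fun z : ℕ → E => bigStep R (z k, z (k + 1)) := fun k =>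
    (measurable_bigStep R).comp (by fun_prop)
  have hB' : ∀ k, Measurable fun z : ℕ → E => ∫ e, bigStep R (z k, e) ∂(κ k (z k)) := fun k =>
    (hker k (measurable_bigStep R)).comp (measurable_pi_apply k)
  have hBB : ∀ k ∈ Finset.Ico i j, Measurable fun z : ℕ → E => ‖bigStep R (z k, z (k + 1))‖ₑ +
      ‖∫ e, bigStep R (z k, e) ∂(κ k (z k))‖ₑ := fun k _ => (hB k).enorm.add (hB' k).enorm
  calc ∫⁻ z, ‖∑ k ∈ Finset.Ico i j, (z (k + 1) - z k - ∫ e, (e - z k) ∂(κ k (z k)))‖ₑ ∂Q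
      = ∫⁻ z, ‖∑ k ∈ Finset.Ico i j, (m k (z k, z (k + 1)) + (bigStep R (z k, z (k + 1)) -
        ∫ e, bigStep R (z k, e) ∂(κ k (z k))))‖ₑ ∂Q := by
        refine lintegral_congr_ae ?_
        filter_upwards [(Finset.eventually_all _).2 hstep] with z hz
        rw [Finset.sum_congr rfl hz]
    _ ≤ ∫⁻ z, (‖∑ k ∈ Finset.Ico i j, m k (z k, z (k + 1))‖ₑ + ∑ k ∈ Finset.Ico i j,
          (‖bigStep R (z k, z (k + 1))‖ₑ + ‖∫ e, bigStep R (z k, e) ∂(κ k (z k))‖ₑ)) ∂Q := by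
        refine lintegral_mono fun z => ?_
        rw [Finset.sum_add_distrib]
        refine (enorm_add_le _ _).trans (add_le_add le_rfl ?_)
        refine (enorm_sum_le _ _).trans (Finset.sum_le_sum fun k _ => enorm_sub_le)
    _ = ∫⁻ z, ‖∑ k ∈ Finset.Ico i j, m k (z k, z (k + 1))‖ₑ ∂Q + ∑ k ∈ Finset.Ico i j,
          (∫⁻ z, ‖bigStep R (z k, z (k + 1))‖ₑ ∂Q +
            ∫⁻ z, ‖∫ e, bigStep R (z k, e) ∂(κ k (z k))‖ₑ ∂Q) := by
        rw [lintegral_add_left (Finset.measurable_fun_sum _ fun k _ => hM k).enorm,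
          lintegral_finsetSum _ hBB]
        congr 1
        exact Finset.sum_congr rfl fun k _ => lintegral_add_left (hB k).enorm _
    _ ≤ _ := by
        refine add_le_add ?_ ?_
        · refine lintegral_sum_orthogonal_le Q _ (fun k z => m k (z k, z (k + 1))) (C := 2 * R)
            ha (fun k _ => hM k) (fun k _ z => hmC k _) ?_ ?_
          · intro k hk l hl hkl
            exact horth k l hkl (by have := (Finset.mem_Ico.1 hl).2; omega) (m k) (m l) (2 * R)
              (hm k) (hm l) (hmC k) (hmC l) (hmc l)
          · refine le_trans ?_ hNa
            gcongr
            simp only [Nat.card_Ico]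
            omega
        · rw [Finset.mul_sum]
          refine Finset.sum_le_sum fun k hk => ?_
          rw [hbig k hk, two_mul]
          exact add_le_add le_rfl (hbig' k hk)

end MarkovChain

/-! ### Compactness of laws on a countable product -/

/-- Probability measures on a countable product with tight marginals have a convergent
subsequence. -/
lemma exists_subseq_tendsto_of_tight_marginals {ι E : Type*} [Countable ι] [TopologicalSpace E]
    [PolishSpace E] [MeasurableSpace E] [BorelSpace E] (Q : ℕ → ProbabilityMeasure (ι → E))
    (h : ∀ i, IsTightMeasureSet (range fun n => (Q n : Measure (ι → E)).map (fun z => z i))) :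
    ∃ (Q' : ProbabilityMeasure (ι → E)) (φ : ℕ → ℕ), StrictMono φ ∧
      Tendsto (fun n => Q (φ n)) atTop (𝓝 Q') := by
  have htight : IsTightMeasureSet {((μ : ProbabilityMeasure (ι → E)) : Measure (ι → E)) |
      μ ∈ range Q} := by
    rw [isTightMeasureSet_iff_exists_isCompact_measure_compl_le]
    intro ε hε
    obtain ⟨ε', hε', hsum⟩ := ENNReal.exists_pos_sum_of_countable' hε.ne' ι
    have hK : ∀ i, ∃ K : Set E, IsCompact K ∧
        ∀ n, (Q n : Measure (ι → E)).map (fun z => z i) Kᶜ ≤ ε' i := by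
      intro i
      obtain ⟨K, hK, hK'⟩ := isTightMeasureSet_iff_exists_isCompact_measure_compl_le.1 (h i)
        (ε' i) (hε' i)
      exact ⟨K, hK, fun n => hK' _ ⟨n, rfl⟩⟩
    choose K hKc hKε using hK
    -- A product of compact sets is compact, and the masses `ε' i` lost in the coordinates are
    -- summable with sum below `ε`.
    refine ⟨univ.pi K, isCompact_univ_pi hKc, ?_⟩
    rintro _ ⟨_, ⟨n, rfl⟩, rfl⟩
    have hsub : (univ.pi K)ᶜ ⊆ ⋃ i, (fun z : ι → E => z i) ⁻¹' (K i)ᶜ := by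
      intro z hz
      simpa [Set.mem_pi] using hz
    refine (measure_mono hsub).trans ((measure_iUnion_le _).trans (le_trans ?_ hsum.le))
    refine ENNReal.tsum_le_tsum fun i => ?_
    rw [← Measure.map_apply (measurable_pi_apply i) (hKc i).measurableSet.compl]
    exact hKε i n
  obtain ⟨Q', -, φ, hφ, hlim⟩ := (isCompact_closure_of_isTightMeasureSet htight).isSeqCompact
    (x := Q) (fun n => subset_closure ⟨n, rfl⟩)
  exact ⟨Q', φ, hφ, hlim⟩

/-! ### Step approximation of integrable processes on shifted dyadic grids -/

section Translation

variable {F : Type*} [NormedAddCommGroup F]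

/-- Translations are continuous in `L¹(ℝ)`. -/
lemma tendsto_lintegral_translate_sub {f : ℝ → F} (hf : Integrable f) :
    Tendsto (fun δ : ℝ => ∫⁻ x, ‖f (x + δ) - f x‖ₑ) (𝓝 0) (𝓝 0) := by
  have hfm : MemLp f 1 volume := memLp_one_iff_integrable.2 hf
  let g : C(ℝ, C(ℝ, ℝ)) := (ContinuousMap.mk (fun p : ℝ × ℝ => p.2 + p.1) (by fun_prop)).curry
  have hg : ∀ δ, MeasurePreserving (g δ) (volume : Measure ℝ) volume := fun δ =>
    measurePreserving_add_right volume δ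
  have h := Filter.Tendsto.compMeasurePreservingLp (l := 𝓝 (0 : ℝ))
    (tendsto_const_nhds (x := hfm.toLp f)) (g.continuous.tendsto 0) hg (hg 0) ENNReal.one_ne_top
  have h2 := tendsto_iff_edist_tendsto_0.1 h
  refine h2.congr fun δ => ?_
  rw [Lp.toLp_compMeasurePreserving hfm (hg δ), Lp.toLp_compMeasurePreserving hfm (hg 0),
    Lp.edist_toLp_toLp, eLpNorm_one_eq_lintegral_enorm]
  simp [g]

variable {S : Type*} [MeasurableSpace S] {P : Measure S} [IsProbabilityMeasure P]
  [MeasurableSpace F] [BorelSpace F] [SecondCountableTopology F]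

/-- Translations in time are continuous in `L¹` for integrable processes. -/
lemma tendsto_lintegral_process_translate_sub {f : S × ℝ → F} (hf : Measurable f)
    (hfin : ∫⁻ s, (∫⁻ x, ‖f (s, x)‖ₑ) ∂P ≠ ⊤) :
    Tendsto (fun δ : ℝ => ∫⁻ s, (∫⁻ x, ‖f (s, x + δ) - f (s, x)‖ₑ) ∂P) (𝓝 0) (𝓝 0) := by
  have hm : Measurable fun s => ∫⁻ x, ‖f (s, x)‖ₑ := hf.enorm.lintegral_prod_right'
  have hlim : ∀ᵐ s ∂P, Tendsto (fun δ : ℝ => ∫⁻ x, ‖f (s, x + δ) - f (s, x)‖ₑ) (𝓝 0) (𝓝 0) := by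
    filter_upwards [ae_lt_top hm hfin] with s hs
    exact tendsto_lintegral_translate_sub (f := fun x => f (s, x))
      ⟨(hf.comp (by fun_prop)).aestronglyMeasurable, hs⟩
  have := tendsto_lintegral_filter_of_dominated_convergence (μ := P) (l := 𝓝 (0 : ℝ))
    (F := fun δ s => ∫⁻ x, ‖f (s, x + δ) - f (s, x)‖ₑ) (f := fun _ => 0)
    (fun s => 2 * ∫⁻ x, ‖f (s, x)‖ₑ) (Eventually.of_forall fun δ => ?_)
    (Eventually.of_forall fun δ => ae_of_all _ fun s => ?_) ?_ hlim
  · simp only [lintegral_zero] at this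
    exact this
  · exact Measurable.lintegral_prod_right'
      (f := fun p : S × ℝ => ‖f (p.1, p.2 + δ) - f (p.1, p.2)‖ₑ)
      ((hf.comp (by fun_prop)).sub (hf.comp (by fun_prop))).enorm
  · calc ∫⁻ x, ‖f (s, x + δ) - f (s, x)‖ₑ ≤ ∫⁻ x, (‖f (s, x + δ)‖ₑ + ‖f (s, x)‖ₑ) :=
          lintegral_mono fun x => enorm_sub_le
      _ = 2 * ∫⁻ x, ‖f (s, x)‖ₑ := by
          rw [lintegral_add_right _ (by fun_prop),
            lintegral_add_right_eq_self (fun x => ‖f (s, x)‖ₑ) δ, two_mul]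
  · rw [lintegral_const_mul _ hm]
    exact ENNReal.mul_ne_top (by simp) hfin

/-- The largest point of the grid `2⁻ⁿ ℕ` below `r`. -/
noncomputable def dyadicFloor (n : ℕ) (r : ℝ) : ℚ := (⌊r * 2 ^ n⌋₊ : ℚ) / 2 ^ n

@[fun_prop]
lemma measurable_dyadicFloor (n : ℕ) : Measurable (dyadicFloor n) := by
  unfold dyadicFloor
  have : Measurable fun r : ℝ => ⌊r * 2 ^ n⌋₊ := Nat.measurable_floor.comp (by fun_prop)
  exact (measurable_from_nat (f := fun k : ℕ => (k : ℚ) / 2 ^ n)).comp this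

lemma dyadicFloor_le (n : ℕ) {r : ℝ} (hr : 0 ≤ r) : (dyadicFloor n r : ℝ) ≤ r := by
  rw [dyadicFloor]
  push_cast
  rw [div_le_iff₀ (by positivity)]
  exact Nat.floor_le (by positivity)

lemma lt_dyadicFloor_add (n : ℕ) (r : ℝ) : r < dyadicFloor n r + (1 / 2) ^ n := by
  rw [dyadicFloor]
  push_cast
  rw [one_div, inv_pow, ← one_div, ← add_div, lt_div_iff₀ (by positivity)]
  exact Nat.lt_floor_add_one _

lemma dyadicFloor_nonneg (n : ℕ) (r : ℝ) : 0 ≤ dyadicFloor n r := by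
  unfold dyadicFloor; positivity

lemma abs_dyadicFloor_sub_le (n : ℕ) {r : ℝ} (hr : 0 ≤ r) :
    |(dyadicFloor n r : ℝ) - r| ≤ (1 / 2) ^ n := by
  rw [abs_le]
  constructor <;> linarith [dyadicFloor_le n hr, lt_dyadicFloor_add n r,
    pow_nonneg (by norm_num : (0 : ℝ) ≤ 1 / 2) n]

lemma tendsto_dyadicFloor {r : ℝ} (hr : 0 ≤ r) :
    Tendsto (fun n => (dyadicFloor n r : ℝ)) atTop (𝓝 r) := by
  rw [tendsto_iff_norm_sub_tendsto_zero]
  exact squeeze_zero (fun n => norm_nonneg _) (fun n => abs_dyadicFloor_sub_le n hr)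
    (tendsto_pow_atTop_nhds_zero_of_lt_one (by norm_num) (by norm_num))

/-- For almost every shift of the dyadic grid, the step approximations of an integrable process
converge to it in `L¹` along a subsequence; moreover the shifted grid avoids a null set of times. -/
lemma exists_good_shift {f : S × ℝ → F} (hf : Measurable f)
    (hfin : ∫⁻ s, (∫⁻ x, ‖f (s, x)‖ₑ) ∂P ≠ ⊤) {p : ℝ → Prop} (hp : ∀ᵐ t, p t) :
    ∃ U ∈ Icc (0 : ℝ) 1, (∀ q : ℚ, p (q - U)) ∧ ∃ φ : ℕ → ℕ, StrictMono φ ∧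
      Tendsto (fun n => ∫⁻ r in Icc (0 : ℝ) 2, ∫⁻ s,
        ‖f (s, dyadicFloor (φ n) r - U) - f (s, r - U)‖ₑ ∂P) atTop (𝓝 0) := by
  let G : ℕ → ℝ → ENNReal := fun n U => ∫⁻ r in Icc (0 : ℝ) 2, ∫⁻ s,
        ‖f (s, dyadicFloor n r - U) - f (s, r - U)‖ₑ ∂P
  have hFm : ∀ n, Measurable fun p : (ℝ × ℝ) × S =>
      ‖f (p.2, dyadicFloor n p.1.2 - p.1.1) - f (p.2, p.1.2 - p.1.1)‖ₑ := fun n =>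
    ((hf.comp (by fun_prop)).sub (hf.comp (by fun_prop))).enorm
  have hGm' : ∀ n, Measurable fun p : ℝ × ℝ => ∫⁻ s,
      ‖f (s, dyadicFloor n p.2 - p.1) - f (s, p.2 - p.1)‖ₑ ∂P := fun n =>
    (hFm n).lintegral_prod_right'
  have hGm : ∀ n, Measurable (G n) := fun n => (hGm' n).lintegral_prod_right'
  -- Average over the shift: for fixed `r`, the substitution `x = r - U` turns the grid error into a
  -- translation error by `dyadicFloor n r - r`, at most `2⁻ⁿ` in size. The factor `2` is the length
  -- of the range of `r`.
  have hGle : ∀ n, ∀ ε, (∀ δ : ℝ, |δ| ≤ (1 / 2) ^ n →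
      ∫⁻ s, (∫⁻ x, ‖f (s, x + δ) - f (s, x)‖ₑ) ∂P ≤ ε) →
      ∫⁻ U in Icc (0 : ℝ) 1, G n U ≤ 2 * ε := by
    intro n ε hε
    calc ∫⁻ U in Icc (0 : ℝ) 1, G n U
        ≤ ∫⁻ U, G n U := lintegral_mono' Measure.restrict_le_self le_rfl
      _ = ∫⁻ r in Icc (0 : ℝ) 2, ∫⁻ U, ∫⁻ s,
            ‖f (s, dyadicFloor n r - U) - f (s, r - U)‖ₑ ∂P :=
          lintegral_lintegral_swap (hGm' n).aemeasurable
      _ ≤ ∫⁻ r in Icc (0 : ℝ) 2, ε := by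
          refine setLIntegral_mono' measurableSet_Icc fun r hr => ?_
          refine le_trans (le_of_eq ?_) (hε _ (abs_dyadicFloor_sub_le n hr.1))
          rw [lintegral_lintegral_swap]
          · refine lintegral_congr fun s => ?_
            rw [← lintegral_sub_left_eq_self _ r]
            refine lintegral_congr fun x => ?_
            congr 3 <;> ring_nf
          · exact ((hFm n).comp (by fun_prop :
              Measurable fun p : ℝ × S => ((p.1, r), p.2))).aemeasurable
      _ = 2 * ε := by simp [mul_comm]
  have hlim : Tendsto (fun n => ∫⁻ U in Icc (0 : ℝ) 1, G n U) atTop (𝓝 0) := by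
    rw [ENNReal.tendsto_nhds_zero]
    intro ε hε
    have h2 := ENNReal.tendsto_nhds_zero.1 (tendsto_lintegral_process_translate_sub hf hfin)
      (ε / 2) (ENNReal.half_pos hε.ne')
    obtain ⟨ρ, hρ, hball⟩ := Metric.eventually_nhds_iff.1 h2
    have h3 : ∀ᶠ n : ℕ in atTop, ((1 : ℝ) / 2) ^ n < ρ :=
      (tendsto_pow_atTop_nhds_zero_of_lt_one (by norm_num) (by norm_num)).eventually_lt_const hρ
    filter_upwards [h3] with n hn
    refine (hGle n (ε / 2) fun δ hδ => hball ?_).trans (ENNReal.mul_div_le)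
    simpa [Real.dist_eq] using hδ.trans_lt hn
  -- Convergence of the averages is upgraded to convergence for almost every shift by passing to a
  -- subsequence with summable errors.
  obtain ⟨φ, hφ, hφle⟩ := extraction_forall_of_eventually'
    (P := fun n k => ∫⁻ U in Icc (0 : ℝ) 1, G k U ≤ 2⁻¹ ^ n)
    (fun n => eventually_atTop.1 (ENNReal.tendsto_nhds_zero.1 hlim _ (ENNReal.pow_pos (by simp) n)))
  have hsum : ∫⁻ U in Icc (0 : ℝ) 1, ∑' n, G (φ n) U ≠ ⊤ := by
    rw [lintegral_tsum fun n => (hGm (φ n)).aemeasurable]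
    refine ne_top_of_le_ne_top (b := ∑' n : ℕ, (2 : ENNReal)⁻¹ ^ n) ?_
      (ENNReal.tsum_le_tsum hφle)
    rw [ENNReal.tsum_geometric]
    simp
  have hae : ∀ᵐ U ∂(volume.restrict (Icc (0 : ℝ) 1)),
      Tendsto (fun n => G (φ n) U) atTop (𝓝 0) := by
    filter_upwards [ae_lt_top (Measurable.tsum fun n => hGm (φ n)) hsum] with U hU
    exact ENNReal.tendsto_atTop_zero_of_tsum_ne_top hU.ne
  -- The reflection `U ↦ q - U` preserves null sets, and there are countably many `q`.
  have hp' : ∀ᵐ U ∂(volume.restrict (Icc (0 : ℝ) 1)), ∀ q : ℚ, p (q - U) :=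
    ae_restrict_of_ae (ae_all_iff.2 fun q =>
      (Measure.measurePreserving_sub_left volume (q : ℝ)).quasiMeasurePreserving.ae hp)
  have : NeBot (ae (volume.restrict (Icc (0 : ℝ) 1))) := by
    rw [ae_neBot]
    simp
  obtain ⟨U, ⟨hU1, hU2⟩, hU3⟩ := ((hae.and hp').and (ae_restrict_mem measurableSet_Icc)).exists
  exact ⟨U, hU3, hU2, φ, hφ, hU1⟩

end Translation

/-! ### The dyadic grid -/

/-- The point `k / 2ⁿ` of the dyadic grid. -/
def dyadicPt (n k : ℕ) : ℚ := (k : ℚ) / 2 ^ n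

lemma dyadicPt_mono (n : ℕ) : Monotone fun k => (dyadicPt n k : ℝ) := by
  intro i j hij
  simp only [dyadicPt]
  push_cast
  gcongr

lemma dyadicPt_succ_sub (n k : ℕ) : (dyadicPt n (k + 1) : ℝ) - dyadicPt n k = (1 / 2) ^ n := by
  simp only [dyadicPt]
  push_cast
  rw [← sub_div]
  simp

lemma dyadicFloor_of_mem_Ico {n k : ℕ} {r : ℝ}
    (hr : r ∈ Ico (dyadicPt n k : ℝ) (dyadicPt n (k + 1))) : dyadicFloor n r = dyadicPt n k := by
  have h2 : (0 : ℝ) < 2 ^ n := by positivity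
  simp only [dyadicPt] at hr
  push_cast at hr
  rw [mem_Ico, div_le_iff₀ h2, lt_div_iff₀ h2] at hr
  rw [dyadicFloor, dyadicPt, (Nat.floor_eq_iff ((Nat.cast_nonneg k).trans hr.1)).2 hr]

/-- A sum of integrals over consecutive intervals. -/
lemma sum_setLIntegral_Ico {t : ℕ → ℝ} (ht : Monotone t) (g : ℝ → ENNReal) {i j : ℕ}
    (hij : i ≤ j) :
    ∑ k ∈ Finset.Ico i j, ∫⁻ r in Ico (t k) (t (k + 1)), g r = ∫⁻ r in Ico (t i) (t j), g r := by
  induction j, hij using Nat.le_induction with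
  | base => simp
  | succ j hij ih =>
    rw [Finset.sum_Ico_succ_top hij, ih, ← lintegral_union measurableSet_Ico,
      Ico_union_Ico_eq_Ico (ht hij) (ht j.le_succ)]
    exact Set.disjoint_left.2 fun x hx hx' => absurd hx'.1 (not_le.2 hx.2)

/-! ### Velocity processes and their dyadic Markov chains -/

section VelocityProcess

variable {S : Type*} [MeasurableSpace S] {E : Type*} [NormedAddCommGroup E] [InnerProductSpace ℝ E]
  [MeasurableSpace E] [BorelSpace E] [SecondCountableTopology E] [CompleteSpace E]

/-- An absolutely continuous process `y` with integrable velocity `w`, whose mean velocity given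
the position is `b` at all rational times. -/
structure IsVelocityProcess (P : Measure S) (y w : S → ℝ → E) (b : ℝ → E → E) : Prop where
  measurable_position : Measurable fun p : S × ℝ => y p.1 p.2
  measurable_velocity : Measurable fun p : S × ℝ => w p.1 p.2
  measurable_field : Measurable fun p : ℝ × E => b p.1 p.2
  intervalIntegrable : ∀ s a b, IntervalIntegrable (w s) volume a b
  integral_velocity : ∀ s a b, y s b - y s a = ∫ r in a..b, w s r
  lintegral_velocity : ∫⁻ s, (∫⁻ r, ‖w s r‖ₑ) ∂P ≠ ⊤
  lintegral_field : ∫⁻ s, (∫⁻ r, ‖b r (y s r)‖ₑ) ∂P ≠ ⊤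
  integrable_velocity : ∀ q : ℚ, Integrable (fun s => w s q) P
  condExp_velocity : ∀ q : ℚ,
    P[fun s => w s q | MeasurableSpace.comap (fun s => y s q) inferInstance] =ᵐ[P]
      fun s => b q (y s q)

namespace IsVelocityProcess

variable {P : Measure S} [IsProbabilityMeasure P] {y w : S → ℝ → E} {b : ℝ → E → E}

lemma measurable_position_at (h : IsVelocityProcess P y w b) (r : ℝ) :
    Measurable fun s => y s r := h.measurable_position.comp
    (by fun_prop : Measurable fun s : S => (s, r))

lemma measurable_velocity_at (h : IsVelocityProcess P y w b) (r : ℝ) :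
    Measurable fun s => w s r := h.measurable_velocity.comp
    (by fun_prop : Measurable fun s : S => (s, r))

lemma measurable_field_at (h : IsVelocityProcess P y w b) (r : ℝ) :
    Measurable (b r) := h.measurable_field.comp (by fun_prop : Measurable fun x : E => (r, x))

lemma enorm_position_sub_le (h : IsVelocityProcess P y w b) (s : S) {r r' : ℝ} (hr : r ≤ r') :
    ‖y s r' - y s r‖ₑ ≤ ∫⁻ u in Ico r r', ‖w s u‖ₑ := by
  rw [h.integral_velocity, intervalIntegral.integral_of_le hr, setLIntegral_congr Ico_ae_eq_Ioc]
  exact enorm_integral_le_lintegral_enorm _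

lemma lintegral_position_sub_le (h : IsVelocityProcess P y w b) {r r' : ℝ} (hr : r ≤ r') :
    ∫⁻ s, ‖y s r' - y s r‖ₑ ∂P ≤ ∫⁻ u in Ico r r', ∫⁻ s, ‖w s u‖ₑ ∂P := by
  refine (lintegral_mono fun s => h.enorm_position_sub_le s hr).trans (le_of_eq ?_)
  exact lintegral_lintegral_swap h.measurable_velocity.enorm.aemeasurable

lemma lintegral_velocity_swap_ne_top (h : IsVelocityProcess P y w b) :
    ∫⁻ u, ∫⁻ s, ‖w s u‖ₑ ∂P ≠ ⊤ := by
  rw [lintegral_lintegral_swap (f := fun u s => ‖w s u‖ₑ)]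
  · exact h.lintegral_velocity
  · exact (h.measurable_velocity.enorm.comp measurable_swap).aemeasurable

lemma integrable_position_sub (h : IsVelocityProcess P y w b) {r r' : ℝ} (hr : r ≤ r') :
    Integrable (fun s => y s r' - y s r) P := by
  refine ⟨((h.measurable_position_at r').sub
    (h.measurable_position_at r)).aestronglyMeasurable, ?_⟩
  refine (h.lintegral_position_sub_le hr).trans_lt (lt_of_le_of_lt ?_
    h.lintegral_velocity_swap_ne_top.lt_top)
  exact lintegral_mono' Measure.restrict_le_self le_rfl

/-- A large step over a time interval is controlled by the excess of the velocity. -/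
lemma enorm_bigStep_le (h : IsVelocityProcess P y w b) (s : S) {r r' K : ℝ} (hr : r ≤ r')
    (hK : 0 ≤ K) : ‖bigStep ((r' - r) * K) (y s r, y s r')‖ₑ ≤
      2 * ∫⁻ u in Ico r r', ENNReal.ofReal (‖w s u‖ - K / 2) := by
  by_cases hb : (r' - r) * K < ‖y s r' - y s r‖
  · have e : bigStep ((r' - r) * K) (y s r, y s r') = y s r' - y s r := by
      simp [bigStep, Set.indicator, hb]
    rw [e]
    -- Bound `‖w‖` by `K / 2` plus its excess. The constant part contributes half the threshold `(r'
    -- - r) * K`, hence at most half of the large step, and is absorbed on the left; this costs the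
    -- factor `2`.
    have h1 : ‖y s r' - y s r‖ₑ ≤ ENNReal.ofReal ((r' - r) * K / 2) +
        ∫⁻ u in Ico r r', ENNReal.ofReal (‖w s u‖ - K / 2) := by
      refine (h.enorm_position_sub_le s hr).trans ?_
      have : ENNReal.ofReal ((r' - r) * K / 2) = ∫⁻ u in Ico r r', ENNReal.ofReal (K / 2) := by
        rw [setLIntegral_const, Real.volume_Ico, ← ENNReal.ofReal_mul (by positivity)]
        congr 1; ring
      rw [this, ← lintegral_add_left measurable_const]
      refine lintegral_mono fun u => ?_
      rw [← ofReal_norm]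
      refine le_trans (ENNReal.ofReal_le_ofReal ?_) ENNReal.ofReal_add_le
      linarith
    have h2 : 2 * ENNReal.ofReal ((r' - r) * K / 2) ≤ ‖y s r' - y s r‖ₑ := by
      rw [← ofReal_norm, show (2 : ENNReal) = ENNReal.ofReal 2 by simp,
        ← ENNReal.ofReal_mul (by norm_num)]
      exact ENNReal.ofReal_le_ofReal (by linarith)
    have h3 : ‖y s r' - y s r‖ₑ + ‖y s r' - y s r‖ₑ ≤ ‖y s r' - y s r‖ₑ +
        2 * ∫⁻ u in Ico r r', ENNReal.ofReal (‖w s u‖ - K / 2) := by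
      rw [← two_mul]
      calc 2 * ‖y s r' - y s r‖ₑ ≤ 2 * (_ + _) := by gcongr
        _ ≤ _ := by rw [mul_add]; gcongr
    exact ENNReal.le_of_add_le_add_left enorm_ne_top h3
  · have e : bigStep ((r' - r) * K) (y s r, y s r') = 0 := by
      simp [bigStep, Set.indicator, hb]
    simp [e]

/-- The mean increment given the position is close to the field at the left end point. -/
lemma lintegral_condDistrib_sub_le (h : IsVelocityProcess P y w b) (q : ℚ) {r' : ℝ}
    (hr : (q : ℝ) ≤ r') :
    ∫⁻ s, ‖∫ e, (e - y s q) ∂(condDistrib (fun s => y s r') (fun s => y s q) P (y s q)) -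
      (r' - q) • b q (y s q)‖ₑ ∂P ≤ ∫⁻ u in Ico (q : ℝ) r', ∫⁻ s, ‖w s q - w s u‖ₑ ∂P := by
  have hΔ := h.integrable_position_sub hr
  have h1 : P[fun s => y s r' - y s q | MeasurableSpace.comap (fun s => y s q) inferInstance] =ᵐ[P] fun s =>
      ∫ e, (e - y s q) ∂(condDistrib (fun s => y s r') (fun s => y s q) P (y s q)) :=
    condExp_prod_ae_eq_integral_condDistrib (f := fun p : E × E => p.2 - p.1)
      (h.measurable_position_at q) (h.measurable_position_at r').aemeasurable
      (by fun_prop : Measurable fun p : E × E => p.2 - p.1).stronglyMeasurable hΔ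
  have hw := (h.integrable_velocity q).smul (r' - q)
  -- The quantity to estimate is thus the conditional expectation, given `y s q`, of the integral of
  -- `w s u - w s q` over the interval, and conditioning contracts `L¹`.
  have h2 : P[(fun s => y s r' - y s q) - (r' - (q : ℝ)) • fun s => w s q | MeasurableSpace.comap (fun s => y s q) inferInstance] =ᵐ[P] fun s =>
      ∫ e, (e - y s q) ∂(condDistrib (fun s => y s r') (fun s => y s q) P (y s q)) -
        (r' - q) • b q (y s q) := by
    refine (condExp_sub hΔ hw _).trans ?_
    filter_upwards [h1, condExp_smul (μ := P) (r' - (q : ℝ)) (fun s => w s q) _,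
      h.condExp_velocity q] with s hs1 hs2 hs3
    rw [Pi.sub_apply, hs1, hs2, Pi.smul_apply, hs3]
  rw [← lintegral_congr_ae (h2.mono fun s hs => congrArg (‖·‖ₑ) hs), ← eLpNorm_one_eq_lintegral_enorm]
  refine (eLpNorm_condExp_le_eLpNorm _ le_rfl).trans ?_
  rw [eLpNorm_one_eq_lintegral_enorm, lintegral_lintegral_swap]
  · refine lintegral_mono fun s => ?_
    have e : y s r' - y s q - (r' - (q : ℝ)) • w s q = ∫ u in (q : ℝ)..r', (w s u - w s q) := by
      rw [intervalIntegral.integral_sub (h.intervalIntegrable s _ _) intervalIntegrable_const,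
        h.integral_velocity, intervalIntegral.integral_const]
    simp only [Pi.sub_apply, Pi.smul_apply]
    rw [e, intervalIntegral.integral_of_le hr, setLIntegral_congr Ico_ae_eq_Ioc]
    refine (enorm_integral_le_lintegral_enorm _).trans (le_of_eq ?_)
    simp_rw [enorm_sub_rev (w s q)]
  · exact (((h.measurable_velocity_at q).comp measurable_snd).sub
      (h.measurable_velocity.comp measurable_swap)).enorm.aemeasurable

/-- A Markov chain along the dyadic grid of level `n` with the same one-time laws as `y`, viewed as
a process indexed by the rationals. -/
lemma exists_dyadic_chain (h : IsVelocityProcess P y w b) (n : ℕ) :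
    ∃ Q : Measure (ℚ → E), IsProbabilityMeasure Q ∧
      (∀ q : ℚ, Q.map (fun ω => ω q) = P.map (fun s => y s q) ∨
        Q.map (fun ω => ω q) = Measure.dirac 0) ∧
      (∀ k ≤ 2 * 2 ^ n, Q.map (fun ω => ω (dyadicPt n k)) = P.map (fun s => y s (dyadicPt n k))) ∧
      (∀ i j, i ≤ j → j ≤ 2 * 2 ^ n → ∫⁻ ω, ‖ω (dyadicPt n j) - ω (dyadicPt n i)‖ₑ ∂Q ≤
        ∫⁻ u in Ico (dyadicPt n i : ℝ) (dyadicPt n j), ∫⁻ s, ‖w s u‖ₑ ∂P) ∧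
      (∀ i j, i ≤ j → j ≤ 2 * 2 ^ n → ∀ K a : ℝ, 0 ≤ K → 0 < a →
        ((2 * 2 ^ n : ℕ) : ℝ) * (2 * ((1 / 2) ^ n * K)) ^ 2 ≤ a ^ 2 →
        ∫⁻ ω, ‖ω (dyadicPt n j) - ω (dyadicPt n i) -
          ∑ k ∈ Finset.Ico i j, ((1 : ℝ) / 2) ^ n • b (dyadicPt n k) (ω (dyadicPt n k))‖ₑ ∂Q ≤
          ENNReal.ofReal a +
            4 * (∫⁻ u in Icc (0 : ℝ) 2, ∫⁻ s, ENNReal.ofReal (‖w s u‖ - K / 2) ∂P) +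
            ∫⁻ u in Icc (0 : ℝ) 2, ∫⁻ s, ‖w s (dyadicFloor n u) - w s u‖ₑ ∂P) := by
  let N := 2 * 2 ^ n
  let t : ℕ → ℝ := fun k => dyadicPt n k
  have ht : Monotone t := dyadicPt_mono n
  have htk : ∀ k, t k ≤ t (k + 1) := fun k => ht k.le_succ
  have hstep : ∀ k, t (k + 1) - t k = (1 / 2) ^ n := dyadicPt_succ_sub n
  -- The chain forgets the past of `y` but keeps the joint law of each pair of consecutive grid
  -- positions.
  let κ : ℕ → Kernel E E := fun k =>
    condDistrib (fun s => y s (t (k + 1))) (fun s => y s (t k)) P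
  let ν : ℕ → Measure E := fun k => P.map (fun s => y s (t k))
  have hν : ∀ k, IsProbabilityMeasure (ν k) := fun k =>
    Measure.isProbabilityMeasure_map (h.measurable_position_at _).aemeasurable
  have hpairm : ∀ k, Measurable fun s => (y s (t k), y s (t (k + 1))) := fun k =>
    (h.measurable_position_at _).prodMk (h.measurable_position_at _)
  have hνκ : ∀ k, ν k ⊗ₘ κ k = P.map fun s => (y s (t k), y s (t (k + 1))) := fun k =>
    compProd_map_condDistrib (h.measurable_position_at _).aemeasurable
  have hsnd : ∀ k, (ν k ⊗ₘ κ k).snd = ν (k + 1) := by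
    intro k
    rw [hνκ, Measure.snd, Measure.map_map measurable_snd (hpairm k)]
    rfl
  have hfin : ∀ k, Integrable (fun p : E × E => p.2 - p.1) (ν k ⊗ₘ κ k) := by
    intro k
    rw [hνκ, integrable_map_measure (by fun_prop) (hpairm k).aemeasurable]
    exact h.integrable_position_sub (htk k)
  obtain ⟨Q, hQ, hmarg, hpair, hmain⟩ := exists_markov_chain_compensated ν κ hsnd N hfin
  -- The chain is placed on the rationals `k / 2ⁿ` with `k ≤ N`, that is on `[0, 2]`, and every
  -- other coordinate is `0`. This is the source of the Dirac alternative for one-time laws,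
  -- harmless for tightness.
  let Φ : (ℕ → E) → ℚ → E := fun z q =>
    if q = dyadicPt n ⌊q * 2 ^ n⌋₊ ∧ ⌊q * 2 ^ n⌋₊ ≤ N then z ⌊q * 2 ^ n⌋₊ else 0
  have hΦm : Measurable Φ := by
    refine measurable_pi_lambda _ fun q => ?_
    simp only [Φ]
    split_ifs <;> fun_prop
  have hΦ : ∀ z k, k ≤ N → Φ z (dyadicPt n k) = z k := by
    intro z k hk
    have : ⌊dyadicPt n k * 2 ^ n⌋₊ = k := by
      simp [dyadicPt]
    simp [Φ, this, hk]
  have hQmap : ∀ k ≤ N, (Q.map Φ).map (fun ω => ω (dyadicPt n k)) = ν k := by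
    intro k hk
    rw [Measure.map_map (by fun_prop) hΦm, ← hmarg k hk]
    congr 1
    ext z
    exact hΦ z k hk
  have hκm : ∀ k, Measurable fun x => ∫ e, (e - x) ∂(κ k x) := fun k =>
    ((by fun_prop : Measurable fun p : E × E => p.2 - p.1).stronglyMeasurable
      |>.integral_kernel_prod_right' (κ := κ k)).measurable
  have hbm : ∀ k, Measurable fun x => ((1 : ℝ) / 2) ^ n • b (t k) x := fun k =>
    (h.measurable_field_at _).const_smul _
  have hIco : ∀ {i j}, j ≤ N → Ico (t i) (t j) ⊆ Icc (0 : ℝ) 2 := by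
    intro i j hj u hu
    refine ⟨le_trans ?_ hu.1, hu.2.le.trans ((ht hj).trans (le_of_eq ?_))⟩
    · simp only [t, dyadicPt]; positivity
    · simp [t, dyadicPt, N]
  refine ⟨Q.map Φ, Measure.isProbabilityMeasure_map hΦm.aemeasurable, ?_, fun k hk => hQmap k hk,
    ?_, ?_⟩
  · intro q
    by_cases hq : q = dyadicPt n ⌊q * 2 ^ n⌋₊ ∧ ⌊q * 2 ^ n⌋₊ ≤ N
    · left
      have := hQmap _ hq.2
      simp only [ν, t] at this
      rwa [← hq.1] at this
    · right
      rw [Measure.map_map (by fun_prop) hΦm]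
      have : ((fun ω : ℚ → E => ω q) ∘ Φ) = fun _ => 0 := by
        ext z
        simp only [Function.comp, Φ, if_neg hq]
      rw [this, Measure.map_const]
      simp
  · intro i j hij hj
    rw [lintegral_map (by fun_prop) hΦm]
    simp_rw [hΦ _ j hj, hΦ _ i (hij.trans hj), ← Finset.sum_Ico_sub _ hij]
    calc ∫⁻ z, ‖∑ k ∈ Finset.Ico i j, (z (k + 1) - z k)‖ₑ ∂Q
        ≤ ∫⁻ z, ∑ k ∈ Finset.Ico i j, ‖z (k + 1) - z k‖ₑ ∂Q :=
          lintegral_mono fun z => enorm_sum_le _ _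
      _ = ∑ k ∈ Finset.Ico i j, ∫⁻ z, ‖z (k + 1) - z k‖ₑ ∂Q :=
          lintegral_finsetSum _ fun k _ => by fun_prop
      _ ≤ ∑ k ∈ Finset.Ico i j, ∫⁻ u in Ico (t k) (t (k + 1)), ∫⁻ s, ‖w s u‖ₑ ∂P := by
          refine Finset.sum_le_sum fun k hk => ?_
          have hk' := (Finset.mem_Ico.1 hk).2
          refine le_trans (le_of_eq ?_) (h.lintegral_position_sub_le (htk k))
          have hm : Measurable fun p : E × E => ‖p.2 - p.1‖ₑ := by fun_prop
          rw [← lintegral_map (f := fun p : E × E => ‖p.2 - p.1‖ₑ) hm (hpairm k), ← hνκ,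
            ← hpair k (hk'.trans_le hj), lintegral_map hm (by fun_prop)]
      _ = _ := sum_setLIntegral_Ico ht _ hij
  · intro i j hij hj K a hK ha hKa
    have hmeas : Measurable fun ω : ℚ → E => ω (dyadicPt n j) - ω (dyadicPt n i) -
        ∑ k ∈ Finset.Ico i j, ((1 : ℝ) / 2) ^ n • b (dyadicPt n k) (ω (dyadicPt n k)) :=
      (by fun_prop : Measurable fun ω : ℚ → E => ω (dyadicPt n j) - ω (dyadicPt n i)).sub
        (Finset.measurable_fun_sum _ fun k _ => (hbm k).comp (measurable_pi_apply _))
    rw [lintegral_map hmeas.enorm hΦm]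
    -- Martingale part plus drift error.
    have hsplit : ∀ z : ℕ → E, Φ z (dyadicPt n j) - Φ z (dyadicPt n i) -
        ∑ k ∈ Finset.Ico i j, ((1 : ℝ) / 2) ^ n • b (dyadicPt n k) (Φ z (dyadicPt n k)) =
        ∑ k ∈ Finset.Ico i j, (z (k + 1) - z k - ∫ e, (e - z k) ∂(κ k (z k))) +
        ∑ k ∈ Finset.Ico i j, (∫ e, (e - z k) ∂(κ k (z k)) - ((1 : ℝ) / 2) ^ n • b (t k) (z k)) := by
      intro z
      rw [hΦ _ j hj, hΦ _ i (hij.trans hj), ← Finset.sum_Ico_sub _ hij, ← Finset.sum_sub_distrib,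
        ← Finset.sum_add_distrib]
      refine Finset.sum_congr rfl fun k hk => ?_
      rw [hΦ z k ((Finset.mem_Ico.1 hk).2.le.trans hj)]
      simp only [t]
      abel
    simp_rw [hsplit]
    have hcm : ∀ k, Measurable fun z : ℕ → E => ∫ e, (e - z k) ∂(κ k (z k)) := fun k =>
      (hκm k).comp (measurable_pi_apply k)
    have hm1 : Measurable fun z : ℕ → E =>
        ∑ k ∈ Finset.Ico i j, (z (k + 1) - z k - ∫ e, (e - z k) ∂(κ k (z k))) :=
      Finset.measurable_fun_sum _ fun k _ => Measurable.sub (by fun_prop) (hcm k)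
    have hm2 : ∀ k, Measurable fun x : E =>
        ‖∫ e, (e - x) ∂(κ k x) - ((1 : ℝ) / 2) ^ n • b (t k) x‖ₑ := fun k =>
      ((hκm k).sub (hbm k)).enorm
    refine (lintegral_mono fun z => enorm_add_le _ _).trans ?_
    rw [lintegral_add_left hm1.enorm]
    refine add_le_add ?_ ?_
    · have hR : 0 ≤ ((1 : ℝ) / 2) ^ n * K := by positivity
      refine (hmain i j hj _ a hR ha hKa).trans (add_le_add le_rfl ?_)
      -- The truncation level `2⁻ⁿ K` is velocity `K` over one step; the constant `4` is the `2`
      -- lost here times the `2` of the compensation.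
      have : ∀ k, ∫⁻ p, ‖bigStep (((1 : ℝ) / 2) ^ n * K) p‖ₑ ∂(ν k ⊗ₘ κ k) ≤
          2 * ∫⁻ u in Ico (t k) (t (k + 1)), ∫⁻ s, ENNReal.ofReal (‖w s u‖ - K / 2) ∂P := by
        intro k
        have hTm : Measurable fun p : S × ℝ => ENNReal.ofReal (‖w p.1 p.2‖ - K / 2) :=
          (h.measurable_velocity.norm.sub_const _).ennreal_ofReal
        rw [hνκ, lintegral_map (measurable_bigStep _).enorm (hpairm k), ← hstep k]
        refine (lintegral_mono fun s => h.enorm_bigStep_le s (htk k) hK).trans (le_of_eq ?_)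
        rw [lintegral_const_mul _ hTm.lintegral_prod_right']
        congr 1
        exact lintegral_lintegral_swap hTm.aemeasurable
      calc 2 * ∑ k ∈ Finset.Ico i j, ∫⁻ p, ‖bigStep (((1 : ℝ) / 2) ^ n * K) p‖ₑ ∂(ν k ⊗ₘ κ k)
          ≤ 2 * ∑ k ∈ Finset.Ico i j, 2 * ∫⁻ u in Ico (t k) (t (k + 1)),
            ∫⁻ s, ENNReal.ofReal (‖w s u‖ - K / 2) ∂P := by
            gcongr with k
            exact this k
        _ = 4 * ∫⁻ u in Ico (t i) (t j), ∫⁻ s, ENNReal.ofReal (‖w s u‖ - K / 2) ∂P := by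
            rw [← Finset.mul_sum, sum_setLIntegral_Ico ht _ hij, ← mul_assoc]
            norm_num
        _ ≤ _ := by
            gcongr
            exact hIco hj
    · calc ∫⁻ z, ‖∑ k ∈ Finset.Ico i j,
            (∫ e, (e - z k) ∂(κ k (z k)) - ((1 : ℝ) / 2) ^ n • b (t k) (z k))‖ₑ ∂Q
          ≤ ∫⁻ z, ∑ k ∈ Finset.Ico i j,
            ‖∫ e, (e - z k) ∂(κ k (z k)) - ((1 : ℝ) / 2) ^ n • b (t k) (z k)‖ₑ ∂Q :=
            lintegral_mono fun z => enorm_sum_le _ _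
        _ = ∑ k ∈ Finset.Ico i j, ∫⁻ z,
            ‖∫ e, (e - z k) ∂(κ k (z k)) - ((1 : ℝ) / 2) ^ n • b (t k) (z k)‖ₑ ∂Q :=
            lintegral_finsetSum _ fun k _ => (hm2 k).comp (measurable_pi_apply k)
        _ ≤ ∑ k ∈ Finset.Ico i j, ∫⁻ u in Ico (t k) (t (k + 1)),
            ∫⁻ s, ‖w s (dyadicFloor n u) - w s u‖ₑ ∂P := by
            refine Finset.sum_le_sum fun k hk => ?_
            have hk' := (Finset.mem_Ico.1 hk).2
            -- The drift error depends on a single coordinate, whose law is that of `y`, so it may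
            -- be computed along `y`.
            have e1 : ∫⁻ z, ‖∫ e, (e - z k) ∂(κ k (z k)) - ((1 : ℝ) / 2) ^ n • b (t k) (z k)‖ₑ ∂Q =
                ∫⁻ s, ‖∫ e, (e - y s (t k)) ∂(κ k (y s (t k))) -
                  (t (k + 1) - t k) • b (t k) (y s (t k))‖ₑ ∂P := by
              rw [← lintegral_map (hm2 k) (measurable_pi_apply k), hmarg k (hk'.le.trans hj),
                lintegral_map (hm2 k) (h.measurable_position_at _), hstep]
            rw [e1]
            refine (h.lintegral_condDistrib_sub_le (dyadicPt n k) (htk k)).trans (le_of_eq ?_)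
            refine setLIntegral_congr_fun measurableSet_Ico fun u hu => ?_
            rw [dyadicFloor_of_mem_Ico hu]
        _ = ∫⁻ u in Ico (t i) (t j), ∫⁻ s, ‖w s (dyadicFloor n u) - w s u‖ₑ ∂P :=
            sum_setLIntegral_Ico ht _ hij
        _ ≤ _ := lintegral_mono_set (hIco hj)

end IsVelocityProcess

end VelocityProcess

/-! ### Tools for the passage to the limit -/

lemma lintegral_add_add {Ω : Type*} [MeasurableSpace Ω] {μ : Measure Ω} {f g : Ω → ENNReal}
    (hf : Measurable f) (hg : Measurable g) (k : Ω → ENNReal) :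
    ∫⁻ x, (f x + g x + k x) ∂μ = ∫⁻ x, f x ∂μ + ∫⁻ x, g x ∂μ + ∫⁻ x, k x ∂μ := by
  rw [lintegral_add_left (f := fun x => f x + g x) (hf.add hg), lintegral_add_left hf]

lemma dyadicPt_refine {m n : ℕ} (hmn : m ≤ n) (k : ℕ) :
    dyadicPt m k = dyadicPt n (k * 2 ^ (n - m)) := by
  simp only [dyadicPt]
  push_cast
  rw [div_eq_div_iff (by positivity) (by positivity), mul_assoc, ← pow_add, Nat.sub_add_cancel hmn]

lemma dyadicFloor_eq_dyadicPt (n : ℕ) {r : ℝ} (hr : r < 2) :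
    ∃ k, k ≤ 2 * 2 ^ n ∧ dyadicFloor n r = dyadicPt n k := by
  refine ⟨⌊r * 2 ^ n⌋₊, ?_, rfl⟩
  refine Nat.floor_le_of_le ?_
  push_cast
  gcongr

lemma dyadicFloor_mono {m n : ℕ} (hmn : m ≤ n) {r : ℝ} (hr : 0 ≤ r) :
    (dyadicFloor m r : ℝ) ≤ dyadicFloor n r := by
  have h1 : dyadicFloor m r = dyadicPt n (⌊r * 2 ^ m⌋₊ * 2 ^ (n - m)) := dyadicPt_refine hmn _
  rw [h1]
  refine dyadicPt_mono n (Nat.le_floor ?_)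
  push_cast
  calc (⌊r * 2 ^ m⌋₊ : ℝ) * 2 ^ (n - m) ≤ r * 2 ^ m * 2 ^ (n - m) := by
        gcongr; exact Nat.floor_le (by positivity)
    _ = r * 2 ^ n := by rw [mul_assoc, ← pow_add, Nat.add_sub_cancel' hmn]

lemma dyadicPt_nonneg (n k : ℕ) : (0 : ℝ) ≤ dyadicPt n k := by
  simp only [dyadicPt]; positivity

lemma dyadicPt_le_two {n k : ℕ} (hk : k ≤ 2 * 2 ^ n) : (dyadicPt n k : ℝ) ≤ 2 := by
  simp only [dyadicPt]
  push_cast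
  rw [div_le_iff₀ (by positivity)]
  exact_mod_cast hk

/-- A Riemann sum on the dyadic grid is the integral of a step function. -/
lemma sum_dyadicPt_eq_setIntegral {F : Type*} [NormedAddCommGroup F] [NormedSpace ℝ F]
    [CompleteSpace F] (n : ℕ) (G : ℚ → F) {i j : ℕ} (hij : i ≤ j) :
    IntegrableOn (fun r => G (dyadicFloor n r)) (Ico (dyadicPt n i : ℝ) (dyadicPt n j)) ∧
    ∑ k ∈ Finset.Ico i j, ((1 : ℝ) / 2) ^ n • G (dyadicPt n k) =
      ∫ r in Ico (dyadicPt n i : ℝ) (dyadicPt n j), G (dyadicFloor n r) := by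
  induction j, hij using Nat.le_induction with
  | base => simp
  | succ j hij ih =>
    have hstep : ∀ r ∈ Ico (dyadicPt n j : ℝ) (dyadicPt n (j + 1)),
        G (dyadicFloor n r) = G (dyadicPt n j) := fun r hr => by rw [dyadicFloor_of_mem_Ico hr]
    have hI : IntegrableOn (fun r => G (dyadicFloor n r))
        (Ico (dyadicPt n j : ℝ) (dyadicPt n (j + 1))) :=
      (integrableOn_congr_fun hstep measurableSet_Ico).2 (by simp)
    have hU := Ico_union_Ico_eq_Ico (dyadicPt_mono n hij) (dyadicPt_mono n j.le_succ)
    have hdisj : Disjoint (Ico (dyadicPt n i : ℝ) (dyadicPt n j))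
        (Ico (dyadicPt n j : ℝ) (dyadicPt n (j + 1))) :=
      Set.disjoint_left.2 fun x hx hx' => absurd hx'.1 (not_le.2 hx.2)
    refine ⟨?_, ?_⟩
    · rw [← hU]
      exact ih.1.union hI
    · rw [Finset.sum_Ico_succ_top hij, ih.2, ← hU,
        setIntegral_union hdisj measurableSet_Ico ih.1 hI]
      congr 1
      rw [setIntegral_congr_fun measurableSet_Ico hstep, setIntegral_const]
      congr 1
      rw [measureReal_def, Real.volume_Ico, dyadicPt_succ_sub, ENNReal.toReal_ofReal (by positivity)]

/-- Weak convergence does not increase first moments of continuous functions in the limit. -/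
lemma lintegral_enorm_le_of_tendsto {Ω F : Type*} [TopologicalSpace Ω] [MeasurableSpace Ω]
    [OpensMeasurableSpace Ω] [HasOuterApproxClosed Ω] [NormedAddCommGroup F]
    {Q : ℕ → ProbabilityMeasure Ω} {Q' : ProbabilityMeasure Ω} (hQ : Tendsto Q atTop (𝓝 Q'))
    {g : Ω → F} (hg : Continuous g) {B : ENNReal}
    (hB : ∀ᶠ n in atTop, ∫⁻ ω, ‖g ω‖ₑ ∂(Q n : Measure Ω) ≤ B) :
    ∫⁻ ω, ‖g ω‖ₑ ∂(Q' : Measure Ω) ≤ B := by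
  have h := lintegral_le_liminf_lintegral_of_forall_isOpen_measure_le_liminf_measure
    (μ := (Q' : Measure Ω)) (μs := fun n => (Q n : Measure Ω)) (f := fun ω => ‖g ω‖) hg.norm
    (fun _ => norm_nonneg _)
    (fun G hG => ProbabilityMeasure.le_liminf_measure_open_of_tendsto hQ hG)
  simp_rw [ofReal_norm] at h
  exact h.trans (liminf_le_of_frequently_le' hB.frequently)

/-- A continuous compactly supported function is Lipschitz up to an arbitrarily small error. -/
lemma exists_almost_lipschitz {X F : Type*} [PseudoMetricSpace X] [NormedAddCommGroup F]
    {c : X → F} (hc : Continuous c) (hcs : HasCompactSupport c) {ε : ℝ} (hε : 0 < ε) :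
    ∃ C : ℝ, 0 ≤ C ∧ ∀ z z', ‖c z - c z'‖ ≤ ε + C * dist z z' := by
  obtain ⟨δ, hδ, hu⟩ := Metric.uniformContinuous_iff.1
    (hcs.uniformContinuous_of_continuous hc) ε hε
  obtain ⟨M, hM⟩ := hcs.exists_bound_of_continuous hc
  -- Below distance `δ` uniform continuity gives `ε`; beyond it the oscillation, at most `2 * |M|`,
  -- is dominated by the linear term.
  refine ⟨2 * |M| / δ, by positivity, fun z z' => ?_⟩
  by_cases h : dist z z' < δ
  · have := hu h
    rw [dist_eq_norm] at this
    have : 0 ≤ 2 * |M| / δ * dist z z' := by positivity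
    linarith
  · have h1 : 2 * |M| ≤ 2 * |M| / δ * dist z z' := by
      rw [div_mul_eq_mul_div, le_div_iff₀ hδ]
      gcongr
      exact not_lt.1 h
    have := norm_sub_le (c z) (c z')
    linarith [hM z, hM z', le_abs_self M]

/-- Composition with an almost Lipschitz function in mean. -/
lemma lintegral_enorm_comp_sub_le {Ω X F : Type*} [MeasurableSpace Ω] (μ : Measure Ω)
    [IsProbabilityMeasure μ] [NormedAddCommGroup X] [NormedAddCommGroup F] {c : ℝ × X → F}
    {ε C : ℝ} (hε : 0 ≤ ε) (hC : 0 ≤ C) (hc : ∀ z z', ‖c z - c z'‖ ≤ ε + C * dist z z')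
    {r r' δ : ℝ} (hδ : |r - r'| ≤ δ) {Z Z' : Ω → X} {η : ENNReal}
    (hZ : ∫⁻ ω, ‖Z ω - Z' ω‖ₑ ∂μ ≤ η) :
    ∫⁻ ω, ‖c (r, Z ω) - c (r', Z' ω)‖ₑ ∂μ ≤
      ENNReal.ofReal ε + ENNReal.ofReal C * (ENNReal.ofReal δ + η) := by
  have hδ0 : 0 ≤ δ := (abs_nonneg _).trans hδ
  calc ∫⁻ ω, ‖c (r, Z ω) - c (r', Z' ω)‖ₑ ∂μ
      ≤ ∫⁻ ω, (ENNReal.ofReal ε + ENNReal.ofReal C * (ENNReal.ofReal δ + ‖Z ω - Z' ω‖ₑ)) ∂μ := by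
        refine lintegral_mono fun ω => ?_
        rw [← ofReal_norm, ← ofReal_norm, ← ENNReal.ofReal_add hδ0 (norm_nonneg _),
          ← ENNReal.ofReal_mul hC, ← ENNReal.ofReal_add hε (by positivity)]
        refine ENNReal.ofReal_le_ofReal ((hc _ _).trans ?_)
        gcongr
        rw [Prod.dist_eq, Real.dist_eq, dist_eq_norm]
        exact max_le (hδ.trans (by simp)) (by simpa using hδ0)
    _ = ENNReal.ofReal ε + ENNReal.ofReal C * (ENNReal.ofReal δ + ∫⁻ ω, ‖Z ω - Z' ω‖ₑ ∂μ) := by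
        rw [lintegral_add_left measurable_const, lintegral_const_mul' _ _ ENNReal.ofReal_ne_top,
          lintegral_add_left measurable_const]
        simp
    _ ≤ _ := by gcongr

/-! ### Estimates along the approximating chains -/

namespace IsVelocityProcess

variable {S : Type*} [MeasurableSpace S] {E : Type*} [NormedAddCommGroup E] [InnerProductSpace ℝ E]
  [MeasurableSpace E] [BorelSpace E] [SecondCountableTopology E] [CompleteSpace E]

variable {P : Measure S} [IsProbabilityMeasure P] {y w : S → ℝ → E} {b : ℝ → E → E}

/-- Dominated convergence with majorant `‖w‖`: at each point the excess vanishes once `K ≥ 2 * ‖w‖`.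
This makes the large steps negligible uniformly in the mesh. -/
lemma tendsto_lintegral_excess (h : IsVelocityProcess P y w b) :
    Tendsto (fun K : ℕ => ∫⁻ u in Icc (0 : ℝ) 2, ∫⁻ s, ENNReal.ofReal (‖w s u‖ - K / 2) ∂P)
      atTop (𝓝 0) := by
  have hm : ∀ K : ℕ, Measurable fun p : ℝ × S => ENNReal.ofReal (‖w p.2 p.1‖ - K / 2) := fun K =>
    ((h.measurable_velocity.comp measurable_swap).norm.sub_const _).ennreal_ofReal
  have hw : Measurable fun p : ℝ × S => ‖w p.2 p.1‖ₑ :=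
    (h.measurable_velocity.comp measurable_swap).enorm
  simp_rw [← lintegral_prod _ (hm _).aemeasurable]
  have := tendsto_lintegral_of_dominated_convergence (μ := (volume.restrict (Icc (0 : ℝ) 2)).prod P)
    (F := fun (K : ℕ) p => ENNReal.ofReal (‖w p.2 p.1‖ - K / 2)) (f := fun _ => 0)
    (fun p => ‖w p.2 p.1‖ₑ) hm (fun K => ae_of_all _ fun p => ?_) ?_ (ae_of_all _ fun p => ?_)
  · simpa using this
  · beta_reduce
    rw [← ofReal_norm]
    exact ENNReal.ofReal_le_ofReal (sub_le_self _ (by positivity))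
  · rw [lintegral_prod _ hw.aemeasurable]
    exact ne_top_of_le_ne_top h.lintegral_velocity_swap_ne_top
      (lintegral_mono' Measure.restrict_le_self le_rfl)
  · refine tendsto_const_nhds.congr' ?_
    obtain ⟨K₀, hK₀⟩ := exists_nat_ge (2 * ‖w p.2 p.1‖)
    filter_upwards [eventually_ge_atTop K₀] with K hK
    have : (K₀ : ℝ) ≤ K := by exact_mod_cast hK
    rw [ENNReal.ofReal_of_nonpos (by linarith)]

/-- The mean displacement over short time intervals is uniformly small. -/
lemma eventually_lintegral_velocity_le (h : IsVelocityProcess P y w b) {η : ENNReal} (hη : 0 < η) :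
    ∀ᶠ m : ℕ in atTop, ∀ r r' : ℝ, r' ≤ r + (1 / 2) ^ m →
      ∫⁻ u in Ico r r', ∫⁻ s, ‖w s u‖ₑ ∂P ≤ η := by
  obtain ⟨δ, hδ, hδ'⟩ := exists_pos_setLIntegral_lt_of_measure_lt
    h.lintegral_velocity_swap_ne_top hη.ne'
  have hlim : Tendsto (fun m : ℕ => ENNReal.ofReal ((1 / 2) ^ m)) atTop (𝓝 0) := by
    have := ENNReal.tendsto_ofReal (tendsto_pow_atTop_nhds_zero_of_lt_one
      (by norm_num : (0 : ℝ) ≤ 1 / 2) (by norm_num))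
    simpa using this
  filter_upwards [hlim.eventually_lt_const hδ] with m hm r r' hr
  refine (hδ' _ (lt_of_le_of_lt ?_ hm)).le
  rw [Real.volume_Ico]
  exact ENNReal.ofReal_le_ofReal (by linarith)

/-- The chains of `exists_dyadic_chain` asymptotically follow the field `b`. -/
lemma exists_dyadic_chain_seq (h : IsVelocityProcess P y w b) {φ : ℕ → ℕ} (hφ : StrictMono φ)
    (hw : Tendsto (fun n => ∫⁻ u in Icc (0 : ℝ) 2, ∫⁻ s,
      ‖w s (dyadicFloor (φ n) u) - w s u‖ₑ ∂P) atTop (𝓝 0)) :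
    ∃ Q : ℕ → ProbabilityMeasure (ℚ → E),
      (∀ n, ∀ q : ℚ, (Q n : Measure (ℚ → E)).map (fun ω => ω q) = P.map (fun s => y s q) ∨
        (Q n : Measure (ℚ → E)).map (fun ω => ω q) = Measure.dirac 0) ∧
      (∀ n, ∀ k ≤ 2 * 2 ^ n, (Q n : Measure (ℚ → E)).map (fun ω => ω (dyadicPt n k)) =
        P.map (fun s => y s (dyadicPt n k))) ∧
      (∀ n, ∀ i j, i ≤ j → j ≤ 2 * 2 ^ n →
        ∫⁻ ω, ‖ω (dyadicPt n j) - ω (dyadicPt n i)‖ₑ ∂(Q n : Measure (ℚ → E)) ≤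
        ∫⁻ u in Ico (dyadicPt n i : ℝ) (dyadicPt n j), ∫⁻ s, ‖w s u‖ₑ ∂P) ∧
      (∀ δ : ℝ, 0 < δ → ∀ᶠ l in atTop, ∀ i j, i ≤ j → j ≤ 2 * 2 ^ φ l →
        ∫⁻ ω, ‖ω (dyadicPt (φ l) j) - ω (dyadicPt (φ l) i) - ∑ k ∈ Finset.Ico i j,
          ((1 : ℝ) / 2) ^ φ l • b (dyadicPt (φ l) k) (ω (dyadicPt (φ l) k))‖ₑ
            ∂(Q (φ l) : Measure (ℚ → E)) ≤ ENNReal.ofReal δ) := by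
  choose Q hQ hQ1 hQ2 hQ3 hQ4 using h.exists_dyadic_chain
  refine ⟨fun n => ⟨Q n, hQ n⟩, hQ1, hQ2, hQ3, fun δ hδ => ?_⟩
  have hδ3 : 0 < ENNReal.ofReal (δ / 3) := by simpa using hδ
  have htail := ENNReal.Tendsto.const_mul (a := 4) h.tendsto_lintegral_excess (Or.inr (by simp))
  rw [mul_zero] at htail
  -- First fix `K` so that large steps cost at most `δ / 3` at every level. The martingale condition
  -- with `a = δ / 3` then reads `8 K² 2⁻ⁿ ≤ (δ / 3)²`, true at fine levels.
  obtain ⟨K, hK⟩ := (ENNReal.tendsto_nhds_zero.1 htail _ hδ3).exists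
  have hpow : Tendsto (fun l => ((2 * 2 ^ φ l : ℕ) : ℝ) * (2 * ((1 / 2) ^ φ l * (K : ℝ))) ^ 2)
      atTop (𝓝 0) := by
    have h0 : Tendsto (fun l => 8 * (K : ℝ) ^ 2 * (1 / 2) ^ φ l) atTop (𝓝 (8 * (K : ℝ) ^ 2 * 0)) :=
      ((tendsto_pow_atTop_nhds_zero_of_lt_one (by norm_num) (by norm_num)).comp
        hφ.tendsto_atTop).const_mul _
    rw [mul_zero] at h0
    refine h0.congr fun l => ?_
    have : ((2 : ℝ) ^ φ l) * (1 / 2) ^ φ l = 1 := by rw [← mul_pow]; norm_num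
    push_cast
    linear_combination (-8 * (K : ℝ) ^ 2 * (1 / 2) ^ φ l) * this
  filter_upwards [hpow.eventually_le_const (by positivity : (0 : ℝ) < (δ / 3) ^ 2),
    ENNReal.tendsto_nhds_zero.1 hw _ hδ3] with l hl1 hl2 i j hij hj
  refine (hQ4 (φ l) i j hij hj K (δ / 3) (by positivity) (by positivity) hl1).trans ?_
  calc _ ≤ ENNReal.ofReal (δ / 3) + ENNReal.ofReal (δ / 3) + ENNReal.ofReal (δ / 3) := by
        gcongr
    _ = ENNReal.ofReal δ := by
        rw [← ENNReal.ofReal_add (by positivity) (by positivity),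
          ← ENNReal.ofReal_add (by positivity) (by positivity)]
        congr 1; ring

/-- The main estimate along the approximating chains, at a coarser level `m ≤ n` and with a
regular approximation `c` of the field. -/
lemma lintegral_coarse_le (h : IsVelocityProcess P y w b) {n m : ℕ} (hmn : m ≤ n)
    (Q : Measure (ℚ → E)) [IsProbabilityMeasure Q]
    (hmarg : ∀ k ≤ 2 * 2 ^ n, Q.map (fun ω => ω (dyadicPt n k)) =
        P.map (fun s => y s (dyadicPt n k)))
    (hincr : ∀ i j, i ≤ j → j ≤ 2 * 2 ^ n → ∫⁻ ω, ‖ω (dyadicPt n j) - ω (dyadicPt n i)‖ₑ ∂Q ≤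
        ∫⁻ u in Ico (dyadicPt n i : ℝ) (dyadicPt n j), ∫⁻ s, ‖w s u‖ₑ ∂P)
    {β : ENNReal} (hβ : ∀ i j, i ≤ j → j ≤ 2 * 2 ^ n →
        ∫⁻ ω, ‖ω (dyadicPt n j) - ω (dyadicPt n i) - ∑ k ∈ Finset.Ico i j,
          ((1 : ℝ) / 2) ^ n • b (dyadicPt n k) (ω (dyadicPt n k))‖ₑ ∂Q ≤ β)
    {c : ℝ × E → E} (hc : Continuous c) {ε C : ℝ} (hε : 0 ≤ ε) (hC : 0 ≤ C)
    (hcC : ∀ z z', ‖c z - c z'‖ ≤ ε + C * dist z z') {η : ENNReal}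
    (hη : ∀ r r' : ℝ, r' ≤ r + (1 / 2) ^ m → ∫⁻ u in Ico r r', ∫⁻ s, ‖w s u‖ₑ ∂P ≤ η)
    {i j : ℕ} (hij : i ≤ j) (hj : j ≤ 2 * 2 ^ m) :
    ∫⁻ ω, ‖ω (dyadicPt m j) - ω (dyadicPt m i) - ∑ k ∈ Finset.Ico i j,
      ((1 : ℝ) / 2) ^ m • c (dyadicPt m k, ω (dyadicPt m k))‖ₑ ∂Q ≤
      β + (∫⁻ u in Icc (0 : ℝ) 2, ∫⁻ s,
        ‖b (dyadicFloor n u) (y s (dyadicFloor n u)) - b u (y s u)‖ₑ ∂P) +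
      (∫⁻ u in Icc (0 : ℝ) 2, ∫⁻ s, ‖b u (y s u) - c (u, y s u)‖ₑ ∂P) +
      4 * (ENNReal.ofReal ε + ENNReal.ofReal C * (ENNReal.ofReal ((1 / 2) ^ m) + η)) := by
  -- A bound for the mean variation of `c` when time moves by at most `2⁻ᵐ` and position by at most
  -- `η` in mean.
  set ρ := ENNReal.ofReal ε + ENNReal.ofReal C * (ENNReal.ofReal ((1 / 2) ^ m) + η) with hρ
  set i' := i * 2 ^ (n - m) with hi'
  set j' := j * 2 ^ (n - m) with hj'
  have hij' : i' ≤ j' := Nat.mul_le_mul_right _ hij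
  have hjn : j' ≤ 2 * 2 ^ n := by
    calc j' ≤ 2 * 2 ^ m * 2 ^ (n - m) := Nat.mul_le_mul_right _ hj
      _ = 2 * 2 ^ n := by rw [mul_assoc, ← pow_add, Nat.add_sub_cancel' hmn]
  have ei : dyadicPt m i = dyadicPt n i' := dyadicPt_refine hmn i
  have ej : dyadicPt m j = dyadicPt n j' := dyadicPt_refine hmn j
  set I := Ico (dyadicPt m i : ℝ) (dyadicPt m j) with hI
  have hI2 : ∀ r ∈ I, 0 ≤ r ∧ r < 2 := fun r hr =>
    ⟨(dyadicPt_nonneg m i).trans hr.1, hr.2.trans_le (dyadicPt_le_two hj)⟩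
  have hIsub : I ⊆ Icc 0 2 := fun r hr => ⟨(hI2 r hr).1, (hI2 r hr).2.le⟩
  have hIm : MeasurableSet I := measurableSet_Ico
  have hvol : volume I ≤ 2 := (measure_mono hIsub).trans (by simp)
  have hbm := h.measurable_field
  have hym := h.measurable_position
  -- pointwise decomposition
  have hdec : ∀ ω : ℚ → E, ω (dyadicPt m j) - ω (dyadicPt m i) - ∑ k ∈ Finset.Ico i j,
      ((1 : ℝ) / 2) ^ m • c (dyadicPt m k, ω (dyadicPt m k)) =
      (ω (dyadicPt n j') - ω (dyadicPt n i') - ∑ k ∈ Finset.Ico i' j',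
          ((1 : ℝ) / 2) ^ n • b (dyadicPt n k) (ω (dyadicPt n k))) +
      (∫ r in I, (b (dyadicFloor n r) (ω (dyadicFloor n r)) -
        c (dyadicFloor n r, ω (dyadicFloor n r)))) +
      ∫ r in I, (c (dyadicFloor n r, ω (dyadicFloor n r)) -
        c (dyadicFloor m r, ω (dyadicFloor m r))) := by
    intro ω
    have h1 := sum_dyadicPt_eq_setIntegral m (fun q => c (q, ω q)) hij
    have h2 := sum_dyadicPt_eq_setIntegral n (fun q => c (q, ω q)) hij'
    have h3 := sum_dyadicPt_eq_setIntegral n (fun q => b q (ω q)) hij'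
    rw [← ei, ← ej] at h2 h3
    rw [integral_sub h3.1 h2.1, integral_sub h2.1 h1.1, h1.2, ← ei, ← ej, h3.2]
    abel
  have hωm : ∀ l, Measurable fun p : (ℚ → E) × ℝ => p.1 (dyadicFloor l p.2) := by
    intro l
    have : Measurable fun p : (ℚ → E) × ℚ => p.1 p.2 :=
      measurable_from_prod_countable_left fun q => by fun_prop
    exact this.comp (by fun_prop : Measurable fun p : (ℚ → E) × ℝ => (p.1, dyadicFloor l p.2))
  have hfl : ∀ l, Measurable fun p : (ℚ → E) × ℝ => ((dyadicFloor l p.2 : ℚ) : ℝ) := fun l =>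
    (measurable_of_countable (fun q : ℚ => (q : ℝ))).comp (by fun_prop)
  have hcm : ∀ l, Measurable fun p : (ℚ → E) × ℝ =>
      c (dyadicFloor l p.2, p.1 (dyadicFloor l p.2)) := fun l =>
    hc.measurable.comp ((hfl l).prodMk (hωm l))
  have hbm' : Measurable fun p : (ℚ → E) × ℝ =>
      b (dyadicFloor n p.2) (p.1 (dyadicFloor n p.2)) := hbm.comp ((hfl n).prodMk (hωm n))
  -- the three terms
  have hterm2 : ∫⁻ ω, ‖∫ r in I, (b (dyadicFloor n r) (ω (dyadicFloor n r)) -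
        c (dyadicFloor n r, ω (dyadicFloor n r)))‖ₑ ∂Q ≤
      (∫⁻ u in Icc (0 : ℝ) 2, ∫⁻ s,
        ‖b (dyadicFloor n u) (y s (dyadicFloor n u)) - b u (y s u)‖ₑ ∂P) +
      (∫⁻ u in Icc (0 : ℝ) 2, ∫⁻ s, ‖b u (y s u) - c (u, y s u)‖ₑ ∂P) + 2 * ρ := by
    have hflS : Measurable fun p : ℝ × S => ((dyadicFloor n p.1 : ℚ) : ℝ) :=
      (measurable_of_countable (fun q : ℚ => (q : ℝ))).comp (by fun_prop)
    have m1 : Measurable fun p : ℝ × S =>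
        ‖b (dyadicFloor n p.1) (y p.2 (dyadicFloor n p.1)) - b p.1 (y p.2 p.1)‖ₑ :=
      ((hbm.comp (hflS.prodMk (hym.comp (measurable_snd.prodMk hflS)))).sub
        (hbm.comp (measurable_fst.prodMk (hym.comp measurable_swap)))).enorm
    have m2 : Measurable fun p : ℝ × S => ‖b p.1 (y p.2 p.1) - c (p.1, y p.2 p.1)‖ₑ :=
      ((hbm.comp (measurable_fst.prodMk (hym.comp measurable_swap))).sub
        (hc.measurable.comp (measurable_fst.prodMk (hym.comp measurable_swap)))).enorm
    calc ∫⁻ ω, ‖∫ r in I, (b (dyadicFloor n r) (ω (dyadicFloor n r)) -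
          c (dyadicFloor n r, ω (dyadicFloor n r)))‖ₑ ∂Q
        ≤ ∫⁻ ω, (∫⁻ r in I, ‖b (dyadicFloor n r) (ω (dyadicFloor n r)) -
          c (dyadicFloor n r, ω (dyadicFloor n r))‖ₑ) ∂Q :=
          lintegral_mono fun ω => enorm_integral_le_lintegral_enorm _
      _ = ∫⁻ r in I, ∫⁻ ω, ‖b (dyadicFloor n r) (ω (dyadicFloor n r)) -
          c (dyadicFloor n r, ω (dyadicFloor n r))‖ₑ ∂Q :=
          lintegral_lintegral_swap (hbm'.sub (hcm n)).enorm.aemeasurable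
      _ ≤ ∫⁻ r in I, ((∫⁻ s, ‖b (dyadicFloor n r) (y s (dyadicFloor n r)) - b r (y s r)‖ₑ ∂P) +
            (∫⁻ s, ‖b r (y s r) - c (r, y s r)‖ₑ ∂P) + ρ) := by
          refine setLIntegral_mono' hIm fun r hr => ?_
          obtain ⟨hr0, hr2⟩ := hI2 r hr
          obtain ⟨k, hk, ek⟩ := dyadicFloor_eq_dyadicPt n hr2
          have hle := dyadicFloor_le n hr0
          have hmk : Measurable fun x : E => ‖b (dyadicFloor n r) x - c (dyadicFloor n r, x)‖ₑ :=
            ((h.measurable_field_at _).sub (hc.measurable.comp (by fun_prop))).enorm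
          -- Chain and process have the same law at grid times, so the discrepancy between `b` and
          -- `c` is moved to `y`, then from the grid time to `r`.
          have e1 : ∫⁻ ω, ‖b (dyadicFloor n r) (ω (dyadicFloor n r)) -
              c (dyadicFloor n r, ω (dyadicFloor n r))‖ₑ ∂Q =
              ∫⁻ s, ‖b (dyadicFloor n r) (y s (dyadicFloor n r)) -
                c (dyadicFloor n r, y s (dyadicFloor n r))‖ₑ ∂P := by
            rw [← lintegral_map hmk (measurable_pi_apply _), ek, hmarg k hk, ← ek,
              lintegral_map hmk (h.measurable_position_at _)]
          have e2 : ∫⁻ s, ‖c (r, y s r) - c (dyadicFloor n r, y s (dyadicFloor n r))‖ₑ ∂P ≤ ρ := by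
            refine lintegral_enorm_comp_sub_le P hε hC hcC ?_
              ((h.lintegral_position_sub_le hle).trans (hη _ _ ?_))
            · rw [abs_sub_comm]
              exact (abs_dyadicFloor_sub_le n hr0).trans
                (pow_le_pow_of_le_one (by norm_num) (by norm_num) hmn)
            · have := (pow_le_pow_of_le_one (by norm_num : (0 : ℝ) ≤ 1 / 2) (by norm_num) hmn)
              linarith [lt_dyadicFloor_add n r]
          rw [e1]
          calc ∫⁻ s, ‖b (dyadicFloor n r) (y s (dyadicFloor n r)) -
                c (dyadicFloor n r, y s (dyadicFloor n r))‖ₑ ∂P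
              ≤ ∫⁻ s, (‖b (dyadicFloor n r) (y s (dyadicFloor n r)) - b r (y s r)‖ₑ +
                ‖b r (y s r) - c (r, y s r)‖ₑ +
                ‖c (r, y s r) - c (dyadicFloor n r, y s (dyadicFloor n r))‖ₑ) ∂P := by
                refine lintegral_mono fun s => ?_
                refine le_trans (le_of_eq ?_) ((enorm_add_le _ _).trans
                  (add_le_add (enorm_add_le _ _) le_rfl))
                congr 1; abel
            _ ≤ _ := by
                have m1' := m1.comp (by fun_prop : Measurable fun s : S => (r, s))
                have m2' := m2.comp (by fun_prop : Measurable fun s : S => (r, s))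
                exact (lintegral_add_add m1' m2' _).trans_le (add_le_add le_rfl e2)
      _ ≤ _ := by
          refine (lintegral_add_add m1.lintegral_prod_right' m2.lintegral_prod_right' _).trans_le ?_
          rw [setLIntegral_const, mul_comm 2 ρ]
          gcongr
  -- Coarsening the sum of `c` from level `n` to level `m`: the two grid times are within `2⁻ᵐ`, and
  -- the increment bound makes the mean displacement at most `η`.
  have hterm3 : ∫⁻ ω, ‖∫ r in I, (c (dyadicFloor n r, ω (dyadicFloor n r)) -
        c (dyadicFloor m r, ω (dyadicFloor m r)))‖ₑ ∂Q ≤ 2 * ρ := by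
    calc ∫⁻ ω, ‖∫ r in I, (c (dyadicFloor n r, ω (dyadicFloor n r)) -
          c (dyadicFloor m r, ω (dyadicFloor m r)))‖ₑ ∂Q
        ≤ ∫⁻ ω, (∫⁻ r in I, ‖c (dyadicFloor n r, ω (dyadicFloor n r)) -
          c (dyadicFloor m r, ω (dyadicFloor m r))‖ₑ) ∂Q :=
          lintegral_mono fun ω => enorm_integral_le_lintegral_enorm _
      _ = ∫⁻ r in I, ∫⁻ ω, ‖c (dyadicFloor n r, ω (dyadicFloor n r)) -
          c (dyadicFloor m r, ω (dyadicFloor m r))‖ₑ ∂Q :=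
          lintegral_lintegral_swap ((hcm n).sub (hcm m)).enorm.aemeasurable
      _ ≤ ∫⁻ r in I, ρ := by
          refine setLIntegral_mono' hIm fun r hr => ?_
          obtain ⟨hr0, hr2⟩ := hI2 r hr
          have hle := dyadicFloor_mono hmn hr0
          have hlt : (dyadicFloor n r : ℝ) ≤ dyadicFloor m r + (1 / 2) ^ m :=
            (dyadicFloor_le n hr0).trans (lt_dyadicFloor_add m r).le
          have e3 : ∫⁻ ω, ‖ω (dyadicFloor n r) - ω (dyadicFloor m r)‖ₑ ∂Q ≤ η := by
            obtain ⟨k, hk, ek⟩ := dyadicFloor_eq_dyadicPt n hr2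
            have ek' : dyadicFloor m r = dyadicPt n (⌊r * 2 ^ m⌋₊ * 2 ^ (n - m)) :=
              dyadicPt_refine hmn _
            refine le_trans ?_ (hη (dyadicFloor m r) (dyadicFloor n r) hlt)
            rw [ek, ek'] at hle ⊢
            refine hincr _ _ ?_ hk
            simp only [dyadicPt] at hle
            push_cast at hle
            rw [div_le_div_iff_of_pos_right (by positivity)] at hle
            exact_mod_cast hle
          refine lintegral_enorm_comp_sub_le Q hε hC hcC ?_ e3
          rw [abs_of_nonneg (by linarith)]
          linarith
      _ ≤ 2 * ρ := by
          rw [setLIntegral_const, mul_comm]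
          gcongr
  simp_rw [hdec]
  have n1 : Measurable fun ω : ℚ → E => ω (dyadicPt n j') - ω (dyadicPt n i') -
      ∑ k ∈ Finset.Ico i' j', ((1 : ℝ) / 2) ^ n • b (dyadicPt n k) (ω (dyadicPt n k)) :=
    (by fun_prop : Measurable fun ω : ℚ → E => ω (dyadicPt n j') - ω (dyadicPt n i')).sub
      (Finset.measurable_fun_sum _ fun k _ =>
        ((h.measurable_field_at _).comp (measurable_pi_apply _)).const_smul _)
  have n2 : Measurable fun ω : ℚ → E => ∫ r in I, (b (dyadicFloor n r) (ω (dyadicFloor n r)) -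
        c (dyadicFloor n r, ω (dyadicFloor n r))) :=
    ((hbm'.sub (hcm n)).stronglyMeasurable.integral_prod_right').measurable
  calc _ ≤ ∫⁻ ω, (‖ω (dyadicPt n j') - ω (dyadicPt n i') -
          ∑ k ∈ Finset.Ico i' j', ((1 : ℝ) / 2) ^ n • b (dyadicPt n k) (ω (dyadicPt n k))‖ₑ +
        ‖∫ r in I, (b (dyadicFloor n r) (ω (dyadicFloor n r)) -
          c (dyadicFloor n r, ω (dyadicFloor n r)))‖ₑ +
        ‖∫ r in I, (c (dyadicFloor n r, ω (dyadicFloor n r)) -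
          c (dyadicFloor m r, ω (dyadicFloor m r)))‖ₑ) ∂Q :=
        lintegral_mono fun ω => (enorm_add_le _ _).trans (add_le_add (enorm_add_le _ _) le_rfl)
    _ ≤ _ := (lintegral_add_add n1.enorm n2.enorm _).trans_le
        (add_le_add (add_le_add (hβ i' j' hij' hjn) hterm2) hterm3)
    _ = _ := by ring

end IsVelocityProcess

/-! ### The limit law on dyadic paths and its extension to continuous time -/

lemma dyadicPt_zero (n : ℕ) : dyadicPt n 0 = 0 := by simp [dyadicPt]

lemma dyadicPt_two (n : ℕ) : dyadicPt n (2 * 2 ^ n) = 2 := by simp [dyadicPt]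

lemma measurable_eval_dyadicFloor {E : Type*} [MeasurableSpace E] (l : ℕ) :
    Measurable fun p : (ℚ → E) × ℝ => p.1 (dyadicFloor l p.2) := by
  have : Measurable fun p : (ℚ → E) × ℚ => p.1 p.2 :=
    measurable_from_prod_countable_left fun q => by fun_prop
  exact this.comp (by fun_prop : Measurable fun p : (ℚ → E) × ℝ => (p.1, dyadicFloor l p.2))

lemma measurable_dyadicFloor_real (l : ℕ) : Measurable fun r : ℝ => ((dyadicFloor l r : ℚ) : ℝ) :=
  (measurable_of_countable (fun q : ℚ => (q : ℝ))).comp (by fun_prop)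

namespace IsVelocityProcess

variable {S : Type*} [MeasurableSpace S] {E : Type*} [NormedAddCommGroup E] [InnerProductSpace ℝ E]
  [MeasurableSpace E] [BorelSpace E] [SecondCountableTopology E] [CompleteSpace E]

variable {P : Measure S} [IsProbabilityMeasure P] {y w : S → ℝ → E} {b : ℝ → E → E}

/-- A law on dyadic paths, with the same one-time laws as `y`, which approximately follows `b`. -/
structure IsLimitLaw (P : Measure S) (y w : S → ℝ → E) (b : ℝ → E → E) (Q : Measure (ℚ → E)) :
    Prop where
  map_eval : ∀ m, ∀ k ≤ 2 * 2 ^ m,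
    Q.map (fun ω => ω (dyadicPt m k)) = P.map (fun s => y s (dyadicPt m k))
  lintegral_incr : ∀ m, ∀ i j, i ≤ j → j ≤ 2 * 2 ^ m →
    ∫⁻ ω, ‖ω (dyadicPt m j) - ω (dyadicPt m i)‖ₑ ∂Q ≤
      ∫⁻ u in Ico (dyadicPt m i : ℝ) (dyadicPt m j), ∫⁻ s, ‖w s u‖ₑ ∂P
  lintegral_coarse : ∀ m (c : ℝ × E → E), Continuous c → ∀ ε C : ℝ, 0 ≤ ε → 0 ≤ C →
    (∀ z z', ‖c z - c z'‖ ≤ ε + C * dist z z') → ∀ η : ENNReal,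
    (∀ r r' : ℝ, r' ≤ r + (1 / 2) ^ m → ∫⁻ u in Ico r r', ∫⁻ s, ‖w s u‖ₑ ∂P ≤ η) →
    ∀ i j, i ≤ j → j ≤ 2 * 2 ^ m →
    ∫⁻ ω, ‖ω (dyadicPt m j) - ω (dyadicPt m i) - ∑ k ∈ Finset.Ico i j,
      ((1 : ℝ) / 2) ^ m • c (dyadicPt m k, ω (dyadicPt m k))‖ₑ ∂Q ≤
      (∫⁻ u in Icc (0 : ℝ) 2, ∫⁻ s, ‖b u (y s u) - c (u, y s u)‖ₑ ∂P) +
      4 * (ENNReal.ofReal ε + ENNReal.ofReal C * (ENNReal.ofReal ((1 / 2) ^ m) + η))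

/-- A weak subsequential limit of the chains. At a fixed level `m` each condition concerns finitely
many coordinates through continuous functions, so it survives the limit, while the errors belonging
to the level of the chain vanish. -/
lemma exists_isLimitLaw (h : IsVelocityProcess P y w b) {φ : ℕ → ℕ} (hφ : StrictMono φ)
    (hw : Tendsto (fun n => ∫⁻ u in Icc (0 : ℝ) 2, ∫⁻ s,
      ‖w s (dyadicFloor (φ n) u) - w s u‖ₑ ∂P) atTop (𝓝 0))
    (hb : Tendsto (fun n => ∫⁻ u in Icc (0 : ℝ) 2, ∫⁻ s,
      ‖b (dyadicFloor (φ n) u) (y s (dyadicFloor (φ n) u)) - b u (y s u)‖ₑ ∂P) atTop (𝓝 0)) :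
    ∃ Q : Measure (ℚ → E), IsProbabilityMeasure Q ∧ IsLimitLaw P y w b Q := by
  obtain ⟨Q, hQ1, hQ2, hQ3, hQ4⟩ := h.exists_dyadic_chain_seq hφ hw
  have hPr : ∀ r, IsProbabilityMeasure (P.map fun s => y s r) := fun r =>
    Measure.isProbabilityMeasure_map (h.measurable_position_at r).aemeasurable
  obtain ⟨Q', ψ, hψ, hlim⟩ := exists_subseq_tendsto_of_tight_marginals (fun l => Q (φ l)) (by
    intro q
    -- At each rational time only two laws ever occur.
    refine IsTightMeasureSet.subset (T := {P.map fun s => y s q} ∪ {Measure.dirac 0})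
      (isTightMeasureSet_singleton.union isTightMeasureSet_singleton) ?_
    rintro _ ⟨l, rfl⟩
    exact hQ1 (φ l) q)
  have hlev : Tendsto (fun l => φ (ψ l)) atTop atTop := (hφ.comp hψ).tendsto_atTop
  refine ⟨Q', inferInstance, ?_, ?_, ?_⟩
  · intro m k hk
    have h1 := ProbabilityMeasure.tendsto_map_of_tendsto_of_continuous _ _ hlim
      (continuous_apply (A := fun _ : ℚ => E) (dyadicPt m k))
    have h2 : Tendsto (fun l => (Q (φ (ψ l))).map
        (continuous_apply (A := fun _ : ℚ => E) (dyadicPt m k)).measurable.aemeasurable) atTop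
        (𝓝 ⟨P.map (fun s => y s (dyadicPt m k)), hPr _⟩) := by
      refine tendsto_const_nhds.congr' ?_
      filter_upwards [hlev.eventually_ge_atTop m] with l hl
      refine Subtype.ext ?_
      have hk' : k * 2 ^ (φ (ψ l) - m) ≤ 2 * 2 ^ φ (ψ l) := by
        calc k * 2 ^ (φ (ψ l) - m) ≤ 2 * 2 ^ m * 2 ^ (φ (ψ l) - m) := Nat.mul_le_mul_right _ hk
          _ = 2 * 2 ^ φ (ψ l) := by rw [mul_assoc, ← pow_add, Nat.add_sub_cancel' hl]
      have := hQ2 (φ (ψ l)) _ hk'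
      rw [← dyadicPt_refine hl] at this
      exact this.symm.trans (ProbabilityMeasure.toMeasure_map _ _).symm
    have h3 := congrArg (fun μ : ProbabilityMeasure E => (μ : Measure E)) (tendsto_nhds_unique h1 h2)
    simpa using h3
  · intro m i j hij hj
    refine lintegral_enorm_le_of_tendsto hlim (by fun_prop) ?_
    filter_upwards [hlev.eventually_ge_atTop m] with l hl
    rw [dyadicPt_refine hl, dyadicPt_refine hl]
    refine hQ3 (φ (ψ l)) _ _ (Nat.mul_le_mul_right _ hij) ?_
    calc j * 2 ^ (φ (ψ l) - m) ≤ 2 * 2 ^ m * 2 ^ (φ (ψ l) - m) := Nat.mul_le_mul_right _ hj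
      _ = 2 * 2 ^ φ (ψ l) := by rw [mul_assoc, ← pow_add, Nat.add_sub_cancel' hl]
  · intro m c hc ε C hε hC hcC η hη i j hij hj
    refine ENNReal.le_of_forall_pos_le_add fun δ hδ _ => ?_
    -- Two vanishing errors share `δ`: the deviation of the chain from `b`, and the step
    -- approximation of `b` along `y`.
    have hδ2 : (0 : ℝ) < δ / 2 := by positivity
    refine lintegral_enorm_le_of_tendsto hlim ?_ ?_
    · refine (by fun_prop : Continuous fun ω : ℚ → E => ω (dyadicPt m j) - ω (dyadicPt m i)).sub ?_
      refine continuous_finsetSum _ fun k _ => ?_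
      exact (hc.comp (by fun_prop : Continuous fun ω : ℚ → E =>
        (((dyadicPt m k : ℚ) : ℝ), ω (dyadicPt m k)))).const_smul _
    · filter_upwards [hlev.eventually_ge_atTop m, hψ.tendsto_atTop.eventually (hQ4 (δ / 2) hδ2),
        (ENNReal.tendsto_nhds_zero.1 (hb.comp hψ.tendsto_atTop)) (ENNReal.ofReal (δ / 2))
          (by simpa using hδ)] with l hl1 hl2 hl3
      refine (h.lintegral_coarse_le hl1 _ (hQ2 _) (hQ3 _) hl2 hc hε hC hcC hη hij hj).trans ?_
      have e : (δ : ENNReal) = ENNReal.ofReal (δ / 2) + ENNReal.ofReal (δ / 2) := by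
        rw [← ENNReal.ofReal_add hδ2.le hδ2.le, add_halves, ENNReal.ofReal_coe_nnreal]
      rw [e]
      calc _ ≤ ENNReal.ofReal (δ / 2) + ENNReal.ofReal (δ / 2) + _ + _ := by
            gcongr
            exact hl3
        _ = _ := by ring

/-- The dyadic paths extend to a process in continuous time. -/
lemma exists_extension (h : IsVelocityProcess P y w b) {Q : Measure (ℚ → E)}
    [IsProbabilityMeasure Q] (hQ : IsLimitLaw P y w b Q) :
    ∃ (Y : (ℚ → E) × ℝ → E) (φ : ℕ → ℕ), Measurable Y ∧ StrictMono φ ∧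
      Tendsto (fun i => ∫⁻ p, ‖p.1 (dyadicFloor (φ i) p.2) - Y p‖ₑ
        ∂(Q.prod (volume.restrict (Ico (0 : ℝ) 2)))) atTop (𝓝 0) ∧
      ∀ᵐ p ∂(Q.prod (volume.restrict (Ico (0 : ℝ) 2))),
        Tendsto (fun i => p.1 (dyadicFloor (φ i) p.2)) atTop (𝓝 (Y p)) := by
  set μ := Q.prod (volume.restrict (Ico (0 : ℝ) 2)) with hμ
  -- Levels at which the mean displacement over one grid step is at most `2⁻ⁱ`, so that the step
  -- paths are Cauchy in `L¹` at a geometric rate.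
  obtain ⟨φ, hφ, hφη⟩ := extraction_forall_of_eventually' (P := fun i m =>
      ∀ r r' : ℝ, r' ≤ r + (1 / 2) ^ m → ∫⁻ u in Ico r r', ∫⁻ s, ‖w s u‖ₑ ∂P ≤ 2⁻¹ ^ i)
    (fun i => eventually_atTop.1
      (h.eventually_lintegral_velocity_le (ENNReal.pow_pos (by simp) i)))
  have hYm : ∀ l, Measurable fun p : (ℚ → E) × ℝ => p.1 (dyadicFloor l p.2) :=
    measurable_eval_dyadicFloor
  have hswap : ∀ (G : (ℚ → E) × ℝ → ENNReal), Measurable G →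
      ∫⁻ p, G p ∂μ = ∫⁻ r in Ico (0 : ℝ) 2, ∫⁻ ω, G (ω, r) ∂Q := fun G hG =>
    lintegral_prod_symm _ hG.aemeasurable
  have hstep : ∀ n m, n ≤ m → ∫⁻ p, ‖p.1 (dyadicFloor m p.2) - p.1 (dyadicFloor n p.2)‖ₑ ∂μ ≤
      2 * ⨆ (r : ℝ) (r' : ℝ) (_ : r' ≤ r + (1 / 2) ^ n),
        ∫⁻ u in Ico r r', ∫⁻ s, ‖w s u‖ₑ ∂P := by
    intro n m hnm
    refine (hswap _ ((hYm m).sub (hYm n)).enorm).trans_le ?_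
    calc ∫⁻ r in Ico (0 : ℝ) 2, ∫⁻ ω, ‖ω (dyadicFloor m r) - ω (dyadicFloor n r)‖ₑ ∂Q
        ≤ ∫⁻ r in Ico (0 : ℝ) 2, ⨆ (r : ℝ) (r' : ℝ) (_ : r' ≤ r + (1 / 2) ^ n),
          ∫⁻ u in Ico r r', ∫⁻ s, ‖w s u‖ₑ ∂P := by
          refine setLIntegral_mono' measurableSet_Ico fun r hr => ?_
          obtain ⟨k, hk, ek⟩ := dyadicFloor_eq_dyadicPt m hr.2
          have ek' : dyadicFloor n r = dyadicPt m (⌊r * 2 ^ n⌋₊ * 2 ^ (m - n)) :=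
            dyadicPt_refine hnm _
          have hle := dyadicFloor_mono hnm hr.1
          have hlt : (dyadicFloor m r : ℝ) ≤ dyadicFloor n r + (1 / 2) ^ n :=
            (dyadicFloor_le m hr.1).trans (lt_dyadicFloor_add n r).le
          refine le_trans ?_ (le_iSup₂_of_le (dyadicFloor n r : ℝ) (dyadicFloor m r : ℝ)
            (le_iSup_of_le hlt le_rfl))
          rw [ek, ek'] at hle ⊢
          refine hQ.lintegral_incr m _ _ ?_ hk
          simp only [dyadicPt] at hle
          push_cast at hle
          rw [div_le_div_iff_of_pos_right (by positivity)] at hle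
          exact_mod_cast hle
      _ = _ := by simp [mul_comm]
  have hstep' : ∀ N n m, N ≤ n → N ≤ m →
      ∫⁻ p, ‖p.1 (dyadicFloor (φ n) p.2) - p.1 (dyadicFloor (φ m) p.2)‖ₑ ∂μ ≤ 2 * 2⁻¹ ^ N := by
    have key : ∀ N n m, N ≤ n → n ≤ m →
        ∫⁻ p, ‖p.1 (dyadicFloor (φ m) p.2) - p.1 (dyadicFloor (φ n) p.2)‖ₑ ∂μ ≤ 2 * 2⁻¹ ^ N := by
      intro N n m hn hnm
      refine (hstep _ _ (hφ.monotone hnm)).trans ?_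
      gcongr
      refine iSup₂_le fun r r' => iSup_le fun hr => ?_
      refine hφη N r r' (hr.trans ?_)
      gcongr _ + ?_
      exact pow_le_pow_of_le_one (by norm_num) (by norm_num) (hφ.monotone hn)
    intro N n m hn hm
    rcases le_total n m with hnm | hnm
    · exact (lintegral_congr fun p => enorm_sub_rev _ _).trans_le (key N n m hn hnm)
    · exact key N m n hm hnm
  have h0m : Measurable fun p : (ℚ → E) × ℝ => p.1 0 := by fun_prop
  -- Positions need not be integrable; displacements from time `0` are.
  have hmem : ∀ n, MemLp (fun p : (ℚ → E) × ℝ => p.1 (dyadicFloor (φ n) p.2) - p.1 0) 1 μ := by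
    intro n
    refine memLp_one_iff_integrable.2 ⟨((hYm _).sub h0m).aestronglyMeasurable, ?_⟩
    refine lt_of_le_of_lt (b := ∫⁻ r in Ico (0 : ℝ) 2, ∫⁻ u, ∫⁻ s, ‖w s u‖ₑ ∂P) ?_ ?_
    · refine (hswap _ ((hYm _).sub h0m).enorm).trans_le ?_
      refine setLIntegral_mono' measurableSet_Ico fun r hr => ?_
      obtain ⟨k, hk, ek⟩ := dyadicFloor_eq_dyadicPt (φ n) hr.2
      change ∫⁻ ω, ‖ω (dyadicFloor (φ n) r) - ω 0‖ₑ ∂Q ≤ _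
      rw [ek, ← dyadicPt_zero (φ n)]
      refine (hQ.lintegral_incr (φ n) 0 k k.zero_le hk).trans ?_
      exact lintegral_mono' Measure.restrict_le_self le_rfl
    · rw [setLIntegral_const]
      exact ENNReal.mul_lt_top h.lintegral_velocity_swap_ne_top.lt_top (by simp)
  -- The constant `3` replaces the `2` of `hstep'` because a strict bound is required.
  obtain ⟨f, hf, hflim⟩ := Lp.cauchy_complete_eLpNorm (p := 1) le_rfl hmem
    (B := fun N => 3 * 2⁻¹ ^ N)
    (by
      rw [ENNReal.tsum_mul_left, ENNReal.tsum_geometric]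
      exact ENNReal.mul_ne_top (by simp) (by simp))
    (by
      intro N n m hn hm
      rw [eLpNorm_one_eq_lintegral_enorm]
      simp only [Pi.sub_apply, sub_sub_sub_cancel_right]
      refine (hstep' N n m hn hm).trans_lt ?_
      refine ENNReal.mul_lt_mul_left (by simp) (by simp) ?_
      norm_num)
  let g := hf.1.mk f
  have hg : Measurable g := hf.1.stronglyMeasurable_mk.measurable
  have hlim : Tendsto (fun i => ∫⁻ p, ‖p.1 (dyadicFloor (φ i) p.2) - (g p + p.1 0)‖ₑ ∂μ) atTop
      (𝓝 0) := by
    refine hflim.congr fun i => ?_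
    rw [eLpNorm_one_eq_lintegral_enorm]
    refine lintegral_congr_ae ?_
    filter_upwards [hf.1.ae_eq_mk] with p hp
    simp only [Pi.sub_apply]
    rw [hp]
    congr 1
    simp only [g]
    abel
  have hmeas := tendstoInMeasure_of_tendsto_eLpNorm (μ := μ) (p := 1) one_ne_zero
    (f := fun i (p : (ℚ → E) × ℝ) => p.1 (dyadicFloor (φ i) p.2)) (g := fun p => g p + p.1 0)
    (l := atTop) (fun i => (hYm _).aestronglyMeasurable) (hg.add h0m).aestronglyMeasurable (by
      simp_rw [eLpNorm_one_eq_lintegral_enorm]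
      exact hlim)
  obtain ⟨ψ, hψ, hae⟩ := hmeas.exists_seq_tendsto_ae
  exact ⟨fun p => g p + p.1 0, φ ∘ ψ, hg.add h0m, hφ.comp hψ, hlim.comp hψ.tendsto_atTop, hae⟩

end IsVelocityProcess

/-! ### The superposition principle for velocity processes -/

namespace IsVelocityProcess

variable {S : Type*} [MeasurableSpace S] {E : Type*} [NormedAddCommGroup E] [InnerProductSpace ℝ E]
  [MeasurableSpace E] [BorelSpace E] [SecondCountableTopology E] [CompleteSpace E]

variable {P : Measure S} [IsProbabilityMeasure P] {y w : S → ℝ → E} {b : ℝ → E → E}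

lemma continuous_position (h : IsVelocityProcess P y w b) (s : S) : Continuous (y s) := by
  have : y s = fun r => y s 0 + ∫ u in (0 : ℝ)..r, w s u := by
    ext r
    rw [← h.integral_velocity s 0 r]
    abel
  rw [this]
  exact continuous_const.add (intervalIntegral.continuous_primitive (h.intervalIntegrable s) 0)

/-- The extension of the dyadic paths has the same one-time laws as `y` at almost every time. -/
lemma map_extension_eq (h : IsVelocityProcess P y w b) {Q : Measure (ℚ → E)}
    [IsProbabilityMeasure Q] (hQ : IsLimitLaw P y w b Q) {Y : (ℚ → E) × ℝ → E} {φ : ℕ → ℕ}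
    (hY : Measurable Y) (hφ : StrictMono φ)
    (hlim : ∀ᵐ p ∂(Q.prod (volume.restrict (Ico (0 : ℝ) 2))),
      Tendsto (fun i => p.1 (dyadicFloor (φ i) p.2)) atTop (𝓝 (Y p))) :
    (Q.prod (volume.restrict (Ico (0 : ℝ) 2))).map (fun p => (p.2, Y p)) =
      (P.prod (volume.restrict (Ico (0 : ℝ) 2))).map (fun p => (p.2, y p.1 p.2)) := by
  have hYm : Measurable fun p : (ℚ → E) × ℝ => (p.2, Y p) := measurable_snd.prodMk hY
  have hym : Measurable fun p : S × ℝ => (p.2, y p.1 p.2) :=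
    measurable_snd.prodMk h.measurable_position
  have hYl : ∀ l, Measurable fun p : (ℚ → E) × ℝ =>
      ((dyadicFloor l p.2 : ℝ), p.1 (dyadicFloor l p.2)) := fun l =>
    ((measurable_dyadicFloor_real l).comp measurable_snd).prodMk (measurable_eval_dyadicFloor l)
  have hyl : ∀ l, Measurable fun p : S × ℝ =>
      ((dyadicFloor l p.2 : ℝ), y p.1 (dyadicFloor l p.2)) := fun l =>
    ((measurable_dyadicFloor_real l).comp measurable_snd).prodMk (h.measurable_position.comp
      (measurable_fst.prodMk ((measurable_dyadicFloor_real l).comp measurable_snd)))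
  have hstep : ∀ l, (Q.prod (volume.restrict (Ico (0 : ℝ) 2))).map
      (fun p => ((dyadicFloor l p.2 : ℝ), p.1 (dyadicFloor l p.2))) =
      (P.prod (volume.restrict (Ico (0 : ℝ) 2))).map
        (fun p => ((dyadicFloor l p.2 : ℝ), y p.1 (dyadicFloor l p.2))) := by
    intro l
    ext A hA
    rw [Measure.map_apply (hYl l) hA, Measure.map_apply (hyl l) hA,
      Measure.prod_apply_symm (hYl l hA), Measure.prod_apply_symm (hyl l hA)]
    refine setLIntegral_congr_fun measurableSet_Ico fun r hr => ?_
    obtain ⟨k, hk, ek⟩ := dyadicFloor_eq_dyadicPt l hr.2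
    have hA' : MeasurableSet ((fun x : E => ((dyadicPt l k : ℝ), x)) ⁻¹' A) :=
      (by fun_prop : Measurable fun x : E => ((dyadicPt l k : ℝ), x)) hA
    have h1 := congrArg (fun μ => μ ((fun x : E => ((dyadicPt l k : ℝ), x)) ⁻¹' A))
      (hQ.map_eval l k hk)
    beta_reduce at h1
    rw [Measure.map_apply (by fun_prop) hA', Measure.map_apply (h.measurable_position_at _) hA']
      at h1
    simpa only [preimage_preimage, preimage_ofPred_eq, ← ek] using h1
  have : IsFiniteMeasure ((Q.prod (volume.restrict (Ico (0 : ℝ) 2))).map (fun p => (p.2, Y p))) :=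
    Measure.isFiniteMeasure_map _ _
  have : IsFiniteMeasure
      ((P.prod (volume.restrict (Ico (0 : ℝ) 2))).map (fun p => (p.2, y p.1 p.2))) :=
    Measure.isFiniteMeasure_map _ _
  -- Test against bounded continuous functions. The discretised laws agree exactly by `hstep`; the
  -- chain side converges by hypothesis, the process side because `y` is continuous in time.
  refine ext_of_forall_integral_eq_of_IsFiniteMeasure fun f => ?_
  rw [integral_map hYm.aemeasurable f.continuous.aestronglyMeasurable,
    integral_map hym.aemeasurable f.continuous.aestronglyMeasurable]
  have hφt := hφ.tendsto_atTop
  have hle0 : ∀ {ν : Measure (ℚ → E)} [SFinite ν], ∀ᵐ p ∂(ν.prod (volume.restrict (Ico (0 : ℝ) 2))),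
      (0 : ℝ) ≤ p.2 := fun {ν} _ =>
    Measure.quasiMeasurePreserving_snd.ae
      ((ae_restrict_mem measurableSet_Ico).mono fun r hr => hr.1)
  have hle1 : ∀ᵐ p ∂(P.prod (volume.restrict (Ico (0 : ℝ) 2))), (0 : ℝ) ≤ p.2 :=
    Measure.quasiMeasurePreserving_snd.ae
      ((ae_restrict_mem measurableSet_Ico).mono fun r hr => hr.1)
  have t1 : Tendsto (fun i => ∫ p, f ((dyadicFloor (φ i) p.2 : ℝ), p.1 (dyadicFloor (φ i) p.2))
      ∂(Q.prod (volume.restrict (Ico (0 : ℝ) 2)))) atTop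
      (𝓝 (∫ p, f (p.2, Y p) ∂(Q.prod (volume.restrict (Ico (0 : ℝ) 2))))) := by
    refine tendsto_integral_of_dominated_convergence (fun _ => ‖f‖)
      (fun i => (f.continuous.measurable.comp (hYl _)).aestronglyMeasurable)
      (integrable_const _) (fun i => ae_of_all _ fun p => f.norm_coe_le_norm _) ?_
    filter_upwards [hlim, hle0] with p hp hp0
    exact (f.continuous.tendsto _).comp (((tendsto_dyadicFloor hp0).comp hφt).prodMk_nhds hp)
  have t2 : Tendsto (fun i => ∫ p, f ((dyadicFloor (φ i) p.2 : ℝ), y p.1 (dyadicFloor (φ i) p.2))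
      ∂(P.prod (volume.restrict (Ico (0 : ℝ) 2)))) atTop
      (𝓝 (∫ p, f (p.2, y p.1 p.2) ∂(P.prod (volume.restrict (Ico (0 : ℝ) 2))))) := by
    refine tendsto_integral_of_dominated_convergence (fun _ => ‖f‖)
      (fun i => (f.continuous.measurable.comp (hyl _)).aestronglyMeasurable)
      (integrable_const _) (fun i => ae_of_all _ fun p => f.norm_coe_le_norm _) ?_
    filter_upwards [hle1] with p hp0
    have h1 := (tendsto_dyadicFloor hp0).comp hφt
    exact (f.continuous.tendsto _).comp
      (h1.prodMk_nhds (((h.continuous_position p.1).tendsto _).comp h1))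
  refine tendsto_nhds_unique t1 (t2.congr fun i => ?_)
  rw [← integral_map (hyl (φ i)).aemeasurable f.continuous.aestronglyMeasurable, ← hstep,
    integral_map (hYl (φ i)).aemeasurable f.continuous.aestronglyMeasurable]

/-- The extended paths almost surely follow the field `b` between dyadic times. -/
lemma lintegral_extension_sub_eq_zero [ProperSpace E] (h : IsVelocityProcess P y w b)
    {Q : Measure (ℚ → E)} [IsProbabilityMeasure Q] (hQ : IsLimitLaw P y w b Q)
    {Y : (ℚ → E) × ℝ → E} {φ : ℕ → ℕ} (hY : Measurable Y) (hφ : StrictMono φ)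
    (hlim1 : Tendsto (fun i => ∫⁻ p, ‖p.1 (dyadicFloor (φ i) p.2) - Y p‖ₑ
        ∂(Q.prod (volume.restrict (Ico (0 : ℝ) 2)))) atTop (𝓝 0))
    (hlaw : (Q.prod (volume.restrict (Ico (0 : ℝ) 2))).map (fun p => (p.2, Y p)) =
      (P.prod (volume.restrict (Ico (0 : ℝ) 2))).map (fun p => (p.2, y p.1 p.2)))
    (hint : ∀ᵐ ω ∂Q, IntegrableOn (fun r => b r (Y (ω, r))) (Ico 0 2))
    {m i j : ℕ} (hij : i ≤ j) (hj : j ≤ 2 * 2 ^ m) :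
    ∫⁻ ω, ‖ω (dyadicPt m j) - ω (dyadicPt m i) -
      ∫ r in Ico (dyadicPt m i : ℝ) (dyadicPt m j), b r (Y (ω, r))‖ₑ ∂Q = 0 := by
  set μ := Q.prod (volume.restrict (Ico (0 : ℝ) 2)) with hμ
  set ρ := (P.prod (volume.restrict (Ico (0 : ℝ) 2))).map (fun p => (p.2, y p.1 p.2)) with hρ
  have hYm : Measurable fun p : (ℚ → E) × ℝ => (p.2, Y p) := measurable_snd.prodMk hY
  have hym : Measurable fun p : S × ℝ => (p.2, y p.1 p.2) :=
    measurable_snd.prodMk h.measurable_position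
  have hfin : IsFiniteMeasure ρ := Measure.isFiniteMeasure_map _ _
  have hswap : ∀ {G : ℝ × E → ENNReal}, Measurable G → ∫⁻ z, G z ∂ρ =
      ∫⁻ u in Icc (0 : ℝ) 2, ∫⁻ s, G (u, y s u) ∂P := by
    intro G hG
    rw [hρ, lintegral_map hG hym, ← Measure.restrict_congr_set (μ := volume) (Ico_ae_eq_Icc (a := (0 : ℝ)))]
    exact lintegral_prod_symm _ (hG.comp hym).aemeasurable
  have hbm := h.measurable_field
  have hbL : MemLp (fun z : ℝ × E => b z.1 z.2) 1 ρ := by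
    refine memLp_one_iff_integrable.2 ⟨hbm.aestronglyMeasurable, ?_⟩
    refine (hswap hbm.enorm).trans_lt (lt_of_le_of_lt ?_ h.lintegral_field.lt_top)
    refine (lintegral_mono' Measure.restrict_le_self le_rfl).trans (le_of_eq ?_)
    exact lintegral_lintegral_swap (f := fun u s => ‖b u (y s u)‖ₑ)
      (hbm.comp (hym.comp measurable_swap)).enorm.aemeasurable
  refine le_antisymm (ENNReal.le_of_forall_pos_le_add fun δ hδ _ => ?_) zero_le
  -- The final count is `13` units for the limit law, `3` for replacing step paths by `Y`, and `1`
  -- for returning from `c` to `b`.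
  have hδ' : (0 : ℝ) < δ / 17 := by positivity
  set ε : ℝ := δ / 17 with hε
  set e := ENNReal.ofReal ε with he
  have he0 : 0 < e := by simpa [he] using hδ'
  -- The approximation takes place in `L¹` of the common space-time law of `y` and `Y`, so one `c`
  -- serves along both.
  obtain ⟨c, hcs, hcle, hc, -⟩ := hbL.exists_hasCompactSupport_eLpNorm_sub_le ENNReal.one_ne_top
    he0.ne'
  have hec : ∫⁻ u in Icc (0 : ℝ) 2, ∫⁻ s, ‖b u (y s u) - c (u, y s u)‖ₑ ∂P ≤ e := by
    rw [eLpNorm_one_eq_lintegral_enorm] at hcle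
    exact ((hswap (G := fun z => ‖b z.1 z.2 - c z‖ₑ) (hbm.sub hc.measurable).enorm).symm.trans_le
      hcle)
  have hec' : ∫⁻ p, ‖c (p.2, Y p) - b p.2 (Y p)‖ₑ ∂μ ≤ e := by
    rw [eLpNorm_one_eq_lintegral_enorm, ← hlaw, lintegral_map (hbm.sub hc.measurable).enorm hYm]
      at hcle
    exact (lintegral_congr fun p => enorm_sub_rev _ _).trans_le hcle
  obtain ⟨C, hC, hcC⟩ := exists_almost_lipschitz hc hcs hδ'
  obtain ⟨M, hM⟩ := hcs.exists_bound_of_continuous hc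
  -- Chosen so that `C * η ≤ ε`, including when `C = 0`.
  set η := ENNReal.ofReal (ε / (C + 1)) with hη
  have hη0 : 0 < η := by simp only [hη, ENNReal.ofReal_pos]; positivity
  have hCη : ENNReal.ofReal C * η ≤ e := by
    rw [hη, ← ENNReal.ofReal_mul hC]
    refine ENNReal.ofReal_le_ofReal ?_
    rw [mul_div_assoc', div_le_iff₀ (by positivity)]
    nlinarith
  have hpow : Tendsto (fun l => ENNReal.ofReal ((1 / 2) ^ φ l)) atTop (𝓝 0) := by
    have := ENNReal.tendsto_ofReal ((tendsto_pow_atTop_nhds_zero_of_lt_one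
      (by norm_num : (0 : ℝ) ≤ 1 / 2) (by norm_num)).comp hφ.tendsto_atTop)
    simpa using this
  have hsmall : Tendsto (fun l => ENNReal.ofReal C * (2 * ENNReal.ofReal ((1 / 2) ^ φ l) +
      ∫⁻ p, ‖p.1 (dyadicFloor (φ l) p.2) - Y p‖ₑ ∂μ)) atTop (𝓝 0) := by
    have := ENNReal.Tendsto.const_mul (a := ENNReal.ofReal C)
      ((ENNReal.Tendsto.const_mul (a := 2) hpow (Or.inr (by simp))).add hlim1)
      (Or.inr ENNReal.ofReal_ne_top)
    simpa using this
  obtain ⟨l, hl1, hl2, hl3⟩ := ((hφ.tendsto_atTop.eventually_ge_atTop m).and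
    ((hφ.tendsto_atTop.eventually (h.eventually_lintegral_velocity_le hη0)).and
      (ENNReal.tendsto_nhds_zero.1 hsmall e he0))).exists
  set n := φ l with hn
  set i' := i * 2 ^ (n - m) with hi'
  set j' := j * 2 ^ (n - m) with hj'
  have hij' : i' ≤ j' := Nat.mul_le_mul_right _ hij
  have hjn : j' ≤ 2 * 2 ^ n := by
    calc j' ≤ 2 * 2 ^ m * 2 ^ (n - m) := Nat.mul_le_mul_right _ hj
      _ = 2 * 2 ^ n := by rw [mul_assoc, ← pow_add, Nat.add_sub_cancel' hl1]
  rw [dyadicPt_refine hl1 i, dyadicPt_refine hl1 j, ← hi', ← hj']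
  set I := Ico (dyadicPt n i' : ℝ) (dyadicPt n j') with hI
  have hIsub : I ⊆ Ico 0 2 := fun r hr =>
    ⟨(dyadicPt_nonneg n i').trans hr.1, hr.2.trans_le (dyadicPt_le_two hjn)⟩
  have hT1 := hQ.lintegral_coarse n c hc ε C hδ'.le hC hcC η hl2 i' j' hij' hjn
  have hcY : Measurable fun p : (ℚ → E) × ℝ => c (p.2, Y p) := hc.measurable.comp hYm
  have hcl : Measurable fun p : (ℚ → E) × ℝ =>
      c (dyadicFloor n p.2, p.1 (dyadicFloor n p.2)) :=
    hc.measurable.comp (((measurable_dyadicFloor_real n).comp measurable_snd).prodMk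
      (measurable_eval_dyadicFloor n))
  have hT2 : ∫⁻ p, ‖c (dyadicFloor n p.2, p.1 (dyadicFloor n p.2)) - c (p.2, Y p)‖ₑ ∂μ ≤
      2 * e + e := by
    have hd : Measurable fun p : (ℚ → E) × ℝ => ‖p.1 (dyadicFloor n p.2) - Y p‖ₑ :=
      ((measurable_eval_dyadicFloor n).sub hY).enorm
    calc ∫⁻ p, ‖c (dyadicFloor n p.2, p.1 (dyadicFloor n p.2)) - c (p.2, Y p)‖ₑ ∂μ
        = ∫⁻ r in Ico (0 : ℝ) 2, ∫⁻ ω,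
          ‖c (dyadicFloor n r, ω (dyadicFloor n r)) - c (r, Y (ω, r))‖ₑ ∂Q :=
          lintegral_prod_symm _ (hcl.sub hcY).enorm.aemeasurable
      _ ≤ ∫⁻ r in Ico (0 : ℝ) 2, (e + ENNReal.ofReal C * (ENNReal.ofReal ((1 / 2) ^ n) +
            ∫⁻ ω, ‖ω (dyadicFloor n r) - Y (ω, r)‖ₑ ∂Q)) := by
          refine setLIntegral_mono' measurableSet_Ico fun r hr => ?_
          exact lintegral_enorm_comp_sub_le Q hδ'.le hC hcC (abs_dyadicFloor_sub_le n hr.1) le_rfl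
      _ = 2 * e + ENNReal.ofReal C * (2 * ENNReal.ofReal ((1 / 2) ^ n) +
            ∫⁻ p, ‖p.1 (dyadicFloor n p.2) - Y p‖ₑ ∂μ) := by
          rw [lintegral_add_left measurable_const, lintegral_const_mul' _ _ ENNReal.ofReal_ne_top,
            lintegral_add_left measurable_const, setLIntegral_const, setLIntegral_const, hμ,
            lintegral_prod_symm _ hd.aemeasurable]
          simp [mul_comm]
      _ ≤ 2 * e + e := by gcongr
  have hdec : ∀ᵐ ω ∂Q, ω (dyadicPt n j') - ω (dyadicPt n i') - ∫ r in I, b r (Y (ω, r)) =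
      (ω (dyadicPt n j') - ω (dyadicPt n i') - ∑ k ∈ Finset.Ico i' j',
        ((1 : ℝ) / 2) ^ n • c (dyadicPt n k, ω (dyadicPt n k))) +
      (∫ r in I, (c (dyadicFloor n r, ω (dyadicFloor n r)) - c (r, Y (ω, r)))) +
      ∫ r in I, (c (r, Y (ω, r)) - b r (Y (ω, r))) := by
    filter_upwards [hint] with ω hω
    have h1 := sum_dyadicPt_eq_setIntegral n (fun q => c (q, ω q)) hij'
    have h2 : IntegrableOn (fun r => c (r, Y (ω, r))) I :=
      Integrable.of_bound (hcY.comp (by fun_prop : Measurable fun r : ℝ => (ω, r))).aestronglyMeasurable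
        M (ae_of_all _ fun r => hM _)
    rw [integral_sub h1.1 h2, integral_sub h2 (hω.mono_set hIsub), h1.2]
    abel
  have hset : ∀ {G : (ℚ → E) × ℝ → E}, Measurable G →
      ∫⁻ ω, ‖∫ r in I, G (ω, r)‖ₑ ∂Q ≤ ∫⁻ p, ‖G p‖ₑ ∂μ := by
    intro G hG
    rw [hμ, lintegral_prod _ hG.enorm.aemeasurable]
    exact lintegral_mono fun ω => (enorm_integral_le_lintegral_enorm _).trans
      (lintegral_mono_set hIsub)
  have hbY : Measurable fun p : (ℚ → E) × ℝ => b p.2 (Y p) := hbm.comp hYm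
  have n1 : Measurable fun ω : ℚ → E => ω (dyadicPt n j') - ω (dyadicPt n i') -
      ∑ k ∈ Finset.Ico i' j', ((1 : ℝ) / 2) ^ n • c (dyadicPt n k, ω (dyadicPt n k)) :=
    (by fun_prop : Measurable fun ω : ℚ → E => ω (dyadicPt n j') - ω (dyadicPt n i')).sub
      (Finset.measurable_fun_sum _ fun k _ =>
        (hc.measurable.comp (by fun_prop : Measurable fun ω : ℚ → E =>
          (((dyadicPt n k : ℚ) : ℝ), ω (dyadicPt n k)))).const_smul _)
  have n2 : Measurable fun ω : ℚ → E =>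
      ∫ r in I, (c (dyadicFloor n r, ω (dyadicFloor n r)) - c (r, Y (ω, r))) :=
    ((hcl.sub hcY).stronglyMeasurable.integral_prod_right').measurable
  calc _ = ∫⁻ ω, ‖_ + _ + _‖ₑ ∂Q :=
        lintegral_congr_ae (hdec.mono fun ω hω => congrArg (‖·‖ₑ) hω)
    _ ≤ ∫⁻ ω, (‖ω (dyadicPt n j') - ω (dyadicPt n i') - ∑ k ∈ Finset.Ico i' j',
        ((1 : ℝ) / 2) ^ n • c (dyadicPt n k, ω (dyadicPt n k))‖ₑ +
      ‖∫ r in I, (c (dyadicFloor n r, ω (dyadicFloor n r)) - c (r, Y (ω, r)))‖ₑ +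
      ‖∫ r in I, (c (r, Y (ω, r)) - b r (Y (ω, r)))‖ₑ) ∂Q :=
        lintegral_mono fun ω => (enorm_add_le _ _).trans (add_le_add (enorm_add_le _ _) le_rfl)
    _ ≤ (e + 4 * (e + (e + e))) + (2 * e + e) + e := by
        refine (lintegral_add_add n1.enorm n2.enorm _).trans_le ?_
        refine add_le_add (add_le_add (hT1.trans ?_) ((hset (hcl.sub hcY)).trans hT2))
          ((hset (hcY.sub hbY)).trans hec')
        have : ENNReal.ofReal C * ENNReal.ofReal ((1 / 2) ^ n) ≤ e := by
          refine le_trans ?_ hl3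
          gcongr
          rw [two_mul, add_assoc]
          exact le_self_add
        refine add_le_add hec (mul_le_mul' le_rfl (add_le_add le_rfl ?_))
        rw [mul_add]
        exact add_le_add this hCη
    _ = 17 * e := by ring
    _ = 0 + δ := by
        rw [he, hε, show (17 : ENNReal) = ENNReal.ofReal 17 by simp,
          ← ENNReal.ofReal_mul (by norm_num), mul_div_cancel₀ _ (by norm_num : (17 : ℝ) ≠ 0),
          ENNReal.ofReal_coe_nnreal, zero_add]
    _ ≤ _ := le_rfl

/-- **Superposition principle** along a process: there is a law on paths, with the same initial and
final laws as `y`, under which almost every path solves the ODE of the mean velocity field `b`. -/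
theorem exists_superposition [ProperSpace E] (h : IsVelocityProcess P y w b) {φ : ℕ → ℕ}
    (hφ : StrictMono φ)
    (hw : Tendsto (fun n => ∫⁻ u in Icc (0 : ℝ) 2, ∫⁻ s,
      ‖w s (dyadicFloor (φ n) u) - w s u‖ₑ ∂P) atTop (𝓝 0))
    (hb : Tendsto (fun n => ∫⁻ u in Icc (0 : ℝ) 2, ∫⁻ s,
      ‖b (dyadicFloor (φ n) u) (y s (dyadicFloor (φ n) u)) - b u (y s u)‖ₑ ∂P) atTop (𝓝 0)) :
    ∃ Q : Measure (ℚ → E), IsProbabilityMeasure Q ∧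
      Q.map (fun ω => ω 0) = P.map (fun s => y s 0) ∧
      Q.map (fun ω => ω 2) = P.map (fun s => y s 2) ∧
      ∀ᵐ ω ∂Q, ∃ γ : ℝ → E, γ 0 = ω 0 ∧ γ 2 = ω 2 ∧
        IntervalIntegrable (fun r => b r (γ r)) volume 0 2 ∧
        ∀ t ∈ Icc (0 : ℝ) 2, γ t = γ 0 + ∫ r in (0 : ℝ)..t, b r (γ r) := by
  obtain ⟨Q, hQP, hQ⟩ := h.exists_isLimitLaw hφ hw hb
  obtain ⟨Y, ψ, hY, hψ, hlim1, hlim2⟩ := h.exists_extension hQ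
  have hlaw := h.map_extension_eq hQ hY hψ hlim2
  have hYm : Measurable fun p : (ℚ → E) × ℝ => (p.2, Y p) := measurable_snd.prodMk hY
  have hym : Measurable fun p : S × ℝ => (p.2, y p.1 p.2) :=
    measurable_snd.prodMk h.measurable_position
  have hbY : Measurable fun p : (ℚ → E) × ℝ => b p.2 (Y p) := h.measurable_field.comp hYm
  have hfin : ∫⁻ p, ‖b p.2 (Y p)‖ₑ ∂(Q.prod (volume.restrict (Ico (0 : ℝ) 2))) ≠ ⊤ := by
    have e1 := lintegral_map (μ := Q.prod (volume.restrict (Ico (0 : ℝ) 2)))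
      h.measurable_field.enorm hYm
    have e2 := lintegral_map (μ := P.prod (volume.restrict (Ico (0 : ℝ) 2)))
      h.measurable_field.enorm hym
    rw [hlaw] at e1
    refine ne_top_of_le_ne_top h.lintegral_field ((e1.symm.trans e2).trans_le ?_)
    refine (lintegral_prod _ (h.measurable_field.comp hym).enorm.aemeasurable).trans_le ?_
    exact lintegral_mono fun s => lintegral_mono' Measure.restrict_le_self le_rfl
  have hint : ∀ᵐ ω ∂Q, IntegrableOn (fun r => b r (Y (ω, r))) (Ico 0 2) := by
    rw [lintegral_prod _ hbY.enorm.aemeasurable] at hfin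
    filter_upwards [ae_lt_top hbY.enorm.lintegral_prod_right' hfin] with ω hω
    exact ⟨(hbY.comp (by fun_prop : Measurable fun r : ℝ => (ω, r))).aestronglyMeasurable, hω⟩
  have hsol : ∀ᵐ ω ∂Q, ∀ m j, j ≤ 2 * 2 ^ m → ω (dyadicPt m j) - ω 0 -
      ∫ r in Ico (0 : ℝ) (dyadicPt m j), b r (Y (ω, r)) = 0 := by
    rw [ae_all_iff]; intro m
    rw [ae_all_iff]; intro j
    by_cases hj : j ≤ 2 * 2 ^ m
    · have h0 := h.lintegral_extension_sub_eq_zero hQ hY hψ hlim1 hlaw hint (i := 0) j.zero_le hj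
      have hm : Measurable fun ω : ℚ → E => ω (dyadicPt m j) - ω (dyadicPt m 0) -
          ∫ r in Ico (dyadicPt m 0 : ℝ) (dyadicPt m j), b r (Y (ω, r)) :=
        (by fun_prop : Measurable fun ω : ℚ → E => ω (dyadicPt m j) - ω (dyadicPt m 0)).sub
          (hbY.stronglyMeasurable.integral_prod_right').measurable
      filter_upwards [(lintegral_eq_zero_iff hm.enorm).1 h0] with ω hω _
      simpa [dyadicPt_zero] using hω
    · exact ae_of_all _ fun ω hj' => absurd hj' hj
  have hmap0 := hQ.map_eval 0 0 (by norm_num)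
  have hmap2 := hQ.map_eval 0 2 (by norm_num)
  have e2 : dyadicPt 0 2 = 2 := dyadicPt_two 0
  rw [e2] at hmap2
  rw [dyadicPt_zero] at hmap0
  refine ⟨Q, hQP, by simpa using hmap0, by simpa using hmap2, ?_⟩
  filter_upwards [hint, hsol, Measure.ae_ae_of_ae_prod hlim2] with ω hω1 hω2 hω3
  have hII : IntervalIntegrable (fun r => b r (Y (ω, r))) volume 0 2 := by
    rw [intervalIntegrable_iff_integrableOn_Ico_of_le (by norm_num)]
    exact hω1
  -- This continuous curve agrees with `ω` at dyadic times. Hence at almost every `r` both `γ r` and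
  -- `Y (ω, r)` are the limit of `ω` along the dyadic floors of `r`, and `Y` may be replaced by `γ`
  -- in the integral.
  let γ : ℝ → E := fun t => ω 0 + ∫ r in (0 : ℝ)..t, b r (Y (ω, r))
  have hγc : ContinuousOn γ (Icc 0 2) := by
    have := intervalIntegral.continuousOn_primitive_interval
      (μ := volume) (f := fun r => b r (Y (ω, r))) (a := 0) (b := 2) (by
        rw [uIcc_of_le (by norm_num)]
        exact hω1.congr_set_ae Ico_ae_eq_Icc.symm)
    rw [uIcc_of_le (by norm_num)] at this
    exact continuousOn_const.add this
  have hγd : ∀ m j, j ≤ 2 * 2 ^ m → γ (dyadicPt m j) = ω (dyadicPt m j) := by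
    intro m j hj
    have := hω2 m j hj
    simp only [γ]
    rw [intervalIntegral.integral_of_le (dyadicPt_nonneg m j),
      setIntegral_congr_set Ico_ae_eq_Ioc.symm]
    rw [sub_eq_zero] at this
    rw [← this]; abel
  have hγY : ∀ᵐ r ∂(volume.restrict (Ico (0 : ℝ) 2)), Y (ω, r) = γ r := by
    filter_upwards [hω3, ae_restrict_mem measurableSet_Ico] with r hr hr2
    refine tendsto_nhds_unique hr ?_
    have h1 : Tendsto (fun i => (dyadicFloor (ψ i) r : ℝ)) atTop (𝓝[Icc 0 2] r) := by
      refine tendsto_nhdsWithin_iff.2 ⟨(tendsto_dyadicFloor hr2.1).comp hψ.tendsto_atTop, ?_⟩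
      exact Eventually.of_forall fun i => ⟨by exact_mod_cast dyadicFloor_nonneg _ r,
        (dyadicFloor_le _ hr2.1).trans hr2.2.le⟩
    refine ((hγc r ⟨hr2.1, hr2.2.le⟩).tendsto.comp h1).congr fun i => ?_
    obtain ⟨k, hk, ek⟩ := dyadicFloor_eq_dyadicPt (ψ i) hr2.2
    simp only [Function.comp]
    rw [ek, hγd _ k hk]
  have hbγ : (fun r => b r (γ r)) =ᵐ[volume.restrict (Ico (0 : ℝ) 2)] fun r => b r (Y (ω, r)) :=
    hγY.mono fun r hr => by simp only [hr]
  have hγ0 : γ 0 = ω 0 := by simp [γ]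
  refine ⟨γ, hγ0, ?_, ?_, ?_⟩
  · have := hγd 0 2 (by norm_num)
    rw [e2] at this
    simpa using this
  · rw [intervalIntegrable_iff_integrableOn_Ico_of_le (by norm_num)]
    exact hω1.congr hbγ.symm
  · intro t ht
    rw [hγ0]
    simp only [γ]
    congr 1
    rw [intervalIntegral.integral_of_le ht.1, intervalIntegral.integral_of_le ht.1,
      setIntegral_congr_set Ico_ae_eq_Ioc.symm, setIntegral_congr_set Ico_ae_eq_Ioc.symm]
    refine integral_congr_ae (ae_restrict_of_ae_restrict_of_subset
      (Ico_subset_Ico_right ht.2) hbγ.symm)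

end IsVelocityProcess

/-! ### Trajectories and time reversal -/

section Trajectory

variable {d : ℕ} {v : FlowField d} {x₁ : EuclideanSpace ℝ (Fin d)}

lemma WellPosedAt.isTrajectory_runFlow (h : WellPosedAt v x₁) :
    IsTrajectory v x₁ (runFlow v x₁) := by
  have : runFlow v x₁ = h.1.choose := by
    funext t
    simp only [runFlow, dif_pos h.1]
  rw [this]
  exact h.1.choose_spec

lemma WellPosedAt.eqOn_runFlow (h : WellPosedAt v x₁) {γ : ℝ → EuclideanSpace ℝ (Fin d)}
    (hγ : IsTrajectory v x₁ γ) : EqOn (runFlow v x₁) γ (Icc 0 1) :=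
  h.2 _ _ h.isTrajectory_runFlow hγ

lemma WellPosedAt.runFlow_one (h : WellPosedAt v x₁) : runFlow v x₁ 1 = x₁ := by
  simpa using h.isTrajectory_runFlow.2 1 ⟨zero_le_one, le_rfl⟩

lemma IsTrajectory.continuousOn {γ : ℝ → EuclideanSpace ℝ (Fin d)} (h : IsTrajectory v x₁ γ) :
    ContinuousOn γ (Icc 0 1) := by
  have h1 : IntegrableOn (fun s => v s (γ s)) (uIcc 1 0) := by
    rw [uIcc_of_ge zero_le_one, integrableOn_Icc_iff_integrableOn_Ioc,
      ← intervalIntegrable_iff_integrableOn_Ioc_of_le zero_le_one]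
    exact h.1
  have h2 := intervalIntegral.continuousOn_primitive_interval h1
  rw [uIcc_of_ge zero_le_one] at h2
  refine (continuousOn_const.sub h2 : ContinuousOn (fun t => x₁ - _) _).congr fun t ht => ?_
  rw [h.2 t ht, intervalIntegral.integral_symm, sub_eq_add_neg]
  rfl

/-- The time reversal of a trajectory, stopped outside `[0, 1]`, is an integral on the whole line. -/
lemma IsTrajectory.exists_velocity {γ : ℝ → EuclideanSpace ℝ (Fin d)} (h : IsTrajectory v x₁ γ) :
    Integrable (indicator (Icc 0 1) fun r => v (1 - r) (γ (1 - r))) ∧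
    ∀ r, γ (1 - projIcc (0 : ℝ) 1 zero_le_one r) =
      x₁ + ∫ u in (0 : ℝ)..r, indicator (Icc 0 1) (fun r => v (1 - r) (γ (1 - r))) u := by
  set w := indicator (Icc 0 1) fun r => v (1 - r) (γ (1 - r)) with hw
  have h1 : IntervalIntegrable (fun r => v (1 - r) (γ (1 - r))) volume 0 1 := by
    have := h.1.comp_sub_left 1
    simpa using this.symm
  have hint : Integrable w := by
    rw [hw, integrable_indicator_iff measurableSet_Icc, integrableOn_Icc_iff_integrableOn_Ioc,
      ← intervalIntegrable_iff_integrableOn_Ioc_of_le zero_le_one]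
    exact h1
  have hmem : ∀ r ∈ Icc (0 : ℝ) 1, γ (1 - r) = x₁ + ∫ u in (0 : ℝ)..r, w u := by
    intro r hr
    rw [h.2 (1 - r) ⟨by linarith [hr.2], by linarith [hr.1]⟩]
    have e1 := intervalIntegral.integral_comp_sub_left (a := 0) (b := r)
      (fun s => v s (γ s)) (1 : ℝ)
    rw [sub_zero] at e1
    rw [← e1]
    congr 1
    refine intervalIntegral.integral_congr fun u hu => ?_
    rw [uIcc_of_le hr.1] at hu
    have hu' : u ∈ Icc (0 : ℝ) 1 := ⟨hu.1, hu.2.trans hr.2⟩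
    simp only [hw, indicator_of_mem hu']
  refine ⟨hint, fun r => ?_⟩
  rcases le_total r 0 with hr | hr
  · have h0 := hmem 0 ⟨le_rfl, zero_le_one⟩
    rw [projIcc_of_le_left _ hr]
    simp only [sub_zero, intervalIntegral.integral_same] at h0 ⊢
    rw [h0]
    congr 1
    symm
    rw [intervalIntegral.integral_symm, intervalIntegral.integral_of_le hr,
      ← integral_Ico_eq_integral_Ioc, setIntegral_eq_zero_of_forall_eq_zero, neg_zero]
    exact fun u hu => indicator_of_notMem (fun hu' => absurd hu.2 (not_lt.2 hu'.1)) _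
  rcases le_total r 1 with hr1 | hr1
  · rw [projIcc_of_mem _ ⟨hr, hr1⟩]
    exact hmem r ⟨hr, hr1⟩
  · rw [projIcc_of_right_le _ hr1]
    simp only
    rw [hmem 1 ⟨zero_le_one, le_rfl⟩, ← intervalIntegral.integral_add_adjacent_intervals
      (hint.intervalIntegrable (a := 0) (b := 1)) (hint.intervalIntegrable (a := 1) (b := r)),
      intervalIntegral.integral_of_le hr1, setIntegral_eq_zero_of_forall_eq_zero, add_zero]
    exact fun u hu => indicator_of_notMem (fun hu' => absurd hu.1 (not_lt.2 hu'.2)) _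

end Trajectory

/-! ### Conditional expectations through conditional distributions -/

section CondExp

variable {S E : Type*} [MeasurableSpace S] [NormedAddCommGroup E] [NormedSpace ℝ E]
  [CompleteSpace E] [SecondCountableTopology E] [MeasurableSpace E] [BorelSpace E]
  {β : Type*} [MeasurableSpace β]

/-- A function of `X` is a conditional expectation of `Y` given `X` if and only if it is the mean
of the conditional distribution. -/
lemma comp_ae_eq_condExp_iff {μ : Measure S} [IsFiniteMeasure μ] {X : S → β} {Y : S → E}
    (hX : Measurable X) (hY : Integrable Y μ) {g : β → E} (hg : Measurable g) :
    ((fun s => g (X s)) =ᵐ[μ] μ[Y | MeasurableSpace.comap X inferInstance]) ↔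
      g =ᵐ[μ.map X] fun x => ∫ y, y ∂condDistrib Y X μ x := by
  have h1 := condExp_ae_eq_integral_condDistrib (μ := μ) (f := id) (Y := Y) hX hY.aemeasurable
    stronglyMeasurable_id hY
  have hF : StronglyMeasurable fun x => ∫ y, y ∂condDistrib Y X μ x :=
    StronglyMeasurable.integral_condDistrib (f := fun p : β × E => p.2)
      measurable_snd.stronglyMeasurable
  have h2 : g =ᵐ[μ.map X] (fun x => ∫ y, y ∂condDistrib Y X μ x) ↔
      ∀ᵐ s ∂μ, g (X s) = ∫ y, y ∂condDistrib Y X μ (X s) :=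
    ae_map_iff hX.aemeasurable (measurableSet_eq_fun hg hF.measurable)
  rw [h2]
  constructor
  · intro h
    filter_upwards [h, h1] with s hs hs'
    rw [hs]; exact hs'
  · intro h
    filter_upwards [h, h1] with s hs hs'
    rw [hs]; exact hs'.symm

end CondExp

/-! ### Measurable reversal of a random flow, and existence of a marginal flow -/

section Reversal

variable {d : ℕ} {S : Type*} [MeasurableSpace S]

/-- Jointly measurable versions `y` and `w` of the positions and velocities of a random flow, in
reversed time, stopped outside `[0, 1]`. -/
structure IsReversal (P : Measure S) (V : S → FlowField d) (X : S → EuclideanSpace ℝ (Fin d))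
    (y w : S → ℝ → EuclideanSpace ℝ (Fin d)) : Prop where
  measurable_position : Measurable fun p : S × ℝ => y p.1 p.2
  measurable_velocity : Measurable fun p : S × ℝ => w p.1 p.2
  integrable : ∀ s, Integrable (w s)
  position_eq : ∀ s r, y s r = y s 0 + ∫ u in (0 : ℝ)..r, w s u
  velocity_eq_zero : ∀ s, ∀ r ∉ Icc (0 : ℝ) 1, w s r = 0
  start_ae_eq : ∀ᵐ s ∂P, y s 0 = X s
  ae_eq : ∀ᵐ s ∂P, ∀ t ∈ Icc (0 : ℝ) 1, y s (1 - t) = runFlow (V s) (X s) t ∧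
    w s (1 - t) = V s t (runFlow (V s) (X s) t)
  lintegral_velocity : ∫⁻ s, (∫⁻ r, ‖w s r‖ₑ) ∂P ≠ ⊤

variable {P : Measure S} {V : S → FlowField d} {X : S → EuclideanSpace ℝ (Fin d)}

/-- Off a measurable null set, the positions of a regular random flow are measurable. -/
lemma IsRegularRandomFlow.exists_measurable_position (h : IsRegularRandomFlow P V X) :
    ∃ N : Set S, MeasurableSet N ∧ P N = 0 ∧ (∀ s ∉ N, WellPosedAt (V s) (X s)) ∧
      ∀ t ∈ Icc (0 : ℝ) 1, Measurable (indicator Nᶜ fun s => runFlow (V s) (X s) t) := by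
  -- Exceptional sets are needed only at rational times: trajectories are continuous, so the
  -- position at any `t` is a limit of positions at dyadic times.
  have hq : ∀ᵐ s ∂P, WellPosedAt (V s) (X s) ∧ ∀ (q : ℚ) (hq : (q : ℝ) ∈ Icc (0 : ℝ) 1),
      runFlow (V s) (X s) q = (h.aemeasurable_position q hq).mk _ s := by
    refine h.wellPosed.and (ae_all_iff.2 fun q => ?_)
    by_cases hq : (q : ℝ) ∈ Icc (0 : ℝ) 1
    · filter_upwards [(h.aemeasurable_position q hq).ae_eq_mk] with s hs _ using hs
    · exact ae_of_all _ fun s hq' => absurd hq' hq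
  set N := toMeasurable P {s | ¬ (WellPosedAt (V s) (X s) ∧
    ∀ (q : ℚ) (hq : (q : ℝ) ∈ Icc (0 : ℝ) 1),
      runFlow (V s) (X s) q = (h.aemeasurable_position q hq).mk _ s)} with hN
  have hNm : MeasurableSet N := measurableSet_toMeasurable _ _
  have hs : ∀ s ∉ N, _ := fun s hs => not_not.1 fun h' => hs (subset_toMeasurable _ _ h')
  refine ⟨N, hNm, (measure_toMeasurable _).trans (ae_iff.1 hq), fun s h' => (hs s h').1,
    fun t ht => ?_⟩
  have hmem : ∀ n, ((dyadicFloor n t : ℚ) : ℝ) ∈ Icc (0 : ℝ) 1 := fun n =>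
    ⟨by exact_mod_cast dyadicFloor_nonneg n t, (dyadicFloor_le n ht.1).trans ht.2⟩
  refine measurable_of_tendsto_metrizable (f := fun n => indicator Nᶜ
    ((h.aemeasurable_position _ (hmem n)).mk _)) (fun n =>
      (AEMeasurable.measurable_mk _).indicator hNm.compl) (tendsto_pi_nhds.2 fun s => ?_)
  by_cases hsN : s ∈ N
  · simp [hsN]
  · simp only [indicator_of_mem (show s ∈ Nᶜ from hsN)]
    have hc := (hs s hsN).1.isTrajectory_runFlow.continuousOn t ht
    refine (hc.tendsto.comp (tendsto_nhdsWithin_iff.2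
      ⟨tendsto_dyadicFloor ht.1, Eventually.of_forall hmem⟩)).congr fun n => ?_
    exact (hs s hsN).2 _ (hmem n)

lemma IsReversal.map_eq_jointLaw {y w : S → ℝ → EuclideanSpace ℝ (Fin d)}
    (h : IsReversal P V X y w) {t : ℝ} (ht : t ∈ Icc (0 : ℝ) 1) :
    jointLaw P V X t = P.map fun s => (y s 0, y s (1 - t), w s (1 - t)) := by
  refine Measure.map_congr ?_
  filter_upwards [h.start_ae_eq, h.ae_eq] with s h1 h2
  rw [h1, (h2 t ht).1, (h2 t ht).2]

/-- Positions are continuous in time and measurable at each time, hence jointly measurable;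
velocities then are a composition with the jointly measurable field. Setting both to zero on the bad
set makes the path identities hold for every `s`. -/
lemma IsRegularRandomFlow.exists_isReversal [SFinite P] (h : IsRegularRandomFlow P V X) :
    ∃ y w, IsReversal P V X y w := by
  obtain ⟨N, hNm, hN0, hwp, hmeas⟩ := h.exists_measurable_position
  set y : S → ℝ → EuclideanSpace ℝ (Fin d) := fun s r =>
    indicator Nᶜ (fun s => runFlow (V s) (X s) (1 - projIcc (0 : ℝ) 1 zero_le_one r)) s with hy
  set w : S → ℝ → EuclideanSpace ℝ (Fin d) := fun s r =>
    indicator (Nᶜ ×ˢ Icc (0 : ℝ) 1) (fun p : S × ℝ => V p.1 (1 - p.2) (y p.1 p.2)) (s, r) with hw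
  have hproj : ∀ r, (1 : ℝ) - projIcc (0 : ℝ) 1 zero_le_one r ∈ Icc (0 : ℝ) 1 := fun r => by
    have := (projIcc (0 : ℝ) 1 zero_le_one r).2
    exact ⟨by linarith [this.2], by linarith [this.1]⟩
  have hwN : ∀ s ∈ N, ∀ r, w s r = 0 := fun s hs r => by simp [hw, hs]
  have hyN : ∀ s ∈ N, ∀ r, y s r = 0 := fun s hs r => by simp [hy, hs]
  have hy1 : ∀ s ∉ N, ∀ r, y s r = runFlow (V s) (X s) (1 - projIcc (0 : ℝ) 1 zero_le_one r) :=
    fun s hs r => by simp [hy, hs]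
  have hy2 : ∀ s ∉ N, ∀ r ∈ Icc (0 : ℝ) 1, y s r = runFlow (V s) (X s) (1 - r) :=
    fun s hs r hr => by rw [hy1 s hs, projIcc_of_mem _ hr]
  have hw1 : ∀ s ∉ N, w s = indicator (Icc 0 1) fun r => V s (1 - r) (runFlow (V s) (X s) (1 - r)) := by
    intro s hs
    ext1 r
    by_cases hr : r ∈ Icc (0 : ℝ) 1
    · rw [indicator_of_mem hr, ← hy2 s hs r hr]
      exact indicator_of_mem (show (s, r) ∈ Nᶜ ×ˢ Icc (0 : ℝ) 1 from ⟨hs, hr⟩) _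
    · rw [indicator_of_notMem hr]
      exact indicator_of_notMem (fun h' => hr h'.2) _
  have hpos : ∀ s r, y s r = y s 0 + ∫ u in (0 : ℝ)..r, w s u := by
    intro s r
    by_cases hs : s ∈ N
    · simp [hyN s hs, hwN s hs]
    · have := (hwp s hs).isTrajectory_runFlow.exists_velocity.2
      have h0 : y s 0 = X s := by
        rw [hy1 s hs, this]; simp
      rw [hy1 s hs, this, hw1 s hs, h0]
  have hint : ∀ s, Integrable (w s) := by
    intro s
    by_cases hs : s ∈ N
    · have : w s = 0 := funext fun r => hwN s hs r
      rw [this]; exact integrable_zero _ _ _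
    · rw [hw1 s hs]
      exact (hwp s hs).isTrajectory_runFlow.exists_velocity.1
  have hym : Measurable fun p : S × ℝ => y p.1 p.2 := by
    have hc : ∀ s, Continuous fun r => y s r := by
      intro s
      rw [show (fun r => y s r) = fun r => y s 0 + ∫ u in (0 : ℝ)..r, w s u from funext (hpos s)]
      exact continuous_const.add (intervalIntegral.continuous_primitive
        (fun a b => (hint s).intervalIntegrable) 0)
    exact (measurable_uncurry_of_continuous_of_measurable (u := fun r s => y s r) hc
      fun r => hmeas _ (hproj r)).comp measurable_swap
  have hwm : Measurable fun p : S × ℝ => w p.1 p.2 :=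
    (h.measurable_velocity.comp (measurable_fst.prodMk
      ((measurable_const.sub measurable_snd).prodMk hym))).indicator
        (hNm.compl.prod measurableSet_Icc)
  have hw0 : ∀ s, ∀ r ∉ Icc (0 : ℝ) 1, w s r = 0 := fun s r hr =>
    indicator_of_notMem (fun h' => hr h'.2) _
  have hae : ∀ᵐ s ∂P, s ∉ N := measure_eq_zero_iff_ae_notMem.1 hN0
  have hstart : ∀ᵐ s ∂P, y s 0 = X s := by
    filter_upwards [hae] with s hs
    rw [hy2 s hs 0 ⟨le_rfl, zero_le_one⟩, sub_zero, (hwp s hs).runFlow_one]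
  have haeq : ∀ᵐ s ∂P, ∀ t ∈ Icc (0 : ℝ) 1, y s (1 - t) = runFlow (V s) (X s) t ∧
      w s (1 - t) = V s t (runFlow (V s) (X s) t) := by
    filter_upwards [hae] with s hs t ht
    have ht' : 1 - t ∈ Icc (0 : ℝ) 1 := ⟨by linarith [ht.2], by linarith [ht.1]⟩
    rw [hy2 s hs _ ht', hw1 s hs, indicator_of_mem ht', sub_sub_cancel]
    exact ⟨rfl, rfl⟩
  refine ⟨y, w, hym, hwm, hint, hpos, hw0, hstart, haeq, ?_⟩
  have hjoint : ∀ t ∈ Icc (0 : ℝ) 1, ∫⁻ z, ‖z.2.2‖ₑ ∂(jointLaw P V X t) =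
      ∫⁻ s, ‖w s (1 - t)‖ₑ ∂P := by
    intro t ht
    have e : jointLaw P V X t = P.map fun s => (y s 0, y s (1 - t), w s (1 - t)) := by
      refine Measure.map_congr ?_
      filter_upwards [hstart, haeq] with s h1 h2
      rw [h1, (h2 t ht).1, (h2 t ht).2]
    have hslice : ∀ r : ℝ, Measurable fun s : S => (s, r) := fun r => by fun_prop
    have hF : Measurable fun s => (y s 0, y s (1 - t), w s (1 - t)) :=
      (hym.comp (hslice 0)).prodMk ((hym.comp (hslice _)).prodMk (hwm.comp (hslice _)))
    rw [e, lintegral_map measurable_snd.snd.enorm hF]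
  have h1 := h.integrable_velocity
  rw [setLIntegral_congr_fun measurableSet_Icc hjoint] at h1
  refine ne_of_lt (lt_of_le_of_lt (le_of_eq ?_) h1)
  rw [lintegral_lintegral_swap hwm.enorm.aemeasurable,
    ← lintegral_sub_left_eq_self (fun r => ∫⁻ s, ‖w s r‖ₑ ∂P) 1, ← lintegral_indicator
      measurableSet_Icc]
  refine lintegral_congr fun t => ?_
  by_cases ht : t ∈ Icc (0 : ℝ) 1
  · rw [indicator_of_mem ht]
  · rw [indicator_of_notMem ht]
    have : 1 - t ∉ Icc (0 : ℝ) 1 := fun h' => ht ⟨by linarith [h'.2], by linarith [h'.1]⟩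
    simp [hw0 _ _ this]

namespace IsReversal

variable {y w : S → ℝ → EuclideanSpace ℝ (Fin d)}

lemma measurable_position_at (h : IsReversal P V X y w) (r : ℝ) : Measurable fun s => y s r :=
  h.measurable_position.comp (by fun_prop : Measurable fun s : S => (s, r))

lemma measurable_velocity_at (h : IsReversal P V X y w) (r : ℝ) : Measurable fun s => w s r :=
  h.measurable_velocity.comp (by fun_prop : Measurable fun s : S => (s, r))

lemma ae_integrable [SFinite P] (h : IsReversal P V X y w) :
    ∀ᵐ r, Integrable (fun s => w s r) P := by
  have h1 := h.lintegral_velocity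
  have hm : Measurable fun p : S × ℝ => ‖w p.1 p.2‖ₑ := h.measurable_velocity.enorm
  rw [lintegral_lintegral_swap hm.aemeasurable] at h1
  filter_upwards [ae_lt_top hm.lintegral_prod_left' h1] with r hr
  exact ⟨(h.measurable_velocity_at r).aestronglyMeasurable, hr⟩

lemma position_of_nonpos (h : IsReversal P V X y w) (s : S) {r : ℝ} (hr : r ≤ 0) :
    y s r = y s 0 := by
  rw [h.position_eq s r, intervalIntegral.integral_symm, intervalIntegral.integral_of_le hr,
    ← integral_Ico_eq_integral_Ioc, setIntegral_eq_zero_of_forall_eq_zero, neg_zero, add_zero]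
  exact fun u hu => h.velocity_eq_zero s u fun hu' => absurd hu.2 (not_lt.2 hu'.1)

lemma position_sub (h : IsReversal P V X y w) (s : S) (a b : ℝ) :
    y s b - y s a = ∫ r in a..b, w s r := by
  rw [h.position_eq s b, h.position_eq s a, add_sub_add_left_eq_sub,
    intervalIntegral.integral_interval_sub_left (h.integrable s).intervalIntegrable
      (h.integrable s).intervalIntegrable]

lemma position_of_one_le (h : IsReversal P V X y w) (s : S) {r : ℝ} (hr : 1 ≤ r) :
    y s r = y s 1 := by
  rw [← sub_eq_zero, h.position_sub, intervalIntegral.integral_of_le hr,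
    setIntegral_eq_zero_of_forall_eq_zero]
  exact fun u hu => h.velocity_eq_zero s u fun hu' => absurd hu.1 (not_lt.2 hu'.2)

/-- A field is a marginal flow if and only if at almost every time it is the mean of the
conditional distribution of the velocity given the position. -/
lemma isMarginalFlow_iff [IsFiniteMeasure P] (h : IsReversal P V X y w) {vs : FlowField d}
    (hvs : Measurable fun z : ℝ × EuclideanSpace ℝ (Fin d) => vs z.1 z.2) :
    IsMarginalFlow P V X vs ↔ ∀ᵐ t ∂(volume.restrict (Icc (0 : ℝ) 1)),
      vs t =ᵐ[P.map fun s => y s (1 - t)]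
        fun x => ∫ u, u ∂condDistrib (fun s => w s (1 - t)) (fun s => y s (1 - t)) P x := by
  rw [IsMarginalFlow, and_iff_right hvs]
  have hi : ∀ᵐ t : ℝ, Integrable (fun s => w s (1 - t)) P :=
    (quasiMeasurePreserving_sub_left volume (1 : ℝ)).ae h.ae_integrable
  refine eventually_congr ?_
  filter_upwards [ae_restrict_of_ae hi, ae_restrict_mem measurableSet_Icc] with t hti ht
  have hvt : Measurable (vs t) := hvs.comp
    (by fun_prop : Measurable fun x : EuclideanSpace ℝ (Fin d) => (t, x))
  have hF : Measurable fun s => (y s 0, y s (1 - t), w s (1 - t)) :=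
    (h.measurable_position_at 0).prodMk
      ((h.measurable_position_at _).prodMk (h.measurable_velocity_at _))
  rw [h.map_eq_jointLaw ht]
  set μ := P.map fun s => (y s 0, y s (1 - t), w s (1 - t)) with hμ
  have : IsFiniteMeasure μ := Measure.isFiniteMeasure_map _ _
  have hint : Integrable (fun z => z.2.2) μ :=
    (integrable_map_measure (by fun_prop) hF.aemeasurable).2 hti
  refine (comp_ae_eq_condExp_iff (μ := μ) (X := fun z => z.2.1) (Y := fun z => z.2.2)
    measurable_snd.fst hint hvt).trans ?_
  have e1 : μ.map (fun z => z.2.1) = P.map fun s => y s (1 - t) :=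
    Measure.map_map (by fun_prop) hF
  have e2 : μ.map (fun z => (z.2.1, z.2.2)) = P.map fun s => (y s (1 - t), w s (1 - t)) :=
    Measure.map_map (by fun_prop) hF
  -- A conditional distribution depends only on the joint law.
  have e3 : condDistrib (fun z => z.2.2) (fun z => z.2.1) μ =
      condDistrib (fun s => w s (1 - t)) (fun s => y s (1 - t)) P := by
    rw [condDistrib, condDistrib]
    congr 1
  rw [e1, e3]

/-- Conditioning at each time separately would not control measurability in time. Instead the joint
laws of position and velocity form a kernel with parameter `t`, and disintegrating it gives
conditional laws jointly measurable in `(t, x)`; their means are the field. -/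
theorem exists_isMarginalFlow [IsProbabilityMeasure P] (h : IsReversal P V X y w) :
    ∃ vs, IsMarginalFlow P V X vs := by
  have hF : Measurable fun p : ℝ × S => (y p.2 (1 - p.1), w p.2 (1 - p.1)) :=
    (h.measurable_position.comp (by fun_prop : Measurable fun p : ℝ × S => (p.2, 1 - p.1))).prodMk
      (h.measurable_velocity.comp (by fun_prop : Measurable fun p : ℝ × S => (p.2, 1 - p.1)))
  let κ : Kernel ℝ (EuclideanSpace ℝ (Fin d) × EuclideanSpace ℝ (Fin d)) :=
    (Kernel.id ×ₖ Kernel.const ℝ P).map fun p : ℝ × S => (y p.2 (1 - p.1), w p.2 (1 - p.1))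
  have hκ : ∀ t, κ t = P.map fun s => (y s (1 - t), w s (1 - t)) := by
    intro t
    simp only [κ]
    rw [Kernel.map_apply _ hF, Kernel.prod_apply, Kernel.id_apply, Kernel.const_apply,
      Measure.dirac_prod, Measure.map_map hF (by fun_prop)]
    rfl
  have : IsMarkovKernel κ := Kernel.IsMarkovKernel.map _ hF
  let vs : FlowField d := fun t x => ∫ u, u ∂κ.condKernel (t, x)
  have hvs : Measurable fun z : ℝ × EuclideanSpace ℝ (Fin d) => vs z.1 z.2 :=
    (StronglyMeasurable.integral_kernel (κ := κ.condKernel)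
      (stronglyMeasurable_id : StronglyMeasurable fun u : EuclideanSpace ℝ (Fin d) => u)).measurable
  refine ⟨vs, (h.isMarginalFlow_iff hvs).2 (ae_of_all _ fun t => ?_)⟩
  have hm : Measurable (Prod.mk t : EuclideanSpace ℝ (Fin d) → _) := by fun_prop
  have hd := condDistrib_ae_eq_of_measure_eq_compProd (μ := P) (fun s => y s (1 - t))
    (h.measurable_velocity_at (1 - t)).aemeasurable (κ := κ.condKernel.comap (Prod.mk t) hm) (by
      rw [← hκ]
      nth_rw 1 [← κ.disintegrate κ.condKernel]
      rw [Kernel.compProd_apply_eq_compProd_sectR]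
      have : κ.fst t = P.map fun s => y s (1 - t) := by
        rw [Kernel.fst_apply, hκ, Measure.map_map measurable_fst
          ((h.measurable_position_at _).prodMk (h.measurable_velocity_at _))]
        rfl
      rw [this]
      rfl)
  filter_upwards [hd] with x hx
  rw [hx]
  rfl

end IsReversal

end Reversal

lemma enorm_prodMk {F G : Type*} [SeminormedAddCommGroup F] [SeminormedAddCommGroup G] (a : F)
    (b : G) : ‖(a, b)‖ₑ = max ‖a‖ₑ ‖b‖ₑ := by
  simp only [enorm_eq_nnnorm, Prod.nnnorm_mk, ENNReal.coe_max]

/-! ### From marginal flows to transport -/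

section Combining

variable {d : ℕ} {S : Type*} [MeasurableSpace S] {P : Measure S} {V : S → FlowField d}
  {X : S → EuclideanSpace ℝ (Fin d)}

namespace IsReversal

variable {y w : S → ℝ → EuclideanSpace ℝ (Fin d)}

/-- The time reversal of a field on `[0, 1]`, extended by zero. -/
noncomputable def reversedField (vs : FlowField d) : FlowField d :=
  fun r x => indicator (Icc (0 : ℝ) 1) (fun r => vs (1 - r) x) r

lemma measurable_reversedField {vs : FlowField d}
    (hvs : Measurable fun z : ℝ × EuclideanSpace ℝ (Fin d) => vs z.1 z.2) :
    Measurable fun z : ℝ × EuclideanSpace ℝ (Fin d) => reversedField vs z.1 z.2 := by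
  have : (fun z : ℝ × EuclideanSpace ℝ (Fin d) => reversedField vs z.1 z.2) =
      indicator (Icc (0 : ℝ) 1 ×ˢ univ) fun z => vs (1 - z.1) z.2 := by
    ext1 z
    by_cases hz : z.1 ∈ Icc (0 : ℝ) 1
    · rw [reversedField, indicator_of_mem hz, indicator_of_mem (by exact ⟨hz, trivial⟩)]
    · rw [reversedField, indicator_of_notMem hz, indicator_of_notMem (fun h' => hz h'.1)]
  rw [this]
  exact (hvs.comp (by fun_prop : Measurable fun z : ℝ × EuclideanSpace ℝ (Fin d) =>
    (1 - z.1, z.2))).indicator (measurableSet_Icc.prod MeasurableSet.univ)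

/-- Outside `[0, 1]` both velocity and field vanish, so the relation holds at almost every real
time; this is what the shifted grid needs in order to see it at all its points. -/
lemma ae_condExp_velocity [IsProbabilityMeasure P] (h : IsReversal P V X y w) {vs : FlowField d}
    (hvs : IsMarginalFlow P V X vs) :
    ∀ᵐ r, Integrable (fun s => w s r) P ∧
      P[fun s => w s r | MeasurableSpace.comap (fun s => y s r) inferInstance] =ᵐ[P]
        fun s => reversedField vs r (y s r) := by
  have h1 := (h.isMarginalFlow_iff hvs.1).1 hvs
  rw [ae_restrict_iff' measurableSet_Icc] at h1
  filter_upwards [(quasiMeasurePreserving_sub_left volume (1 : ℝ)).ae h1, h.ae_integrable]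
    with r hr hi
  refine ⟨hi, ?_⟩
  by_cases hr1 : r ∈ Icc (0 : ℝ) 1
  · have h2 := hr ⟨by linarith [hr1.2], by linarith [hr1.1]⟩
    rw [sub_sub_cancel] at h2
    simp only [reversedField, indicator_of_mem hr1]
    exact ((comp_ae_eq_condExp_iff (h.measurable_position_at r) hi (hvs.1.comp
      (by fun_prop : Measurable fun x : EuclideanSpace ℝ (Fin d) => (1 - r, x)))).2 h2).symm
  · have e : (fun s => w s r) = 0 := funext fun s => h.velocity_eq_zero s r hr1
    simp only [reversedField, indicator_of_notMem hr1]
    rw [e, condExp_zero]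
    rfl

/-- Contraction of conditional expectation in `L¹`, at almost every time. -/
lemma lintegral_reversedField_ne_top [IsProbabilityMeasure P] (h : IsReversal P V X y w)
    {vs : FlowField d} (hvs : IsMarginalFlow P V X vs) :
    ∫⁻ s, (∫⁻ r, ‖reversedField vs r (y s r)‖ₑ) ∂P ≠ ⊤ := by
  have hm : Measurable fun p : S × ℝ => ‖reversedField vs p.2 (y p.1 p.2)‖ₑ :=
    ((measurable_reversedField hvs.1).comp
      (measurable_snd.prodMk h.measurable_position)).enorm
  refine ne_top_of_le_ne_top h.lintegral_velocity ?_
  rw [lintegral_lintegral_swap (f := fun s r => ‖reversedField vs r (y s r)‖ₑ) hm.aemeasurable,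
    lintegral_lintegral_swap (f := fun s r => ‖w s r‖ₑ) h.measurable_velocity.enorm.aemeasurable]
  refine lintegral_mono_ae ?_
  filter_upwards [h.ae_condExp_velocity hvs] with r hr
  have h1 := eLpNorm_condExp_le_eLpNorm (μ := P) (p := 1)
    (m := MeasurableSpace.comap (fun s => y s r) inferInstance) (fun s => w s r) le_rfl
  rw [eLpNorm_congr_ae hr.2, eLpNorm_one_eq_lintegral_enorm, eLpNorm_one_eq_lintegral_enorm] at h1
  exact h1

/-- Superposition principle for a marginal flow: the laws of the end points of the random flow are
joined by random trajectories of the marginal flow. -/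
theorem exists_superposition [IsProbabilityMeasure P] (h : IsReversal P V X y w)
    {vs : FlowField d} (hvs : IsMarginalFlow P V X vs) :
    ∃ Q : Measure (ℚ → EuclideanSpace ℝ (Fin d)), IsProbabilityMeasure Q ∧
      Q.map (fun ω => ω 0) = P.map (fun s => y s 0) ∧
      Q.map (fun ω => ω 2) = P.map (fun s => y s 1) ∧
      ∀ᵐ ω ∂Q, ∃ γ, IsTrajectory vs (ω 0) γ ∧ γ 0 = ω 2 := by
  set b := reversedField vs with hb
  have hbm : Measurable fun z : ℝ × EuclideanSpace ℝ (Fin d) => b z.1 z.2 :=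
    measurable_reversedField hvs.1
  have hbym : Measurable fun p : S × ℝ => b p.2 (y p.1 p.2) :=
    hbm.comp (measurable_snd.prodMk h.measurable_position)
  have hbfin := h.lintegral_reversedField_ne_top hvs
  -- Velocity and field are treated as one process with values in a product, so that a single shift
  -- and a single subsequence serve both.
  obtain ⟨U, hU, hp, φ, hφ, hlim⟩ := exists_good_shift (P := P)
    (f := fun p : S × ℝ => (w p.1 p.2, b p.2 (y p.1 p.2)))
    (h.measurable_velocity.prodMk hbym) (by
      have hle : ∫⁻ s, (∫⁻ r, ‖(w s r, b r (y s r))‖ₑ) ∂P ≤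
          ∫⁻ s, (∫⁻ r, ‖w s r‖ₑ) ∂P + ∫⁻ s, (∫⁻ r, ‖b r (y s r)‖ₑ) ∂P := by
        have hw : Measurable fun s => ∫⁻ r, ‖w s r‖ₑ :=
          h.measurable_velocity.enorm.lintegral_prod_right'
        rw [← lintegral_add_left hw]
        refine lintegral_mono fun s => ?_
        have hws : Measurable fun r => ‖w s r‖ₑ := (h.measurable_velocity.comp
          (by fun_prop : Measurable fun r : ℝ => (s, r))).enorm
        rw [← lintegral_add_left hws]
        refine lintegral_mono fun r => ?_
        rw [enorm_prodMk]
        exact max_le_add_of_nonneg zero_le zero_le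
      exact ne_top_of_le_ne_top (ENNReal.add_ne_top.2 ⟨h.lintegral_velocity, hbfin⟩) hle)
    (h.ae_condExp_velocity hvs)
  have hsh : Measurable fun p : S × ℝ => (p.1, p.2 - U) := by fun_prop
  -- The motion now takes place during `[U, 1 + U]`, inside `[0, 2]` whatever the shift; the process
  -- is at rest before and after, so its values at `0` and `2` are the end points.
  have hproc : IsVelocityProcess P (fun s r => y s (r - U)) (fun s r => w s (r - U))
      (fun r x => b (r - U) x) :=
    { measurable_position := h.measurable_position.comp hsh
      measurable_velocity := h.measurable_velocity.comp hsh
      measurable_field := hbm.comp (by fun_prop :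
        Measurable fun p : ℝ × EuclideanSpace ℝ (Fin d) => (p.1 - U, p.2))
      intervalIntegrable := fun s a c => ((h.integrable s).comp_sub_right U).intervalIntegrable
      integral_velocity := fun s a c => by
        rw [h.position_sub, intervalIntegral.integral_comp_sub_right (w s)]
      lintegral_velocity := by
        refine ne_of_eq_of_ne (lintegral_congr fun s => ?_) h.lintegral_velocity
        exact lintegral_sub_right_eq_self (fun r => ‖w s r‖ₑ) U
      lintegral_field := by
        refine ne_of_eq_of_ne (lintegral_congr fun s => ?_) hbfin
        exact lintegral_sub_right_eq_self (fun r => ‖b r (y s r)‖ₑ) U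
      integrable_velocity := fun q => (hp q).1
      condExp_velocity := fun q => (hp q).2 }
  obtain ⟨Q, hQ, hQ0, hQ2, hQγ⟩ := hproc.exists_superposition hφ
    (tendsto_of_tendsto_of_tendsto_of_le_of_le tendsto_const_nhds hlim (fun _ => zero_le)
      fun n => lintegral_mono fun r => lintegral_mono fun s => by
        rw [Prod.mk_sub_mk, enorm_prodMk]; exact le_max_left _ _)
    (tendsto_of_tendsto_of_tendsto_of_le_of_le tendsto_const_nhds hlim (fun _ => zero_le)
      fun n => lintegral_mono fun r => lintegral_mono fun s => by
        rw [Prod.mk_sub_mk, enorm_prodMk]; exact le_max_right _ _)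
  refine ⟨Q, hQ, ?_, ?_, ?_⟩
  · rw [hQ0]
    congr 1
    funext s
    exact h.position_of_nonpos s (by linarith [hU.1])
  · rw [hQ2]
    congr 1
    funext s
    exact h.position_of_one_le s (by linarith [hU.2])
  filter_upwards [hQγ] with ω ⟨γ, hγ0, hγ2, hint, hγ⟩
  have hb0 : ∀ r, r < U ∨ 1 + U < r → b (r - U) (γ r) = 0 := by
    intro r hr
    refine indicator_of_notMem (fun h' => ?_) _
    rcases hr with hr | hr
    · linarith [h'.1]
    · linarith [h'.2]
  have hsub : ∀ {a c : ℝ}, 0 ≤ a → a ≤ c → c ≤ 2 →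
      IntervalIntegrable (fun r => b (r - U) (γ r)) volume a c := by
    intro a c h1 h2 h3
    refine hint.mono_set ?_
    rw [uIcc_of_le h2, uIcc_of_le zero_le_two]
    exact Icc_subset_Icc h1 h3
  have hγU : γ U = γ 0 := by
    rw [hγ U ⟨hU.1, by linarith [hU.2]⟩, intervalIntegral.integral_of_le hU.1,
      ← integral_Ico_eq_integral_Ioc, setIntegral_eq_zero_of_forall_eq_zero, add_zero]
    exact fun r hr => hb0 r (Or.inl hr.2)
  have hdiff : ∀ {a c : ℝ}, 0 ≤ a → a ≤ c → c ≤ 2 →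
      γ c = γ a + ∫ r in a..c, b (r - U) (γ r) := by
    intro a c h1 h2 h3
    rw [hγ c ⟨h1.trans h2, h3⟩, hγ a ⟨h1, h2.trans h3⟩, add_assoc,
      intervalIntegral.integral_add_adjacent_intervals (hsub le_rfl h1 (h2.trans h3))
        (hsub h1 h2 h3)]
  have hγ1 : γ (1 + U) = γ 2 := by
    rw [hdiff (a := 1 + U) (c := 2) (by linarith [hU.1]) (by linarith [hU.2]) le_rfl,
      intervalIntegral.integral_of_le (by linarith [hU.2]), setIntegral_eq_zero_of_forall_eq_zero,
      add_zero]
    exact fun r hr => hb0 r (Or.inr hr.1)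
  have hfield : ∀ t ∈ Icc (0 : ℝ) 1, b (1 + U - t - U) (γ (1 + U - t)) =
      vs t (γ (1 + U - t)) := by
    intro t ht
    have e : 1 + U - t - U = 1 - t := by ring
    have ht' : 1 - t ∈ Icc (0 : ℝ) 1 := ⟨by linarith [ht.2], by linarith [ht.1]⟩
    rw [e, hb, reversedField, indicator_of_mem ht', sub_sub_cancel]
  -- Undo the shift and the reversal together; `γ` is constant on `[0, U]` and `[1 + U, 2]`, so its
  -- end points are those of the trajectory.
  refine ⟨fun t => γ (1 + U - t), ⟨?_, ?_⟩, by simp only [sub_zero, hγ1, hγ2]⟩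
  · have h1 : IntervalIntegrable (fun r => b (r - U) (γ r)) volume U (1 + U) :=
      hsub hU.1 (by linarith) (by linarith [hU.2])
    have h2 := h1.comp_sub_left (1 + U)
    rw [add_sub_cancel_right, sub_self] at h2
    refine h2.symm.congr_ae ?_
    filter_upwards [ae_restrict_mem measurableSet_uIoc] with t ht
    rw [uIoc_of_le zero_le_one] at ht
    exact hfield t ⟨ht.1.le, ht.2⟩
  · intro t ht
    have e1 := intervalIntegral.integral_comp_sub_left (a := t) (b := 1)
      (fun r => b (r - U) (γ r)) (1 + U)
    rw [show 1 + U - 1 = U by ring] at e1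
    have e2 : ∫ s in t..1, vs s (γ (1 + U - s)) =
        ∫ s in t..1, b (1 + U - s - U) (γ (1 + U - s)) := by
      refine intervalIntegral.integral_congr fun s hs => ?_
      rw [uIcc_of_le ht.2] at hs
      exact (hfield s ⟨ht.1.trans hs.1, hs.2⟩).symm
    rw [e2, e1, ← hγ0, ← hγU]
    exact hdiff hU.1 (by linarith [ht.2]) (by linarith [hU.2, ht.1])

end IsReversal

/-- If a function of a random variable `X₁` is almost surely equal to a random variable `X₀` then
it is almost everywhere measurable for the law of `X₁`. -/
lemma aemeasurable_of_comp_ae_eq {Ω F : Type*} [MeasurableSpace Ω] [StandardBorelSpace Ω]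
    [Nonempty Ω] {β : Type*} [MeasurableSpace β] [MeasurableEq β] [NormedAddCommGroup F]
    [NormedSpace ℝ F] [CompleteSpace F] [SecondCountableTopology F] [MeasurableSpace F]
    [BorelSpace F] {Q : Measure Ω} [IsProbabilityMeasure Q] {X₁ : Ω → β} {X₀ : Ω → F} {f : β → F}
    (h1 : Measurable X₁) (h0 : Measurable X₀) (hf : ∀ᵐ ω ∂Q, f (X₁ ω) = X₀ ω) :
    AEMeasurable f (Q.map X₁) := by
  set G := (toMeasurable Q {ω | ¬ f (X₁ ω) = X₀ ω})ᶜ with hG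
  have hGm : MeasurableSet G := (measurableSet_toMeasurable _ _).compl
  have hGf : ∀ ω ∈ G, f (X₁ ω) = X₀ ω := fun ω hω => not_not.1 fun h' =>
    hω (subset_toMeasurable _ _ h')
  have hGQ : ∀ᵐ ω ∂Q, ω ∈ G := by
    rw [ae_iff]
    simpa [hG, measure_toMeasurable] using ae_iff.1 hf
  -- Given `X₁ = x`, the variable `X₀` is almost surely the constant `f x`, so its conditional mean
  -- is a measurable version of `f`. The event used to show this avoids `f`, whose measurability is
  -- not known.
  have hmeas : MeasurableSet {p : β × Ω | p.1 = X₁ p.2 ∧ p.2 ∈ G} :=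
    (measurableSet_eq_fun measurable_fst (h1.comp measurable_snd)).inter (measurable_snd hGm)
  have hp : ∀ᵐ p ∂((Q.map X₁) ⊗ₘ condDistrib id X₁ Q), p.1 = X₁ p.2 ∧ p.2 ∈ G := by
    rw [compProd_map_condDistrib aemeasurable_id,
      ae_map_iff (h1.prodMk measurable_id).aemeasurable hmeas]
    exact hGQ.mono fun ω hω => ⟨rfl, hω⟩
  have hP : IsProbabilityMeasure (Q.map X₁) := Measure.isProbabilityMeasure_map h1.aemeasurable
  have hκ := Measure.ae_ae_of_ae_compProd hp
  have hsm : StronglyMeasurable fun x => ∫ ω, X₀ ω ∂condDistrib id X₁ Q x :=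
    StronglyMeasurable.integral_condDistrib (f := fun p : β × Ω => X₀ p.2)
      (h0.comp measurable_snd).stronglyMeasurable
  refine ⟨_, hsm.measurable, ?_⟩
  filter_upwards [hκ] with x hx
  have : ∀ᵐ ω ∂condDistrib id X₁ Q x, X₀ ω = f x := by
    filter_upwards [hx] with ω hω
    rw [hω.1, hGf ω hω.2]
  rw [integral_congr_ae this]
  simp

/-- A well posed marginal flow transports the law of the initial points of a random flow to the law
of its final points. -/
theorem IsMarginalFlow.transports [IsProbabilityMeasure P] (h : IsRegularRandomFlow P V X)
    {vs : FlowField d} (hvs : IsMarginalFlow P V X vs)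
    (hwp : ∀ᵐ x₁ ∂(P.map X), WellPosedAt vs x₁) :
    Transports vs (P.map X) (P.map fun s => runFlow (V s) (X s) 0) := by
  obtain ⟨y, w, hyw⟩ := h.exists_isReversal
  obtain ⟨Q, hQ, hQ0, hQ2, hQγ⟩ := hyw.exists_superposition hvs
  rw [Measure.map_congr hyw.start_ae_eq] at hQ0
  have hy1 : (fun s => y s 1) =ᵐ[P] fun s => runFlow (V s) (X s) 0 := by
    filter_upwards [hyw.ae_eq] with s hs
    simpa using (hs 0 ⟨le_rfl, zero_le_one⟩).1
  rw [Measure.map_congr hy1] at hQ2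
  have hm : ∀ q : ℚ, Measurable fun ω : ℚ → EuclideanSpace ℝ (Fin d) => ω q :=
    fun q => measurable_pi_apply q
  rw [← hQ0] at hwp
  -- Uniqueness turns the random trajectories of the superposition into a deterministic function of
  -- the initial point.
  have hf : ∀ᵐ ω ∂Q, runFlow vs (ω 0) 0 = ω 2 := by
    filter_upwards [hQγ, ae_of_ae_map (hm 0).aemeasurable hwp] with ω ⟨γ, hγ, hγ0⟩ hω
    rw [hω.eqOn_runFlow hγ ⟨le_rfl, zero_le_one⟩, hγ0]
  have hae : AEMeasurable (fun x₁ => runFlow vs x₁ 0) (Q.map fun ω => ω 0) :=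
    aemeasurable_of_comp_ae_eq (hm 0) (hm 2) hf
  rw [← hQ0, ← hQ2]
  refine ⟨hwp, hae, ?_⟩
  rw [finalLaw, AEMeasurable.map_map_of_aemeasurable hae (hm 0).aemeasurable]
  exact Measure.map_congr hf

lemma IsRegularRandomFlow.exists_isMarginalFlow [IsProbabilityMeasure P]
    (h : IsRegularRandomFlow P V X) : ∃ vs, IsMarginalFlow P V X vs := by
  obtain ⟨y, w, hyw⟩ := h.exists_isReversal
  exact hyw.exists_isMarginalFlow

/-- The law of a function of `(ω, x)` is the mixture of its conditional laws. -/
lemma map_compProd_eq_bind {Ω α β : Type*} [MeasurableSpace Ω] [MeasurableSpace α]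
    [MeasurableSpace β] {Γ : Measure Ω} [IsProbabilityMeasure Γ] {q : Kernel Ω α}
    [IsMarkovKernel q] {f : Ω × α → β} (hf : AEMeasurable f (Γ ⊗ₘ q)) :
    (Γ ⊗ₘ q).map f = Γ.bind fun ω => (q ω).map fun x => f (ω, x) := by
  obtain ⟨g, hg, hfg⟩ := hf
  -- A measurable version of `f` makes the conditional laws a kernel; they change only for a
  -- `Γ`-null set of `ω`.
  have e : (fun ω => (q ω).map fun x => f (ω, x)) =ᵐ[Γ]
      fun ω => (q ω).map fun x => g (ω, x) := by
    filter_upwards [Measure.ae_ae_of_ae_compProd hfg] with ω hω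
    exact Measure.map_congr hω
  have hk : (fun ω => (q ω).map fun x => g (ω, x)) =
      ((Kernel.id ×ₖ q).map (g) : Kernel Ω β) := by
    funext ω
    rw [Kernel.map_apply _ hg, Kernel.prod_apply, Kernel.id_apply,
      Measure.dirac_prod, Measure.map_map hg (by fun_prop)]
    rfl
  have e2 : Γ.bind (fun ω => (q ω).map fun x => f (ω, x)) =
      Γ.bind fun ω => (q ω).map fun x => g (ω, x) := by
    rw [Measure.bind, Measure.map_congr e, Measure.bind]
  rw [Measure.map_congr hfg, e2, hk, Measure.compProd_eq_comp_prod,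
    Measure.map_comp _ _ hg]

end Combining

/-! ### The two cases of the combining lemma -/

theorem mainTheorem4 (d : ℕ) :
    (∀ (Ω : Type*) [MeasurableSpace Ω] (Γ : Measure Ω) [IsProbabilityMeasure Γ]
        (v : Ω → FlowField d) (q : Kernel Ω (EuclideanSpace ℝ (Fin d))) [IsMarkovKernel q],
      IsRegularRandomFlow (Γ ⊗ₘ q) (fun z => v z.1) (fun z => z.2) →
      (∃ vs : FlowField d, IsMarginalFlow (Γ ⊗ₘ q) (fun z => v z.1) (fun z => z.2) vs) ∧
      ∀ vs : FlowField d, IsMarginalFlow (Γ ⊗ₘ q) (fun z => v z.1) (fun z => z.2) vs →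
        (∀ᵐ x₁ ∂(Γ.bind q), WellPosedAt vs x₁) →
        Transports vs (Γ.bind q) (Γ.bind (fun ω => finalLaw (v ω) (q ω)))) ∧
    (∀ (q p : Measure (EuclideanSpace ℝ (Fin d))) [IsProbabilityMeasure q] [IsProbabilityMeasure p]
        (C : Measure (EuclideanSpace ℝ (Fin d) × EuclideanSpace ℝ (Fin d)))
        (u : EuclideanSpace ℝ (Fin d) → EuclideanSpace ℝ (Fin d) → FlowField d),
      C.fst = q → C.snd = p →
      (∀ᵐ z ∂C, IsPointwiseFlow (u z.1 z.2) z.1 z.2) →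
      IsRegularRandomFlow C (fun z => u z.1 z.2) (fun z => z.1) →
      (∃ vs : FlowField d, IsMarginalFlow C (fun z => u z.1 z.2) (fun z => z.1) vs) ∧
      ∀ vs : FlowField d, IsMarginalFlow C (fun z => u z.1 z.2) (fun z => z.1) vs →
        (∀ᵐ x₁ ∂q, WellPosedAt vs x₁) → Transports vs q p) := by
  constructor
  · intro Ω _ Γ _ v q _ h
    refine ⟨h.exists_isMarginalFlow, fun vs hvs hwp => ?_⟩
    have e1 : (Γ ⊗ₘ q).map (fun z => z.2) = Γ.bind q := Measure.snd_compProd Γ q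
    have e2 : (Γ ⊗ₘ q).map (fun z => runFlow (v z.1) z.2 0) =
        Γ.bind (fun ω => finalLaw (v ω) (q ω)) :=
      map_compProd_eq_bind (h.aemeasurable_position 0 ⟨le_rfl, zero_le_one⟩)
    rw [← e1] at hwp ⊢
    rw [← e2]
    exact hvs.transports h hwp
  · intro q p _ _ C u hq hp hu h
    -- The total mass of the coupling is that of its first marginal.
    have : IsProbabilityMeasure C := by
      refine ⟨?_⟩
      rw [← Measure.fst_univ, hq, measure_univ]
    refine ⟨h.exists_isMarginalFlow, fun vs hvs hwp => ?_⟩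
    -- A pointwise flow ends almost surely at the second coordinate, so the final law is the second
    -- marginal.
    have e : C.map (fun z => runFlow (u z.1 z.2) z.1 0) = p := by
      rw [← hp, Measure.snd]
      exact Measure.map_congr (hu.mono fun z hz => hz.2)
    rw [← hq] at hwp ⊢
    rw [← e]
    exact hvs.transports h hwp
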